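/- **Conventions.** $\lambda$ is the security parameter. A PPT algorithm is a probabilistic algorithm whose running time is, on every input and for all random choices, bounded by a polynomial in the input size (it may draw uniformly from $\{0,\dots,N\}$ for a number $N$ that it has computed). A function $f$ is negligible if for every $c\in\mathbb N$ there is an $N$ with $f(\lambda)<\lambda^{-c}$ for all $\lambda>N$. Let $n,m,k$ (in unary) and $q\ge 1$ (in binary) be functions of $\lambda$ that are computable in deterministic polynomial time from $1^\lambda$; write $[m]$ for the index set of size $m$, and $e_x$ for the unit vectors. **SIS.** The $(n,m,\beta_2,\beta_\infty)$-SIS problem (modulo $q$) is hard if every PPT algorithm that is given $1^\lambda$ and a uniformly random $A\in\mathbb Z_q^{n\times m}$ outputs only with negligible probability a vector $s\in\mathbb Z^m$ with $s\neq 0$, $\|s\|_2\le\beta_2$, $\|s\|_\infty\le\beta_\infty$ and $As=0$ in $\mathbb Z_q^n$. **Hash functions.** For all $\lambda$ and $t\ge1$ let $\mathcal R$ be a family of functions $r:[m]\to[2t]$, sampled by a PPT algorithm from $(1^\lambda,1^t)$ and evaluated by a deterministic polynomial-time algorithm, that is $t$-wise independent: for every $S\subseteq[m]$ with $|S|\le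 t$ and all $y_x\in[2t]$, $\Pr_r[\forall x\in S:\ r(x)=y_x]=(2t)^{-|S|}$. **Construction.** - $\mathsf{Sample}(1^\lambda,t)$: sample $r_1,\dots,r_k$ independently from $\mathcal R$ and a uniform $A\in\mathbb Z_q^{n\times m}$; return $f=((r_1,\dots,r_k),A)$. - $\mathsf{Encode}(f,X)$ for $X\subseteq[m]$: the table $H\in(\mathbb Z_q^n)^{k\times 2t}$ with $H[i,j]=\sum_{x\in X,\,r_i(x)=j}Ae_x$. - $\mathsf{Decode}(f,H_0,H_1)$: put $H:=H_0-H_1$, $X':=\emptyset$. In each round let $Z$ be the set of all pairs $(x,w)$ such that $w\in\{Ae_x,-Ae_x\}$ and $w$ is the content of some cell of $H$; add all $x$ with $(x,w)\in Z$ for some $w$ to $X'$; for every $(x,w)\in Z$ and every $i\in[k]$ subtract $w$ from $H[i,r_i(x)]$. The loop ends after the first round with $Z=\emptyset$; then return $X'$ if $H=0$, and $\bot$ otherwise. If the loop has not ended after $m+1$ rounds, return $\bot$. Write $\mathsf{Diff}(f,X_0,X_1)=\mathsf{Decode}(f,\mathsf{Encode}(f,X_0),\mathsf{Encode}(f,X_1))$.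 **Theorem.** Let $\mathcal R$ be as above, let $k\ge\max\{\lambda,\,2\log_{3/e}m\}$ for all $\lambda$, and assume that the $(n,m,\sqrt{m+3},3)$-SIS problem is hard. Then the construction is a robust set encoding for the universe $[m]$. That is: 1. $\mathsf{Sample}$ is computed by a PPT algorithm on input $(1^\lambda,1^t)$, and, for all $f$ in the range of $\mathsf{Sample}(1^\lambda,t)$ and all sets and tables, $\mathsf{Encode}$ and $\mathsf{Decode}$ are computed by deterministic polynomial-time algorithms (given $1^\lambda$, $1^t$ and their arguments). 2. For every PPT adversary $\mathcal A$ and every threshold $t=t(\lambda)\ge 1$ bounded by a polynomial in $\lambda$ (in particular every constant $t\geq 1$), the probability over $f\gets\mathsf{Sample}(1^\lambda,t)$ and $(X_0,X_1)\gets\mathcal A(1^\lambda,1^t,f)$ that $X'=\mathsf{Diff}(f,X_0,X_1)$ satisfies $$X'\notin\{X_0\triangle X_1,\bot\}\quad\text{or}\quad\bigl(|X_0\triangle X_1|<t\ \text{ and }\ X'=\bot\bigr)$$ is negligible in $\lambda$. Moreover, for all such $\mathcal A$ and $t$, the probability that the loop in the computation of $\mathsf{Diff}(f,X_0,X_1)$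 has not ended after $m+1$ rounds (with $f,X_0,X_1$ drawn as in 2) is negligible. -/

import Mathlib

open scoped Matrix

/-! ## Probabilistic algorithms with a step count

The algorithms are programs of a small WHILE language over finite binary trees with
natural numbers at the leaves, under a logarithmic cost measure: a number has the size of its
binary expansion, and every instruction is charged the total size of what it reads and
writes. All deterministic instructions are polynomial-time operations on their arguments, and
one-step moves of a Turing machine are short programs, so that "polynomial time" for these
programs is polynomial time for (probabilistic) Turing machines. The only random instruction
draws an element of an initial segment of the naturals uniformly at random. -/

/-- Data: binary trees with natural numbers at the leaves. -/
inductive Val : Type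
  | num : ℕ → Val
  | pair : Val → Val → Val
  deriving DecidableEq

namespace Val

/-- Size of a datum; numbers are measured in binary. -/
def size : Val → ℕ
  | num a => Nat.size a + 1
  | pair x y => x.size + y.size + 1

def fst : Val → Val
  | pair x _ => x
  | num _ => num 0

def snd : Val → Val
  | pair _ y => y
  | num _ => num 0

/-- A binary operation on numbers, applied to a pair of numbers (`0` on other data). -/
def arith (f : ℕ → ℕ → ℕ) : Val → Val
  | pair (num a) (num b) => num (f a b)
  | _ => num 0

/-- Equality test of the two components (`1` for equal). -/
def eqTest : Val → Val
  | pair x y => if x = y then num 1 else num 0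
  | num _ => num 0

/-- A list of data as a datum. -/
def ofList : List Val → Val
  | [] => num 0
  | x :: xs => pair x (ofList xs)

theorem ofList_injective : Function.Injective ofList := by
  intro a
  induction a with
  | nil => intro b h; cases b with
    | nil => rfl
    | cons y ys => simp [ofList] at h
  | cons x xs ih => intro b h; cases b with
    | nil => simp [ofList] at h
    | cons y ys =>
      simp only [ofList, pair.injEq] at h
      rw [h.1, ih h.2]

end Val

/-- The deterministic instructions. -/
inductive Instr : Type
  | id
  | const (v : Val)
  | fst
  | snd
  | add
  | sub
  | mul
  | div
  | mod
  | eq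

/-- The effect of a deterministic instruction (`sub` is truncated, `div` and `mod` are
division with remainder). -/
def Instr.eval : Instr → Val → Val
  | .id => fun x => x
  | .const v => fun _ => v
  | .fst => Val.fst
  | .snd => Val.snd
  | .add => Val.arith (· + ·)
  | .sub => Val.arith (· - ·)
  | .mul => Val.arith (· * ·)
  | .div => Val.arith (· / ·)
  | .mod => Val.arith (· % ·)
  | .eq => Val.eqTest

/-- Programs. Each program reads one datum and, if it halts, returns one datum. -/
inductive Prog : Type
  /-- a deterministic instruction -/
  | instr (f : Instr)
  /-- on input the number `N`, return a uniformly random element of `{0, …, N}` -/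
  | rand
  /-- first `p`, then `p'` on the result -/
  | seq (p p' : Prog)
  /-- run `p` and `p'` on the input and return the pair of the results -/
  | pair (p p' : Prog)
  /-- run `p` on the input if `c` returns a datum other than `0` on it, and `p'` otherwise -/
  | ite (c p p' : Prog)
  /-- replace the datum by the result of `p` on it, as long as `c` does not return `0` on it -/
  | loop (c p : Prog)

/-- The law of the outcome of a run: the returned datum together with the number of steps, or
`none` for a run that was cut off. -/
abbrev Outcome : Type := PMF (Option (Val × ℕ))

/-- Continue with `g`, adding up the numbers of steps. -/
noncomputable def Outcome.andThen (μ : Outcome) (g : Val → Outcome) : Outcome :=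
  μ.bind fun o => match o with
    | none => PMF.pure none
    | some (y, c) => (g y).map (Option.map fun z => (z.1, c + z.2))

/-- A loop with test `c` and body `p`, cut off after a given number of tests. -/
noncomputable def Outcome.loop (c p : Val → Outcome) : ℕ → Val → Outcome
  | 0, _ => PMF.pure none
  | T + 1, x => (c x).andThen fun b =>
      if b = Val.num 0 then PMF.pure (some (x, 1))
      else (p x).andThen (Outcome.loop c p T)

/-- The law of `rand`. -/
noncomputable def Val.uniform : Val → PMF Val
  | .num N => (PMF.uniformOfFintype (Fin (N + 1))).map fun a => Val.num a
  | .pair _ _ => PMF.pure (.num 0)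

/-- Run a program on a datum, where every execution of a loop is cut off after `T` tests. As
every test takes at least one step, a run of at most `T` steps is never cut off. -/
noncomputable def Prog.run (T : ℕ) : Prog → Val → Outcome
  | .instr f => fun x => PMF.pure (some (f.eval x, x.size + (f.eval x).size))
  | .rand => fun x => x.uniform.map fun y => some (y, x.size + y.size)
  | .seq p p' => fun x => (p.run T x).andThen (p'.run T)
  | .pair p p' => fun x => (p.run T x).andThen fun y => (p'.run T x).andThen fun z =>
      PMF.pure (some (Val.pair y z, 1))
  | .ite c p p' => fun x => (c.run T x).andThen fun b =>
      if b = Val.num 0 then p'.run T x else p.run T x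
  | .loop c p => fun x => Outcome.loop (c.run T) (p.run T) T x

/-- Every run of the program on `x` halts after at most `T` steps. -/
def Prog.HaltsWithin (p : Prog) (x : Val) (T : ℕ) : Prop :=
  ∀ o ∈ (p.run T x).support, ∃ y c, o = some (y, c) ∧ c ≤ T

/-- The program makes no random choices. -/
def Prog.IsDeterministic : Prog → Prop
  | .instr _ => True
  | .rand => False
  | .seq p p' => p.IsDeterministic ∧ p'.IsDeterministic
  | .pair p p' => p.IsDeterministic ∧ p'.IsDeterministic
  | .ite c p p' => c.IsDeterministic ∧ p.IsDeterministic ∧ p'.IsDeterministic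
  | .loop c p => c.IsDeterministic ∧ p.IsDeterministic

/-- A probabilistic polynomial-time algorithm: a program with a polynomial that bounds, on every
input and for all random choices, the number of steps in terms of the size of the input. -/
structure PPT where
  prog : Prog
  bound : Polynomial ℕ
  halts : ∀ x : Val, prog.HaltsWithin x (bound.eval x.size)

/-- The law of the output of a PPT algorithm on input `x`. (The cut off never happens here.) -/
noncomputable def PPT.law (B : PPT) (x : Val) : PMF Val :=
  (B.prog.run (B.bound.eval x.size) x).map fun o => (o.map Prod.fst).getD (Val.num 0)

def PPT.IsDeterministic (B : PPT) : Prop := B.prog.IsDeterministic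

/-! ## Representation of inputs and outputs -/

/-- An injective representation of the elements of a type by data. -/
class Enc (α : Type) where
  enc : α → Val
  enc_injective : Function.Injective enc

/-- Numbers that are handed over in unary notation. -/
structure Unary where
  val : ℕ

instance : Enc Val := ⟨fun v => v, fun _ _ h => h⟩

instance : Enc ℕ := ⟨Val.num, fun _ _ h => by simpa using h⟩

instance : Enc Bool := ⟨fun b => Val.num b.toNat, fun a b h => by
  cases a <;> cases b <;> simp_all⟩

instance : Enc Unary := ⟨fun a => Val.ofList (List.replicate a.val (Val.num 0)), fun a b h => by
  have := congrArg List.length (Val.ofList_injective h)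
  cases a; cases b; simpa using this⟩

/-- An integer is represented by its positive and its negative part. -/
instance : Enc ℤ := ⟨fun z => Val.pair (Val.num z.toNat) (Val.num (-z).toNat), fun a b h => by
  simp only [Val.pair.injEq, Val.num.injEq] at h
  omega⟩

instance (N : ℕ) : Enc (Fin N) := ⟨fun i => Val.num i, fun i j h => by
  simp only [Val.num.injEq] at h
  exact Fin.ext h⟩

/-- A residue is represented by its representative in `{0, …, N - 1}`. -/
instance (N : ℕ) [NeZero N] : Enc (ZMod N) := ⟨fun a => Val.num a.val, fun a b h => by
  simp only [Val.num.injEq] at h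
  exact ZMod.val_injective N h⟩

instance (α β : Type) [Enc α] [Enc β] : Enc (α × β) :=
  ⟨fun a => Val.pair (Enc.enc a.1) (Enc.enc a.2), fun a b h => by
    simp only [Val.pair.injEq] at h
    exact Prod.ext (Enc.enc_injective h.1) (Enc.enc_injective h.2)⟩

instance (α : Type) [Enc α] : Enc (Option α) :=
  ⟨fun a => match a with
    | none => Val.num 0
    | some x => Val.pair (Val.num 1) (Enc.enc x), fun a b h => by
    cases a <;> cases b <;> simp_all
    exact Enc.enc_injective h⟩

/-- A tuple is represented by the list of its entries. -/
instance (N : ℕ) (α : Type) [Enc α] : Enc (Fin N → α) :=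
  ⟨fun v => Val.ofList (List.ofFn fun i => Enc.enc (v i)), fun v w h => by
    have h1 := List.ofFn_injective (Val.ofList_injective h)
    funext i
    exact Enc.enc_injective (congrFun h1 i)⟩

/-- A matrix is represented by the list of its rows. -/
instance (N M : ℕ) (α : Type) [Enc α] : Enc (Matrix (Fin N) (Fin M) α) :=
  ⟨fun A => Enc.enc fun (i : Fin N) (j : Fin M) => A i j, fun A B h => by
    have h1 := Enc.enc_injective h
    ext i j
    exact congrFun (congrFun h1 i) j⟩

/-- A set of elements of `[M]` is represented by its characteristic vector. -/
instance (M : ℕ) : Enc (Finset (Fin M)) :=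
  ⟨fun X => Enc.enc fun x : Fin M => decide (x ∈ X), fun X Y h => by
    have h1 := Enc.enc_injective h
    ext x
    simpa using congrFun h1 x⟩

/-- The function is computed by a deterministic polynomial-time algorithm. -/
def EfficientlyComputable {α β : Type} [Enc α] [Enc β] (f : α → β) : Prop :=
  ∃ D : PPT, D.IsDeterministic ∧ ∀ a, D.law (Enc.enc a) = PMF.pure (Enc.enc (f a))

/-! ## Asymptotics and probabilities -/

/-- Negligible functions of the security parameter. -/
def Negligible (f : ℕ → ℝ) : Prop :=
  ∀ c : ℕ, ∃ N : ℕ, ∀ lam : ℕ, N < lam → f lam < 1 / (lam : ℝ) ^ c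

/-- Positive integers depending on the security parameter, bounded by a polynomial. -/
def PolyBounded (t : ℕ → ℕ+) : Prop :=
  ∃ P : Polynomial ℕ, ∀ lam, (t lam : ℕ) ≤ P.eval lam

/-- Probability of an event under a discrete law. -/
noncomputable def PMF.prob {Ω : Type} (μ : PMF Ω) (S : Set Ω) : ℝ := (μ.toOuterMeasure S).toReal

/-- The joint law of an element `a` that is drawn from `μ` and of the output of `B` on
`input a`. -/
noncomputable def PPT.experiment {Ω : Type} (B : PPT) (μ : PMF Ω) (input : Ω → Val) :
    PMF (Ω × Val) :=
  μ.bind fun a => (B.law (input a)).map fun v => (a, v)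

/-- The law of `N` independent samples of `μ`. -/
noncomputable def PMF.iid {Ω : Type} (μ : PMF Ω) : (N : ℕ) → PMF (Fin N → Ω)
  | 0 => PMF.pure Fin.elim0
  | N + 1 => μ.bind fun a => (PMF.iid μ N).map fun v => Fin.cons a v

/-! ## The short integer solution problem -/

/-- `s` is a solution of the SIS instance `A` for the norm bounds `β₂` and `βinf`. -/
def IsSISSolution {n m q : ℕ} (β₂ βinf : ℝ) (A : Matrix (Fin n) (Fin m) (ZMod q))
    (s : Fin m → ℤ) : Prop :=
  s ≠ 0 ∧ Real.sqrt (∑ i, (s i : ℝ) ^ 2) ≤ β₂ ∧ (∀ i, |(s i : ℝ)| ≤ βinf) ∧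
    A *ᵥ (fun i => (s i : ZMod q)) = 0

/-- The SIS problem with the given parameters (as functions of the security parameter) is hard:
every PPT algorithm solves uniformly random instances with negligible probability only. -/
def SISHard (n m q : ℕ → ℕ) [∀ lam, NeZero (q lam)] (β₂ βinf : ℕ → ℝ) : Prop :=
  ∀ B : PPT, Negligible fun lam =>
    (B.experiment
      (PMF.uniformOfFintype (Matrix (Fin (n lam)) (Fin (m lam)) (ZMod (q lam))))
      (fun A => Enc.enc (Unary.mk lam, A))).prob
      {z | ∃ s : Fin (m lam) → ℤ, z.2 = Enc.enc s ∧ IsSISSolution (β₂ lam) (βinf lam) z.1 s}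

/-! ## Hash families -/

/-- A family of hash functions `[m] → [2t]` for every security parameter and every `t ≥ 1`, with
a law on the descriptions of its members. -/
structure HashFamily (m : ℕ → ℕ) where
  sample : ℕ → ℕ+ → PMF Val
  hash : (lam : ℕ) → (t : ℕ+) → Val → Fin (m lam) → Fin (2 * t)

/-- The members are sampled, and evaluated, by efficient algorithms. -/
def HashFamily.Efficient {m : ℕ → ℕ} (R : HashFamily m) : Prop :=
  (∃ S : PPT, ∀ (lam : ℕ) (t : ℕ+),
    S.law (Enc.enc (Unary.mk lam, Unary.mk t)) = R.sample lam t) ∧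
  ∃ D : PPT, D.IsDeterministic ∧
    ∀ (lam : ℕ) (t : ℕ+), ∀ r ∈ (R.sample lam t).support, ∀ x : Fin (m lam),
      D.law (Enc.enc (Unary.mk lam, Unary.mk t, r, x)) = PMF.pure (Enc.enc (R.hash lam t r x))

/-- The hash functions into `[2t]` are `t`-wise independent: the values at any at most `t`
elements are independent and uniformly distributed. -/
def HashFamily.IsTWiseIndependent {m : ℕ → ℕ} (R : HashFamily m) : Prop :=
  ∀ (lam : ℕ) (t : ℕ+) (S : Finset (Fin (m lam))) (y : Fin (m lam) → Fin (2 * t)),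
    S.card ≤ t →
      (R.sample lam t).prob {r | ∀ x ∈ S, R.hash lam t r x = y x}
        = (1 / (2 * (t : ℕ)) : ℝ) ^ S.card

/-! ## Robust set encodings -/

/-- The syntax of a set encoding for the universe `[m]`. `Key` holds the set encoding functions,
`Code` holds the encodings, and `none` as the result of `decode` stands for `⊥`. -/
structure SetEncoding (m : ℕ → ℕ) where
  Key : ℕ → ℕ+ → Type
  Code : ℕ → ℕ+ → Type
  keyEnc : ∀ lam t, Enc (Key lam t)
  codeEnc : ∀ lam t, Enc (Code lam t)
  sample : (lam : ℕ) → (t : ℕ+) → PMF (Key lam t)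
  encode : (lam : ℕ) → (t : ℕ+) → Key lam t → Finset (Fin (m lam)) → Code lam t
  decode : (lam : ℕ) → (t : ℕ+) → Key lam t → Code lam t → Code lam t →
    Option (Finset (Fin (m lam)))

namespace SetEncoding

attribute [instance] SetEncoding.keyEnc SetEncoding.codeEnc

variable {m : ℕ → ℕ} (E : SetEncoding m)

def diff (lam : ℕ) (t : ℕ+) (f : E.Key lam t) (X₀ X₁ : Finset (Fin (m lam))) :
    Option (Finset (Fin (m lam))) :=
  E.decode lam t f (E.encode lam t f X₀) (E.encode lam t f X₁)

/-- The probability that, on input `1^lam`, `1^t` and a sampled `f`, the adversary outputs two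
sets `X₀`, `X₁` with `Bad f X₀ X₁`. -/
noncomputable def advantage (B : PPT) (lam : ℕ) (t : ℕ+)
    (Bad : E.Key lam t → Finset (Fin (m lam)) → Finset (Fin (m lam)) → Prop) : ℝ :=
  (B.experiment (E.sample lam t) (fun f => Enc.enc (Unary.mk lam, Unary.mk t, f))).prob
    {z | ∃ X₀ X₁ : Finset (Fin (m lam)), z.2 = Enc.enc (X₀, X₁) ∧ Bad z.1 X₀ X₁}

/-- No PPT adversary finds, with more than negligible probability, two sets for which decoding
returns a wrong set, or returns `⊥` although their symmetric difference has fewer than `t`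
elements. -/
def Robust : Prop :=
  ∀ (B : PPT) (t : ℕ → ℕ+), PolyBounded t →
    Negligible fun lam => E.advantage B lam (t lam) fun f X₀ X₁ =>
      (∃ X', E.diff lam (t lam) f X₀ X₁ = some X' ∧ X' ≠ symmDiff X₀ X₁) ∨
      ((symmDiff X₀ X₁).card < t lam ∧ E.diff lam (t lam) f X₀ X₁ = none)

/-- A robust set encoding: efficient sampling, efficient deterministic encoding and decoding, and
robustness. -/
structure IsRobustSetEncoding : Prop where
  sample_efficient : ∃ S : PPT, ∀ (lam : ℕ) (t : ℕ+),
    S.law (Enc.enc (Unary.mk lam, Unary.mk t)) = (E.sample lam t).map Enc.enc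
  encode_efficient : ∃ D : PPT, D.IsDeterministic ∧
    ∀ (lam : ℕ) (t : ℕ+), ∀ f ∈ (E.sample lam t).support, ∀ X : Finset (Fin (m lam)),
      D.law (Enc.enc (Unary.mk lam, Unary.mk t, f, X))
        = PMF.pure (Enc.enc (E.encode lam t f X))
  decode_efficient : ∃ D : PPT, D.IsDeterministic ∧
    ∀ (lam : ℕ) (t : ℕ+), ∀ f ∈ (E.sample lam t).support, ∀ y₀ y₁ : E.Code lam t,
      D.law (Enc.enc (Unary.mk lam, Unary.mk t, f, y₀, y₁))
        = PMF.pure (Enc.enc (E.decode lam t f y₀ y₁))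
  robust : E.Robust

end SetEncoding

/-! ## The construction -/

namespace IBLT

/-- The tables `(ℤ_q^n)^(k × 2t)`. -/
abbrev Table (n q k : ℕ) (t : ℕ+) : Type := Fin k → Fin (2 * t) → Fin n → ZMod q

section

variable {n m q k : ℕ} {t : ℕ+} [NeZero q]
  (r : Fin k → Fin m → Fin (2 * t)) (A : Matrix (Fin n) (Fin m) (ZMod q))

/-- The column `A e_x`. -/
def column (x : Fin m) : Fin n → ZMod q := A *ᵥ Pi.single x 1

/-- For all `x ∈ X` and all rows `i`, the column `A e_x` is added to the cell `(i, r_i(x))` of the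
zero table. -/
def encode (X : Finset (Fin m)) : Table n q k t :=
  fun i j => ∑ x ∈ X with r i x = j, column A x

/-- The set `Z` of the pairs `(x, w)` such that some cell of the table holds `w` and `w` is
`A e_x` or `-A e_x`. -/
def peelable (H : Table n q k t) : Finset (Fin m × (Fin n → ZMod q)) :=
  {z | (∃ i j, H i j = z.2) ∧ (z.2 = column A z.1 ∨ z.2 = -column A z.1)}

/-- For all `(x, w) ∈ Z` and all rows `i`, subtract `w` from the cell `(i, r_i(x))`. -/
def peel (H : Table n q k t) (Z : Finset (Fin m × (Fin n → ZMod q))) : Table n q k t :=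
  fun i j => H i j - ∑ z ∈ Z with r i z.1 = j, z.2

/-- The do-while loop of the decoder, started with the table `H` and the set `X'`: the final
table and the final set, or `none` if the loop has not ended after the given number of rounds. -/
def decodeLoop : ℕ → Table n q k t → Finset (Fin m) → Option (Table n q k t × Finset (Fin m))
  | 0, _, _ => none
  | c + 1, H, X' =>
      if peelable A H = ∅ then
        some (peel r H (peelable A H), X' ∪ (peelable A H).image Prod.fst)
      else
        decodeLoop c (peel r H (peelable A H)) (X' ∪ (peelable A H).image Prod.fst)

/-- Decoding, where the loop is abandoned with result `⊥` if it has not ended after `m + 1`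
rounds. -/
def decode (H₀ H₁ : Table n q k t) : Option (Finset (Fin m)) :=
  match decodeLoop r A (m + 1) (H₀ - H₁) ∅ with
  | some (H, X') => if H = 0 then some X' else none
  | none => none

end

/-- The construction with the parameters `n`, `m`, `q`, `k` (functions of the security
parameter) and the hash family `R`. An encoding function consists of the descriptions of `k`
independently sampled members of `R` and of a uniformly random matrix `A`. -/
noncomputable def setEncoding (n m q k : ℕ → ℕ) [∀ lam, NeZero (q lam)] (R : HashFamily m) :
    SetEncoding m where
  Key lam _ := (Fin (k lam) → Val) × Matrix (Fin (n lam)) (Fin (m lam)) (ZMod (q lam))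
  Code lam t := Table (n lam) (q lam) (k lam) t
  keyEnc _ _ := inferInstance
  codeEnc _ _ := inferInstance
  sample lam t := ((R.sample lam t).iid (k lam)).bind fun r =>
    (PMF.uniformOfFintype (Matrix (Fin (n lam)) (Fin (m lam)) (ZMod (q lam)))).map fun A => (r, A)
  encode lam t f X := encode (fun i => R.hash lam t (f.1 i)) f.2 X
  decode lam t f H₀ H₁ := decode (fun i => R.hash lam t (f.1 i)) f.2 H₀ H₁

end IBLT

/-! Let `D` be the symmetric difference of the two sets and `s` the difference of their
characteristic vectors. The decoder starts from the table whose cells hold `A` times the part of `s`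
in that cell. Call the part of `s` on the remaining elements of one cell, minus `σ e_x` with `σ ∈
{0, 1, -1}`, a candidate. If no candidate is a nonzero kernel vector of `A` modulo `q`, a cell can
hold `± A e_x` only if `x` is its sole remaining element. A round then removes, with the right
signs, exactly the elements that are alone in some cell (`mem_peelable_signedTable`,
`round_signedTable`). This is stable after `m` rounds (`shrink_iterate`). If nothing remains, the
output is `D`; if something remains, the candidates with `σ = 0` show that the table is not zero,
and the output is `⊥`. So a failure needs either a kernel candidate or a leftover set in which every
element shares all its cells (`decode_spec`).

Kernel candidates are short enough to be SIS solutions (`isSISSolution_candidate`), and there are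
only polynomially many of them. A reduction can therefore run the adversary and test them all
(`listSearch_spec`, `attack_spec`). The threshold is an arbitrary polynomially bounded function that
need not be computable, so the reduction guesses it and loses a polynomial factor (`guessLaw`,
`PMF.toOuterMeasure_le_mul_bind`).

A leftover set of fewer than `t` elements is an event about the hash functions alone, so the
adaptivity of the adversary does not matter. If each of `l` elements collides with another, they
occupy at most `l / 2` of the `2t` cells, which has probability at most `(e/4)^(l/2)` in one row
(`PMF.toOuterMeasure_collision_le`, `choose_mul_pow_div_le`). The rows are independent, there are at
most `m^l` sets, and `m ≤ (3/e)^(k/2)` for positive `m`; this leaves at most `(7/8)^k` for each size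
`l` (`toOuterMeasure_stuck_le`).

The remaining work is complexity theory for the program language. Polynomial-time functions are
shown to be closed under composition, case distinction and size-controlled folds (`PolyLaw.fold`,
`EfficientlyComputable.foldl`). The construction and the reduction are then rewritten as functions
on lists of natural numbers built from these operations. -/

/-! ### Outcome laws of programs and their dependence on the cut-off -/

namespace Outcome

/-- Forget the number of steps. -/
noncomputable def erase (o : Outcome) : PMF (Option Val) := o.map (Option.map Prod.fst)

theorem some_mem_support_andThen {μ : Outcome} {g : Val → Outcome} {y : Val} {c : ℕ} :
    some (y, c) ∈ (μ.andThen g).support ↔ ∃ y₁ c₁ c₂, some (y₁, c₁) ∈ μ.support ∧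
      some (y, c₂) ∈ (g y₁).support ∧ c = c₁ + c₂ := by
  simp only [andThen, PMF.mem_support_bind_iff]
  constructor
  · rintro ⟨_ | ⟨y₁, c₁⟩, h1, h2⟩
    · simp at h2
    · simp only [PMF.mem_support_map_iff] at h2
      obtain ⟨_ | ⟨y₂, c₂⟩, h3, h4⟩ := h2
      · simp at h4
      · simp only [Option.map_some, Option.some.injEq, Prod.mk.injEq] at h4
        obtain ⟨rfl, rfl⟩ := h4
        exact ⟨_, _, _, h1, h3, rfl⟩
  · rintro ⟨y₁, c₁, c₂, h1, h2, rfl⟩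
    refine ⟨_, h1, ?_⟩
    simp only [PMF.mem_support_map_iff]
    exact ⟨_, h2, rfl⟩

theorem none_mem_support_andThen {μ : Outcome} {g : Val → Outcome} :
    none ∈ (μ.andThen g).support ↔ none ∈ μ.support ∨
      ∃ y c, some (y, c) ∈ μ.support ∧ none ∈ (g y).support := by
  simp only [andThen, PMF.mem_support_bind_iff]
  constructor
  · rintro ⟨_ | ⟨y, c⟩, h1, h2⟩
    · exact Or.inl h1
    · simp only [PMF.mem_support_map_iff] at h2
      obtain ⟨_ | z, h3, h4⟩ := h2
      · exact Or.inr ⟨_, _, h1, h3⟩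
      · simp at h4
  · rintro (h | ⟨y, c, h1, h2⟩)
    · exact ⟨none, h, by simp⟩
    · refine ⟨_, h1, ?_⟩
      simp only [PMF.mem_support_map_iff]
      exact ⟨_, h2, rfl⟩

end Outcome

theorem PMF.bind_congr_support {α β : Type*} {μ : PMF α} {f g : α → PMF β}
    (h : ∀ a ∈ μ.support, f a = g a) : μ.bind f = μ.bind g := by
  ext b
  simp only [PMF.bind_apply]
  refine tsum_congr fun a => ?_
  by_cases ha : a ∈ μ.support
  · rw [h a ha]
  · rw [(PMF.apply_eq_zero_iff _ _).2 ha]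
    simp

namespace Outcome

theorem andThen_congr {μ : Outcome} {f g : Val → Outcome}
    (h : ∀ y c, some (y, c) ∈ μ.support → f y = g y) : μ.andThen f = μ.andThen g := by
  refine PMF.bind_congr_support fun o ho => ?_
  rcases o with _ | ⟨y, c⟩
  · rfl
  · simp only [h y c ho]

/-- Step counts are only added up and never influence what is computed next, so forgetting them
turns sequencing into a monadic bind. -/
theorem erase_andThen (μ : Outcome) (g : Val → Outcome) :
    (μ.andThen g).erase =
      μ.erase.bind fun o => o.elim (PMF.pure none) fun y => (g y).erase := by
  simp only [erase, andThen, PMF.map_bind, PMF.bind_map]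
  refine congrArg _ (funext fun o => ?_)
  rcases o with _ | ⟨y, c⟩
  · simp [PMF.pure_map]
  · simp only [PMF.map_comp, Function.comp_apply, Option.map_some, Option.elim]
    congr 1
    funext o
    rcases o with _ | ⟨y, c⟩ <;> rfl

theorem erase_andThen_of_eq {μ : Outcome} {g : Val → Outcome} {ν : PMF Val}
    {f : Val → PMF Val} (hμ : μ.erase = ν.map some)
    (hg : ∀ y ∈ ν.support, (g y).erase = (f y).map some) :
    (μ.andThen g).erase = (ν.bind f).map some := by
  rw [erase_andThen, hμ, PMF.bind_map, PMF.map_bind]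
  exact PMF.bind_congr_support fun y hy => by simpa using hg y hy

theorem exists_of_mem_erase {μ : Outcome} {ν : PMF Val} (hμ : μ.erase = ν.map some) {y : Val} :
    y ∈ ν.support ↔ ∃ c, some (y, c) ∈ μ.support := by
  have h : some y ∈ (ν.map some).support ↔ y ∈ ν.support := by
    rw [PMF.mem_support_map_iff]
    simp
  rw [← h, ← hμ, erase, PMF.mem_support_map_iff]
  constructor
  · rintro ⟨_ | ⟨z, c⟩, h1, h2⟩
    · simp at h2
    · simp only [Option.map_some, Option.some.injEq] at h2
      exact ⟨c, h2 ▸ h1⟩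
  · rintro ⟨c, h⟩
    exact ⟨_, h, rfl⟩

end Outcome

theorem Val.size_pos (x : Val) : 0 < x.size := by cases x <;> simp [Val.size]

theorem Outcome.size_le_of_loop {c p : Val → Outcome}
    (hc : ∀ x y s, some (y, s) ∈ (c x).support → x.size ≤ s ∧ y.size ≤ s)
    (hp : ∀ x y s, some (y, s) ∈ (p x).support → x.size ≤ s ∧ y.size ≤ s) (F : ℕ) :
    ∀ x y s, some (y, s) ∈ (Outcome.loop c p F x).support → x.size ≤ s ∧ y.size ≤ s := by
  induction F with
  | zero => intro x y s h; simp [Outcome.loop] at h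
  | succ F ih =>
    intro x y s h
    rw [Outcome.loop, some_mem_support_andThen] at h
    obtain ⟨b, c₁, c₂, h1, h2, rfl⟩ := h
    have h3 := hc _ _ _ h1
    split_ifs at h2 with hb
    · simp at h2
      obtain ⟨rfl, rfl⟩ := h2
      omega
    · rw [some_mem_support_andThen] at h2
      obtain ⟨z, d₁, d₂, h4, h5, rfl⟩ := h2
      have := hp _ _ _ h4
      have := ih _ _ _ h5
      omega

/-- Every step count dominates the sizes of the input and of the output. -/
theorem Prog.size_le (T : ℕ) (p : Prog) : ∀ x y s, some (y, s) ∈ (p.run T x).support →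
    x.size ≤ s ∧ y.size ≤ s := by
  induction p with
  | instr f =>
    intro x y s h
    simp [Prog.run] at h
    obtain ⟨rfl, rfl⟩ := h
    omega
  | rand =>
    intro x y s h
    simp only [Prog.run, PMF.mem_support_map_iff] at h
    obtain ⟨z, -, h⟩ := h
    simp only [Option.some.injEq, Prod.mk.injEq] at h
    obtain ⟨rfl, rfl⟩ := h
    omega
  | seq p p' ih ih' =>
    intro x y s h
    rw [Prog.run, Outcome.some_mem_support_andThen] at h
    obtain ⟨b, c₁, c₂, h1, h2, rfl⟩ := h
    have := ih _ _ _ h1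
    have := ih' _ _ _ h2
    omega
  | pair p p' ih ih' =>
    intro x y s h
    simp only [Prog.run, Outcome.some_mem_support_andThen] at h
    obtain ⟨b, c₁, c₂, h1, ⟨d, c₃, c₄, h2, h3, rfl⟩, rfl⟩ := h
    simp at h3
    obtain ⟨rfl, rfl⟩ := h3
    have := ih _ _ _ h1
    have := ih' _ _ _ h2
    simp only [Val.size]
    omega
  | ite c p p' ihc ih ih' =>
    intro x y s h
    rw [Prog.run, Outcome.some_mem_support_andThen] at h
    obtain ⟨b, c₁, c₂, h1, h2, rfl⟩ := h
    have := ihc _ _ _ h1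
    split_ifs at h2
    · have := ih' _ _ _ h2
      omega
    · have := ih _ _ _ h2
      omega
  | loop c p ihc ih => exact Outcome.size_le_of_loop ihc ih T

/-- The cut-off enters a loop twice: as its own fuel and inside test and body. Separating the two
allows an induction on the fuel alone. -/
theorem Outcome.loop_eq_of_le {c p c' p' : Val → Outcome}
    (hc : ∀ x, none ∉ (c x).support → c' x = c x)
    (hp : ∀ x, none ∉ (p x).support → p' x = p x) (F F' : ℕ) (hF : F ≤ F') :
    ∀ x, none ∉ (Outcome.loop c p F x).support →
      Outcome.loop c' p' F' x = Outcome.loop c p F x := by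
  induction F generalizing F' with
  | zero => intro x h; simp [Outcome.loop] at h
  | succ F ih =>
    intro x h
    obtain ⟨F', rfl⟩ : ∃ G, F' = G + 1 := ⟨F' - 1, by omega⟩
    rw [Outcome.loop, Outcome.none_mem_support_andThen] at h
    push Not at h
    rw [Outcome.loop, Outcome.loop, hc _ h.1]
    refine Outcome.andThen_congr fun b s hb => ?_
    have h2 := h.2 _ _ hb
    split_ifs with hb0
    · rfl
    · rw [if_neg hb0, Outcome.none_mem_support_andThen] at h2
      push Not at h2
      rw [hp _ h2.1]
      exact Outcome.andThen_congr fun y s hy => ih F' (by omega) _ (h2.2 _ _ hy)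

/-- A run that is not cut off does not depend on the bound. -/
theorem Prog.run_eq_of_le {T T' : ℕ} (hT : T ≤ T') (p : Prog) : ∀ x,
    none ∉ (p.run T x).support → p.run T' x = p.run T x := by
  induction p with
  | instr f => intro x _; rfl
  | rand => intro x _; rfl
  | seq p p' ih ih' =>
    intro x h
    rw [Prog.run, Outcome.none_mem_support_andThen] at h
    push Not at h
    simp only [Prog.run]
    rw [ih _ h.1]
    exact Outcome.andThen_congr fun y s hy => ih' _ (h.2 _ _ hy)
  | pair p p' ih ih' =>
    intro x h
    simp only [Prog.run, Outcome.none_mem_support_andThen] at h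
    push Not at h
    simp only [Prog.run]
    rw [ih _ h.1]
    exact Outcome.andThen_congr fun y s hy => by rw [ih' _ (h.2 _ _ hy).1]
  | ite c p p' ihc ih ih' =>
    intro x h
    rw [Prog.run, Outcome.none_mem_support_andThen] at h
    push Not at h
    simp only [Prog.run]
    rw [ihc _ h.1]
    refine Outcome.andThen_congr fun y s hy => ?_
    have h2 := h.2 _ _ hy
    split_ifs with hb
    · rw [if_pos hb] at h2
      exact ih' _ h2
    · rw [if_neg hb] at h2
      exact ih _ h2
  | loop c p ihc ih => exact Outcome.loop_eq_of_le ihc ih _ _ hT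

theorem Val.uniform_num (N : ℕ) : (Val.num N).uniform =
    (PMF.uniformOfFintype (Fin (N + 1))).map fun a => Val.num a.val := by
  change PMF.map _ (PMF.bind _ (PMF.pure ∘ _)) = _
  rw [PMF.bind_pure_comp, PMF.map_comp]
  rfl

/-! ### Laws and running times of the program constructors -/

/-- The program halts on `x` after at most `C` steps, and `μ` is the law of its output. -/
def Prog.Runs (p : Prog) (x : Val) (μ : PMF Val) (C : ℕ) : Prop :=
  ∀ T, C ≤ T → (p.run T x).erase = μ.map some ∧ p.HaltsWithin x T ∧
    ∀ y s, some (y, s) ∈ (p.run T x).support → s ≤ C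

namespace Prog.Runs

theorem mono {p : Prog} {x : Val} {μ : PMF Val} {C C' : ℕ} (h : p.Runs x μ C) (hC : C ≤ C') :
    p.Runs x μ C' := fun T hT =>
  ⟨(h T (hC.trans hT)).1, (h T (hC.trans hT)).2.1,
    fun y s hy => ((h T (hC.trans hT)).2.2 y s hy).trans hC⟩

/-- Halting is automatic: a law of the form `μ.map some` gives no mass to a run that was cut off. -/
theorem of_erase {p : Prog} {x : Val} {μ : PMF Val} {C : ℕ}
    (h : ∀ T, C ≤ T → (p.run T x).erase = μ.map some ∧
      ∀ y s, some (y, s) ∈ (p.run T x).support → s ≤ C) : p.Runs x μ C := by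
  intro T hT
  refine ⟨(h T hT).1, ?_, (h T hT).2⟩
  rintro (_ | ⟨y, s⟩) ho
  · exfalso
    have : none ∈ (p.run T x).erase.support := by
      rw [Outcome.erase, PMF.mem_support_map_iff]
      exact ⟨_, ho, rfl⟩
    rw [(h T hT).1, PMF.mem_support_map_iff] at this
    simp at this
  · exact ⟨y, s, rfl, ((h T hT).2 y s ho).trans hT⟩

/-- Intermediate data are never larger than the cost already paid for them; this is what keeps
compositions polynomial. -/
theorem size_le {p : Prog} {x : Val} {μ : PMF Val} {C : ℕ} (h : p.Runs x μ C) {y : Val}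
    (hy : y ∈ μ.support) : x.size ≤ C ∧ y.size ≤ C := by
  obtain ⟨s, hs⟩ := (Outcome.exists_of_mem_erase (h C le_rfl).1).1 hy
  have h1 := (h C le_rfl).2.2 _ _ hs
  have h2 := Prog.size_le _ _ _ _ _ hs
  omega

theorem instr (f : Instr) (x : Val) :
    (Prog.instr f).Runs x (PMF.pure (f.eval x)) (x.size + (f.eval x).size) := by
  refine of_erase fun T _ => ⟨?_, fun y s h => ?_⟩
  · simp [Prog.run, Outcome.erase, PMF.pure_map]
  · simp [Prog.run] at h
    omega

theorem rand (x : Val) : Prog.rand.Runs x x.uniform (2 * x.size) := by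
  refine of_erase fun T _ => ⟨?_, fun y s h => ?_⟩
  · simp only [Prog.run, Outcome.erase, PMF.map_comp]
    rfl
  · simp only [Prog.run, PMF.mem_support_map_iff, Option.some.injEq, Prod.mk.injEq] at h
    obtain ⟨z, hz, rfl, rfl⟩ := h
    cases x with
    | num N =>
      simp only [Val.uniform_num, PMF.mem_support_map_iff] at hz
      obtain ⟨a, -, rfl⟩ := hz
      have := Nat.size_le_size (Nat.lt_succ_iff.1 a.2)
      simp only [Val.size]
      omega
    | pair u v =>
      simp only [Val.uniform, PMF.support_pure, Set.mem_singleton_iff] at hz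
      subst hz
      simp [Val.size]

theorem seq {p p' : Prog} {x : Val} {μ : PMF Val} {f : Val → PMF Val} {C C' : ℕ}
    (h : p.Runs x μ C) (h' : ∀ y ∈ μ.support, p'.Runs y (f y) C') :
    (Prog.seq p p').Runs x (μ.bind f) (C + C') := by
  refine of_erase fun T hT => ⟨?_, fun y s hy => ?_⟩
  · exact Outcome.erase_andThen_of_eq (h T (by omega)).1 fun y hy => (h' y hy T (by omega)).1
  · rw [Prog.run, Outcome.some_mem_support_andThen] at hy
    obtain ⟨z, c₁, c₂, h1, h2, rfl⟩ := hy
    have h3 := (h T (by omega)).2.2 _ _ h1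
    have hz := (Outcome.exists_of_mem_erase (h T (by omega)).1).2 ⟨_, h1⟩
    have := (h' z hz T (by omega)).2.2 _ _ h2
    omega

theorem pair {p p' : Prog} {x : Val} {μ μ' : PMF Val} {C C' : ℕ}
    (h : p.Runs x μ C) (h' : p'.Runs x μ' C') :
    (Prog.pair p p').Runs x (μ.bind fun y => μ'.map (Val.pair y)) (C + C' + 1) := by
  refine of_erase fun T hT => ⟨?_, fun y s hy => ?_⟩
  · refine Outcome.erase_andThen_of_eq (h T (by omega)).1 fun y _ => ?_
    rw [← PMF.bind_pure_comp]
    refine Outcome.erase_andThen_of_eq (h' T (by omega)).1 fun z _ => ?_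
    simp [Outcome.erase, PMF.pure_map]
  · simp only [Prog.run, Outcome.some_mem_support_andThen] at hy
    obtain ⟨b, c₁, c₂, h1, ⟨d, c₃, c₄, h2, h3, rfl⟩, rfl⟩ := hy
    simp at h3
    have := (h T (by omega)).2.2 _ _ h1
    have := (h' T (by omega)).2.2 _ _ h2
    omega

theorem ite {c p p' : Prog} {x : Val} {μ ν ν' : PMF Val} {C C' : ℕ}
    (hc : c.Runs x μ C) (h : p.Runs x ν C') (h' : p'.Runs x ν' C') :
    (Prog.ite c p p').Runs x (μ.bind fun b => if b = Val.num 0 then ν' else ν) (C + C') := by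
  refine of_erase fun T hT => ⟨?_, fun y s hy => ?_⟩
  · refine Outcome.erase_andThen_of_eq (hc T (by omega)).1 fun b _ => ?_
    split_ifs
    · exact (h' T (by omega)).1
    · exact (h T (by omega)).1
  · rw [Prog.run, Outcome.some_mem_support_andThen] at hy
    obtain ⟨b, c₁, c₂, h1, h2, rfl⟩ := hy
    have := (hc T (by omega)).2.2 _ _ h1
    split_ifs at h2
    · have := (h' T (by omega)).2.2 _ _ h2
      omega
    · have := (h T (by omega)).2.2 _ _ h2
      omega

end Prog.Runs

/-- The law of the outcome of a loop with a deterministic test, where the body is executed at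
most the given number of times. -/
noncomputable def PMF.iterWhile {α : Type} (c : α → Prop) [DecidablePred c] (f : α → PMF α) :
    ℕ → α → PMF α
  | 0, x => PMF.pure x
  | N + 1, x => if c x then (f x).bind (PMF.iterWhile c f N) else PMF.pure x

/-- The measure `N` decreases in every pass, so the test fails after at most `N x ≤ M` passes and
the budget `M` of `iterWhile` is no restriction. The invariant `I` gives uniform costs for test and
body. -/
theorem Prog.Runs.loop {c p : Prog} {cf : Val → Val} {f : Val → PMF Val} {I : Val → Prop}
    {Cc Cp : ℕ} (hc : ∀ x, I x → c.Runs x (PMF.pure (cf x)) Cc)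
    (hp : ∀ x, I x → cf x ≠ Val.num 0 → p.Runs x (f x) Cp)
    (N : Val → ℕ)
    (hN : ∀ x, I x → cf x ≠ Val.num 0 → 0 < N x ∧ ∀ y ∈ (f x).support, N y < N x ∧ I y)
    (x : Val) (hx : I x) (M : ℕ) (hM : N x ≤ M) :
    (Prog.loop c p).Runs x (PMF.iterWhile (fun x => cf x ≠ Val.num 0) f M x)
      ((M + 1) * (Cc + Cp + 1)) := by
  suffices key : ∀ T, Cc ≤ T → Cp ≤ T → ∀ M x F, I x → N x ≤ M → M + 1 ≤ F →
      (Outcome.loop (c.run T) (p.run T) F x).erase =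
        (PMF.iterWhile (fun x => cf x ≠ Val.num 0) f M x).map some ∧
      ∀ y s, some (y, s) ∈ (Outcome.loop (c.run T) (p.run T) F x).support →
        s ≤ (M + 1) * (Cc + Cp + 1) by
    refine of_erase fun T hT => ?_
    have h1 : (M + 1) * 1 ≤ (M + 1) * (Cc + Cp + 1) := Nat.mul_le_mul_left _ (by omega)
    have h2 : 1 * (Cc + Cp + 1) ≤ (M + 1) * (Cc + Cp + 1) := Nat.mul_le_mul_right _ (by omega)
    exact key T (by omega) (by omega) M x T hx hM (by omega)
  intro T hT1 hT2 M
  induction M with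
  | zero =>
    intro x F hx hN0 hF
    obtain ⟨F, rfl⟩ : ∃ G, F = G + 1 := ⟨F - 1, by omega⟩
    have h0 : cf x = Val.num 0 := by
      by_contra h
      have := (hN x hx h).1
      omega
    have hcx := hc x hx T hT1
    refine ⟨?_, fun y s hy => ?_⟩
    -- The target is written as a bind over the value of the test, to match the shape of
    -- `Outcome.loop`.
    · rw [Outcome.loop, PMF.iterWhile, ← PMF.pure_bind (cf x) fun _ => PMF.pure x]
      refine Outcome.erase_andThen_of_eq hcx.1 fun b hb => ?_
      simp only [PMF.support_pure, Set.mem_singleton_iff] at hb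
      rw [if_pos (hb.trans h0)]
      simp [Outcome.erase, PMF.pure_map]
    · rw [Outcome.loop, Outcome.some_mem_support_andThen] at hy
      obtain ⟨b, c₁, c₂, h1, h2, rfl⟩ := hy
      have hb := (Outcome.exists_of_mem_erase hcx.1).2 ⟨_, h1⟩
      simp only [PMF.support_pure, Set.mem_singleton_iff] at hb
      rw [if_pos (hb.trans h0)] at h2
      simp at h2
      have := hcx.2.2 _ _ h1
      omega
  | succ M ih =>
    intro x F hx hNx hF
    obtain ⟨F, rfl⟩ : ∃ G, F = G + 1 := ⟨F - 1, by omega⟩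
    have hcx := hc x hx T hT1
    by_cases h0 : cf x = Val.num 0
    · refine ⟨?_, fun y s hy => ?_⟩
      · rw [Outcome.loop, PMF.iterWhile, if_neg (not_not.2 h0),
          ← PMF.pure_bind (cf x) fun _ => PMF.pure x]
        refine Outcome.erase_andThen_of_eq hcx.1 fun b hb => ?_
        simp only [PMF.support_pure, Set.mem_singleton_iff] at hb
        rw [if_pos (hb.trans h0)]
        simp [Outcome.erase, PMF.pure_map]
      · rw [Outcome.loop, Outcome.some_mem_support_andThen] at hy
        obtain ⟨b, c₁, c₂, h1, h2, rfl⟩ := hy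
        have hb := (Outcome.exists_of_mem_erase hcx.1).2 ⟨_, h1⟩
        simp only [PMF.support_pure, Set.mem_singleton_iff] at hb
        rw [if_pos (hb.trans h0)] at h2
        simp at h2
        have := hcx.2.2 _ _ h1
        have h2 : 1 * (Cc + Cp + 1) ≤ (M + 1 + 1) * (Cc + Cp + 1) :=
          Nat.mul_le_mul_right _ (by omega)
        omega
    · have hpx := hp x hx h0 T hT2
      have hstep := (hN x hx h0).2
      refine ⟨?_, fun y s hy => ?_⟩
      · rw [Outcome.loop, PMF.iterWhile, if_pos h0, ← PMF.pure_bind (cf x) fun _ =>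
          (f x).bind (PMF.iterWhile (fun x => cf x ≠ Val.num 0) f M)]
        refine Outcome.erase_andThen_of_eq hcx.1 fun b hb => ?_
        simp only [PMF.support_pure, Set.mem_singleton_iff] at hb
        rw [if_neg (by rw [hb]; exact h0)]
        refine Outcome.erase_andThen_of_eq hpx.1 fun y hy => ?_
        exact (ih y F (hstep y hy).2 (by have := (hstep y hy).1; omega) (by omega)).1
      · rw [Outcome.loop, Outcome.some_mem_support_andThen] at hy
        obtain ⟨b, c₁, c₂, h1, h2, rfl⟩ := hy
        have hb := (Outcome.exists_of_mem_erase hcx.1).2 ⟨_, h1⟩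
        simp only [PMF.support_pure, Set.mem_singleton_iff] at hb
        rw [if_neg (by rw [hb]; exact h0), Outcome.some_mem_support_andThen] at h2
        obtain ⟨z, d₁, d₂, h3, h4, rfl⟩ := h2
        have hz := (Outcome.exists_of_mem_erase hpx.1).2 ⟨_, h3⟩
        have h5 := (ih z F (hstep z hz).2 (by have := (hstep z hz).1; omega) (by omega)).2 _ _ h4
        have h6 := hcx.2.2 _ _ h1
        have h7 := hpx.2.2 _ _ h3
        have : (M + 1 + 1) * (Cc + Cp + 1) = (M + 1) * (Cc + Cp + 1) + (Cc + Cp + 1) := by ring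
        omega

/-- At the polynomial bound no run is cut off, so by `Prog.run_eq_of_le` every larger cut-off gives
the same outcome. -/
theorem PPT.runs (B : PPT) (x : Val) : B.prog.Runs x (B.law x) (B.bound.eval x.size) := by
  have hnone : none ∉ (B.prog.run (B.bound.eval x.size) x).support := fun h => by
    obtain ⟨y, c, h, -⟩ := B.halts x _ h
    simp at h
  refine Prog.Runs.of_erase fun T hT => ?_
  rw [Prog.run_eq_of_le hT _ _ hnone]
  refine ⟨?_, fun y s hy => ?_⟩
  · rw [PPT.law, PMF.map_comp, Outcome.erase]
    simp only [← PMF.bind_pure_comp]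
    refine PMF.bind_congr_support fun o ho => ?_
    rcases o with _ | z
    · exact absurd ho hnone
    · rfl
  · obtain ⟨y, c, h, hc⟩ := B.halts x _ hy
    simp only [Option.some.injEq, Prod.mk.injEq] at h
    omega

theorem Prog.Runs.law_eq {B : PPT} {x : Val} {μ : PMF Val}
    (h : B.prog.Runs x μ (B.bound.eval x.size)) : B.law x = μ := by
  have h1 := (h _ le_rfl).1
  have h2 : B.law x = ((B.prog.run (B.bound.eval x.size) x).erase).map fun o =>
      o.getD (Val.num 0) := by
    rw [PPT.law, Outcome.erase, PMF.map_comp]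
    rfl
  rw [h2, h1, PMF.map_comp]
  exact PMF.map_id _

theorem Polynomial.eval_mono_nat (P : Polynomial ℕ) {a b : ℕ} (h : a ≤ b) :
    P.eval a ≤ P.eval b := by
  rw [Polynomial.eval_eq_sum_range, Polynomial.eval_eq_sum_range]
  gcongr

namespace Val

@[simp] theorem fst_pair (x y : Val) : (pair x y).fst = x := rfl

@[simp] theorem snd_pair (x y : Val) : (pair x y).snd = y := rfl

theorem size_num_le (a : ℕ) : (num a).size ≤ a + 1 := by
  have : Nat.size a ≤ a := Nat.size_le.2 a.lt_two_pow_self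
  simpa [size] using this

theorem size_fst_le (x : Val) : x.fst.size ≤ x.size := by
  cases x with
  | num a => simp [fst, size]
  | pair x y => simp only [fst, size]; omega

theorem size_snd_le (x : Val) : x.snd.size ≤ x.size := by
  cases x with
  | num a => simp [snd, size]
  | pair x y => simp only [snd, size]; omega

theorem size_snd_lt {x : Val} (h : x ≠ num 0) : x.snd.size < x.size := by
  cases x with
  | num a =>
    have : a ≠ 0 := fun h0 => h (by rw [h0])
    have := Nat.size_pos.2 (Nat.pos_of_ne_zero this)
    simpa [snd, size] using this
  | pair x y => simp only [snd, size]; omega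

theorem size_arith_le {f : ℕ → ℕ → ℕ}
    (hf : ∀ a b, Nat.size (f a b) ≤ Nat.size a + Nat.size b + 1) (x : Val) :
    (arith f x).size ≤ x.size := by
  rcases x with a | ⟨a | _, b | _⟩
  · simp [arith, size]
  · simp only [arith, size]
    have := hf a b
    omega
  all_goals simp [arith, size]

end Val

theorem Nat.size_mono_add (a b : ℕ) : Nat.size (a + b) ≤ Nat.size a + Nat.size b + 1 := by
  rw [Nat.size_le, pow_succ, pow_add]
  have ha := Nat.lt_size_self a
  have hb := Nat.lt_size_self b
  have := Nat.one_le_two_pow (n := a.size)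
  have := Nat.one_le_two_pow (n := b.size)
  nlinarith

theorem Nat.size_mul_le (a b : ℕ) : Nat.size (a * b) ≤ Nat.size a + Nat.size b := by
  rw [Nat.size_le, pow_add]
  exact Nat.mul_lt_mul'' (Nat.lt_size_self a) (Nat.lt_size_self b)

/-! ### Closure properties of polynomial time on raw data -/

/-- `f` is computed in polynomial time, and without random choices if `d` holds. -/
def PolyLaw (d : Prop) (f : Val → PMF Val) : Prop :=
  ∃ (p : Prog) (P : Polynomial ℕ), (d → p.IsDeterministic) ∧
    ∀ x, p.Runs x (f x) (P.eval x.size)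

/-- The function is computed in deterministic polynomial time. -/
def PolyFun (g : Val → Val) : Prop := PolyLaw True fun x => PMF.pure (g x)

theorem PPT.polyLaw (B : PPT) : PolyLaw B.IsDeterministic B.law :=
  ⟨B.prog, B.bound, fun h => h, B.runs⟩

namespace PolyLaw

variable {d : Prop}

theorem exists_ppt {f : Val → PMF Val} (h : PolyLaw d f) :
    ∃ B : PPT, (d → B.IsDeterministic) ∧ ∀ x, B.law x = f x := by
  obtain ⟨p, P, hd, hp⟩ := h
  exact ⟨⟨p, P, fun x => (hp x _ le_rfl).2.1⟩, hd, fun x => Prog.Runs.law_eq (hp x)⟩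

theorem weaken {d' : Prop} {f : Val → PMF Val} (h : PolyLaw d f) (hd : d' → d) :
    PolyLaw d' f := by
  obtain ⟨p, P, hp⟩ := h
  exact ⟨p, P, fun h => hp.1 (hd h), hp.2⟩

theorem congr {f g : Val → PMF Val} (h : PolyLaw d f) (hfg : ∀ x, f x = g x) : PolyLaw d g :=
  (funext hfg : f = g) ▸ h

theorem size_bound {f : Val → PMF Val} (h : PolyLaw d f) :
    ∃ P : Polynomial ℕ, ∀ x, ∀ y ∈ (f x).support, y.size ≤ P.eval x.size := by
  obtain ⟨p, P, -, hp⟩ := h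
  exact ⟨P, fun x y hy => ((hp x).size_le hy).2⟩

theorem instr (f : Instr) : PolyLaw d fun x => PMF.pure (f.eval x) := by
  suffices h : ∃ K : ℕ, ∀ x, (f.eval x).size ≤ K + x.size by
    obtain ⟨K, hK⟩ := h
    refine ⟨.instr f, Polynomial.C K + 2 * Polynomial.X, fun _ => trivial, fun x =>
      (Prog.Runs.instr f x).mono ?_⟩
    have := hK x
    simp only [Polynomial.eval_add, Polynomial.eval_mul, Polynomial.eval_C, Polynomial.eval_X,
      Polynomial.eval_ofNat]
    omega
  cases f with
  | id => exact ⟨0, fun x => by simp [Instr.eval]⟩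
  | const v => exact ⟨v.size, fun x => by simp [Instr.eval]⟩
  | fst => exact ⟨0, fun x => by rw [zero_add]; exact x.size_fst_le⟩
  | snd => exact ⟨0, fun x => by rw [zero_add]; exact x.size_snd_le⟩
  | add => exact ⟨0, fun x => by rw [zero_add]; exact Val.size_arith_le Nat.size_mono_add x⟩
  | sub => exact ⟨0, fun x => by
      rw [zero_add]
      exact Val.size_arith_le
        (fun a b => by have := Nat.size_le_size (Nat.sub_le a b); omega) x⟩
  | mul => exact ⟨0, fun x => by
      rw [zero_add]
      exact Val.size_arith_le (fun a b => (Nat.size_mul_le a b).trans (by omega)) x⟩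
  | div => exact ⟨0, fun x => by
      rw [zero_add]
      exact Val.size_arith_le
        (fun a b => by have := Nat.size_le_size (Nat.div_le_self a b); omega) x⟩
  | mod => exact ⟨0, fun x => by
      rw [zero_add]
      exact Val.size_arith_le
        (fun a b => by have := Nat.size_le_size (Nat.mod_le a b); omega) x⟩
  | eq => exact ⟨2, fun x => by
      have := x.size_pos
      cases x with
      | num a => simp only [Instr.eval, Val.eqTest, Val.size, Nat.size_zero]; omega
      | pair x y =>
        simp only [Instr.eval, Val.eqTest]
        split_ifs <;> simp [Val.size]
        omega⟩

theorem rand : PolyLaw False Val.uniform :=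
  ⟨.rand, 2 * Polynomial.X, fun h => h.elim, fun x => by simpa using Prog.Runs.rand x⟩

/-- The second program runs on data of size at most `P`, hence the bound `P'.comp P`. -/
theorem comp {f g : Val → PMF Val} (hf : PolyLaw d f) (hg : PolyLaw d g) :
    PolyLaw d fun x => (f x).bind g := by
  obtain ⟨p, P, hd, hp⟩ := hf
  obtain ⟨p', P', hd', hp'⟩ := hg
  refine ⟨.seq p p', P + P'.comp P, fun h => ⟨hd h, hd' h⟩, fun x => ?_⟩
  rw [Polynomial.eval_add, Polynomial.eval_comp]
  exact (hp x).seq fun y hy => (hp' y).mono (P'.eval_mono_nat ((hp x).size_le hy).2)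

theorem pair {f g : Val → PMF Val} (hf : PolyLaw d f) (hg : PolyLaw d g) :
    PolyLaw d fun x => (f x).bind fun y => (g x).map (Val.pair y) := by
  obtain ⟨p, P, hd, hp⟩ := hf
  obtain ⟨p', P', hd', hp'⟩ := hg
  refine ⟨.pair p p', P + P' + 1, fun h => ⟨hd h, hd' h⟩, fun x => ?_⟩
  simpa using (hp x).pair (hp' x)

theorem ite {c : Val → Val} {f g : Val → PMF Val}
    (hc : PolyFun c) (hf : PolyLaw d f) (hg : PolyLaw d g) :
    PolyLaw d fun x => if c x = Val.num 0 then g x else f x := by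
  obtain ⟨p₀, P₀, hd₀, hp₀⟩ := hc
  obtain ⟨p, P, hd, hp⟩ := hf
  obtain ⟨p', P', hd', hp'⟩ := hg
  refine ⟨.ite p₀ p p', P₀ + (P + P'), fun h => ⟨hd₀ trivial, hd h, hd' h⟩, fun x => ?_⟩
  simp only [Polynomial.eval_add]
  have := (hp₀ x).ite ((hp x).mono (Nat.le_add_right _ (P'.eval x.size)))
    ((hp' x).mono (Nat.le_add_left _ (P.eval x.size)))
  simpa [PMF.pure_bind] using this

theorem comp_fun {f : Val → PMF Val} {g : Val → Val} (hf : PolyLaw d f) (hg : PolyFun g) :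
    PolyLaw d fun x => (f x).map g :=
  (hf.comp (hg.weaken fun _ => trivial)).congr fun _ => PMF.bind_pure_comp _ _

theorem fun_comp {f : Val → PMF Val} {g : Val → Val} (hg : PolyFun g) (hf : PolyLaw d f) :
    PolyLaw d fun x => f (g x) :=
  ((hg.weaken fun _ => trivial).comp hf).congr fun x => by simp

end PolyLaw

/-- The outcome of a deterministic program is certain. -/
theorem Prog.IsDeterministic.exists_run_eq_pure {T : ℕ} {p : Prog} (h : p.IsDeterministic) :
    ∀ x, ∃ o, p.run T x = PMF.pure o := by
  have key : ∀ {μ : Outcome} {g : Val → Outcome}, (∃ o, μ = PMF.pure o) →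
      (∀ y, ∃ o, g y = PMF.pure o) → ∃ o, μ.andThen g = PMF.pure o := by
    rintro μ g ⟨o, rfl⟩ hg
    rw [Outcome.andThen, PMF.pure_bind]
    rcases o with _ | ⟨y, c⟩
    · exact ⟨_, rfl⟩
    · obtain ⟨o, ho⟩ := hg y
      exact ⟨o.map fun z => (z.1, c + z.2), by simp only [ho, PMF.pure_map]⟩
  induction p with
  | instr f => exact fun x => ⟨_, rfl⟩
  | rand => exact h.elim
  | seq p p' ih ih' => exact fun x => key (ih h.1 x) (ih' h.2)
  | pair p p' ih ih' =>
    exact fun x => key (ih h.1 x) fun y => key (ih' h.2 x) fun z => ⟨_, rfl⟩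
  | ite c p p' ihc ih ih' =>
    refine fun x => key (ihc h.1 x) fun b => ?_
    split_ifs
    · exact ih' h.2.2 x
    · exact ih h.2.1 x
  | loop c p ihc ih =>
    suffices hs : ∀ F x, ∃ o, Outcome.loop (c.run T) (p.run T) F x = PMF.pure o from
      fun x => hs T x
    intro F
    induction F with
    | zero => exact fun x => ⟨_, rfl⟩
    | succ F ihF =>
      refine fun x => key (ihc h.1 x) fun b => ?_
      split_ifs
      · exact ⟨_, rfl⟩
      · exact key (ih h.2 x) ihF

/-- Recovers a function on all data from a deterministic program, also where nothing is specified
about its output. -/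
theorem PolyLaw.exists_fun {f : Val → PMF Val} (h : PolyLaw True f) :
    ∃ g, PolyFun g ∧ ∀ x, f x = PMF.pure (g x) := by
  obtain ⟨B, hB, hf⟩ := h.exists_ppt
  have : ∀ x, ∃ y, f x = PMF.pure y := fun x => by
    obtain ⟨o, ho⟩ := Prog.IsDeterministic.exists_run_eq_pure
      (T := B.bound.eval x.size) (hB trivial) x
    rw [← hf, PPT.law, ho, PMF.pure_map]
    exact ⟨_, rfl⟩
  choose g hg using this
  exact ⟨g, h.congr hg, hg⟩

namespace PolyFun

theorem congr {f g : Val → Val} (h : PolyFun f) (hfg : ∀ x, f x = g x) : PolyFun g :=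
  (funext hfg : f = g) ▸ h

theorem instr (f : Instr) : PolyFun f.eval := PolyLaw.instr f

theorem id : PolyFun fun x => x := instr .id

theorem const (v : Val) : PolyFun fun _ => v := instr (.const v)

theorem comp {g f : Val → Val} (hg : PolyFun g) (hf : PolyFun f) : PolyFun fun x => g (f x) :=
  PolyLaw.fun_comp (d := True) (f := fun x => PMF.pure (g x)) hf hg

theorem fst {f : Val → Val} (hf : PolyFun f) : PolyFun fun x => (f x).fst := (instr .fst).comp hf

theorem snd {f : Val → Val} (hf : PolyFun f) : PolyFun fun x => (f x).snd := (instr .snd).comp hf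

theorem pair {f g : Val → Val} (hf : PolyFun f) (hg : PolyFun g) :
    PolyFun fun x => Val.pair (f x) (g x) :=
  (PolyLaw.pair hf hg).congr fun x => by simp [PMF.pure_map]

theorem ite {c f g : Val → Val} (hc : PolyFun c) (hf : PolyFun f) (hg : PolyFun g) :
    PolyFun fun x => if c x = Val.num 0 then g x else f x :=
  (PolyLaw.ite hc hf hg).congr fun x => by
    by_cases h : c x = Val.num 0 <;> simp [h]

theorem ite_eq {a b f g : Val → Val} (ha : PolyFun a) (hb : PolyFun b) (hf : PolyFun f)
    (hg : PolyFun g) : PolyFun fun x => if a x = b x then f x else g x :=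
  (ite ((instr .eq).comp (ha.pair hb)) hf hg).congr fun x => by
    by_cases h : a x = b x <;> simp [Instr.eval, Val.eqTest, h]

theorem size_bound {f : Val → Val} (h : PolyFun f) :
    ∃ P : Polynomial ℕ, ∀ x, (f x).size ≤ P.eval x.size := by
  obtain ⟨P, hP⟩ := PolyLaw.size_bound h
  exact ⟨P, fun x => hP x _ (by simp)⟩

end PolyFun

/-! ### Folds over lists of data -/

/-- Folding with random steps. -/
noncomputable def PMF.foldList {α β : Type} (f : β → α → PMF β) : β → List α → PMF β
  | b, [] => PMF.pure b
  | b, a :: l => (f b a).bind fun b' => PMF.foldList f b' l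

theorem PMF.foldList_pure {α β : Type} (f : β → α → β) (b : β) (l : List α) :
    PMF.foldList (fun b a => PMF.pure (f b a)) b l = PMF.pure (l.foldl f b) := by
  induction l generalizing b with
  | nil => rfl
  | cons a l ih => simp [PMF.foldList, ih]

/-- One step of a fold on a state that consists of the context, the rest of the list, and the
accumulator. -/
noncomputable def foldStep (f : Val → PMF Val) (x : Val) : PMF Val :=
  (f (x.fst.pair (x.snd.fst.fst.pair x.snd.snd))).map fun y => x.fst.pair (x.snd.fst.snd.pair y)

theorem PolyLaw.foldStep {d : Prop} {f : Val → PMF Val} (hf : PolyLaw d f) :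
    PolyLaw d (foldStep f) := by
  have hx := PolyFun.id
  have h1 : PolyLaw d fun x : Val => f (x.fst.pair (x.snd.fst.fst.pair x.snd.snd)) :=
    PolyLaw.fun_comp (hx.fst.pair (hx.snd.fst.fst.pair hx.snd.snd)) hf
  have h2 : PolyLaw d fun x : Val => PMF.pure x := hx.weaken fun _ => trivial
  -- A program consumes its input, so the old state is kept next to the value of `f` and the new
  -- state is assembled from both.
  refine ((h2.pair h1).comp_fun
    (hx.fst.fst.pair (hx.fst.snd.fst.snd.pair hx.snd))).congr fun x => ?_
  simp only [PMF.pure_bind, PMF.map_comp, _root_.foldStep]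
  rfl

/-- Iterating a polynomial-time step can produce exponential growth. The hypothesis `hQ` excludes
this: a step enlarges the accumulator only additively, by an amount that does not depend on the
accumulator. -/
theorem PolyLaw.fold {d : Prop} {f : Val → PMF Val} (hf : PolyLaw d f) (Q : Polynomial ℕ)
    (hQ : ∀ e x b, ∀ y ∈ (f (Val.pair e (Val.pair x b))).support,
      y.size ≤ b.size + Q.eval (e.size + x.size)) :
    ∃ F : Val → PMF Val, PolyLaw d F ∧ ∀ e l b, F (Val.pair e (Val.pair (Val.ofList l) b)) =
      PMF.foldList (fun b x => f (Val.pair e (Val.pair x b))) b l := by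
  refine ⟨fun x => (PMF.iterWhile (fun x => x.snd.fst ≠ Val.num 0) (_root_.foldStep f) x.size
    x).map fun x => x.snd.snd, PolyLaw.comp_fun ?_ PolyFun.id.snd.snd, fun e l b => ?_⟩
  · obtain ⟨c, Pc, hdc, hc⟩ := PolyFun.id.snd.fst
    obtain ⟨p, Pp, hdp, hp⟩ := hf.foldStep
    -- A bound for the size of every state: context and rest of the list have size at most `s`, the
    -- accumulator at most `s + s * W`, and the pair nodes are covered by the surplus.
    set B : Polynomial ℕ := 4 * Polynomial.X + Polynomial.X * Q.comp (2 * Polynomial.X) + 3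
      with hB
    refine ⟨.loop c p, (Polynomial.X + 1) * (Pc.comp B + Pp.comp B + 1),
      fun h => ⟨hdc trivial, hdp h⟩, fun x => ?_⟩
    simp only [Polynomial.eval_mul, Polynomial.eval_add, Polynomial.eval_X, Polynomial.eval_one,
      Polynomial.eval_comp]
    set s := x.size with hs
    have h1 := x.size_fst_le
    have h2 := x.size_snd_le
    have h3 := x.snd.size_fst_le
    have h4 := x.snd.size_snd_le
    set W := Q.eval (2 * s) with hW
    have hBs : B.eval s = 4 * s + s * W + 3 := by simp [hB, hW]
    -- The invariant is a potential argument: every unit of the unread list carries a credit of `W`,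
    -- and a pass, which adds at most `W` to the accumulator, removes at least one unit.
    refine Prog.Runs.loop (cf := fun x => x.snd.fst)
      (I := fun z => z.fst = x.fst ∧ z.snd.fst.size ≤ s ∧
        z.snd.snd.size + z.snd.fst.size * W ≤ s + s * W ∧ z.size ≤ B.eval s)
      (fun z hz => (hc z).mono (Pc.eval_mono_nat hz.2.2.2))
      (fun z hz _ => (hp z).mono (Pp.eval_mono_nat hz.2.2.2))
      -- The measure is a size and not a length, because the loop must also halt on data that are
      -- not lists; `num 0` has size one.
      (fun z => z.snd.fst.size - 1) (fun z hz hz0 => ?_) x ?_ s (by omega)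
    · have h5 := Val.size_snd_lt hz0
      have h6 := Val.size_pos z.snd.fst.snd
      refine ⟨by omega, fun y hy => ?_⟩
      simp only [_root_.foldStep, PMF.mem_support_map_iff] at hy
      obtain ⟨w, hw, rfl⟩ := hy
      have h7 := hQ _ _ _ w hw
      have h8 : Q.eval (z.fst.size + z.snd.fst.fst.size) ≤ W := by
        refine Q.eval_mono_nat ?_
        have := z.snd.fst.size_fst_le
        rw [hz.1]
        omega
      have h9 : z.snd.fst.snd.size * W + W ≤ z.snd.fst.size * W := by
        calc _ = (z.snd.fst.snd.size + 1) * W := by ring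
          _ ≤ _ := Nat.mul_le_mul_right _ (by omega)
      refine ⟨?_, hz.1, ?_, ?_, ?_⟩
      · simp only [Val.snd_pair, Val.fst_pair]
        omega
      · simp only [Val.snd_pair, Val.fst_pair]
        omega
      · simp only [Val.snd_pair, Val.fst_pair]
        omega
      · simp only [Val.size]
        rw [hz.1, hBs]
        omega
    · refine ⟨rfl, by omega, ?_, by omega⟩
      exact Nat.add_le_add (by omega) (Nat.mul_le_mul_right _ (by omega))
  · have key : ∀ (l : List Val) (b : Val) (M : ℕ), l.length ≤ M →
        PMF.iterWhile (fun x => x.snd.fst ≠ Val.num 0) (_root_.foldStep f) M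
          (Val.pair e (Val.pair (Val.ofList l) b)) =
        (PMF.foldList (fun b x => f (Val.pair e (Val.pair x b))) b l).map fun b =>
          Val.pair e (Val.pair (Val.num 0) b) := by
      intro l
      induction l with
      | nil =>
        intro b M _
        cases M <;> simp [PMF.iterWhile, PMF.foldList, Val.ofList, PMF.pure_map, Val.snd, Val.fst]
      | cons a l ih =>
        intro b M hM
        obtain ⟨M, rfl⟩ : ∃ G, M = G + 1 := ⟨M - 1, by simp at hM; omega⟩
        rw [PMF.iterWhile, if_pos (by simp [Val.snd, Val.fst, Val.ofList]), _root_.foldStep,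
          PMF.bind_map, PMF.foldList, PMF.map_bind]
        refine PMF.bind_congr_support fun b' _ => ?_
        exact ih b' M (by simpa using hM)
    beta_reduce
    rw [key, PMF.map_comp]
    · exact PMF.map_id _
    · have : ∀ l : List Val, l.length ≤ (Val.ofList l).size := fun l => by
        induction l with
        | nil => simp
        | cons a l ih =>
          simp only [Val.ofList, Val.size, List.length_cons]
          omega
      have := this l
      simp only [Val.size]
      omega

/-! ### Computing sizes of data, and clipping -/

namespace Val

/-- The total size of the entries of a list. -/
def stackSize : Val → ℕ
  | num a => if a = 0 then 0 else 1
  | pair x y => x.size + y.stackSize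

/-- One step of the computation of a size, on a stack of data and a counter. -/
def sizeStep (x : Val) : Val :=
  pair
    (if pair x.fst.fst.fst x.fst.fst.snd = x.fst.fst then
      pair x.fst.fst.fst (pair x.fst.fst.snd x.fst.snd)
    else if x.fst.fst = num 0 then x.fst.snd
    else pair (arith (· / ·) (pair x.fst.fst (num 2))) x.fst.snd)
    (arith (· + ·) (pair x.snd (num 1)))

/-- The size of the top entry is exactly the number of steps spent on it: a pair is split in one
step, a nonzero number loses one binary digit per step, and a zero is popped in one step. -/
theorem sizeStep_pair (st : Val) (c : ℕ) (h : st ≠ num 0) :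
    ∃ st', sizeStep (pair st (num c)) = pair st' (num (c + 1)) ∧ st'.size ≤ st.size ∧
      st'.stackSize + 1 = st.stackSize := by
  rcases st with a | ⟨⟨a⟩ | ⟨x, y⟩, r⟩
  · have ha : a ≠ 0 := fun h0 => h (by rw [h0])
    refine ⟨num 0, by simp [sizeStep, fst, snd, arith], ?_, by simp [stackSize, ha]⟩
    simp [size]
  · by_cases ha : a = 0
    · subst ha
      refine ⟨r, by simp [sizeStep, fst, arith], ?_, ?_⟩
      · simp only [size]
        omega
      · simp only [stackSize, size, Nat.size_zero]
        omega
    · have h2 : Nat.size (a / 2) + 1 = Nat.size a := by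
        conv_rhs => rw [← Nat.bit_bodd_div2 a]
        rw [Nat.size_bit (by rwa [Nat.bit_bodd_div2]), Nat.div2_val]
      refine ⟨pair (num (a / 2)) r, by simp [sizeStep, fst, arith, ha], ?_, ?_⟩
      · simp only [size]
        omega
      · simp only [stackSize, size]
        omega
  · refine ⟨pair x (pair y r), by simp [sizeStep, arith], ?_, ?_⟩
    · simp only [size]
      omega
    · simp only [stackSize, size]
      omega

end Val

theorem PolyFun.sizeStep : PolyFun Val.sizeStep := by
  have hx := PolyFun.id
  refine PolyFun.pair (PolyFun.ite_eq (hx.fst.fst.fst.pair hx.fst.fst.snd) hx.fst.fst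
    (hx.fst.fst.fst.pair (hx.fst.fst.snd.pair hx.fst.snd))
    (PolyFun.ite_eq hx.fst.fst (.const _) hx.fst.snd (.pair ?_ hx.fst.snd))) ?_
  · exact (PolyFun.instr .div).comp (hx.fst.fst.pair (.const _))
  · exact (PolyFun.instr .add).comp (hx.snd.pair (.const _))

theorem PMF.iterWhile_sizeStep (M : ℕ) : ∀ (st : Val) (c : ℕ), st.stackSize ≤ M →
    PMF.iterWhile (fun x => x.fst ≠ Val.num 0) (fun x => PMF.pure x.sizeStep) M
      (Val.pair st (Val.num c)) =
      PMF.pure (Val.pair (Val.num 0) (Val.num (c + st.stackSize))) := by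
  induction M with
  | zero =>
    intro st c h
    by_cases h0 : st = Val.num 0
    · subst h0
      rfl
    · obtain ⟨st', -, -, h3⟩ := Val.sizeStep_pair st c h0
      omega
  | succ M ih =>
    intro st c h
    by_cases h0 : st = Val.num 0
    · subst h0
      rfl
    · obtain ⟨st', h1, -, h3⟩ := Val.sizeStep_pair st c h0
      rw [PMF.iterWhile, if_pos (by simpa using h0), PMF.pure_bind, h1, ih _ _ (by omega)]
      congr 3
      omega

/-- The size of a datum can be computed. -/
theorem PolyFun.size : PolyFun fun v => Val.num v.size := by
  have hx := PolyFun.id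
  suffices h : PolyFun fun v => Val.pair (Val.num 0) (Val.num v.size) from h.snd
  obtain ⟨p₀, P₀, hd₀, hp₀⟩ := (hx.pair (.const (Val.num 0))).pair (.const (Val.num 0))
  obtain ⟨c, Pc, hdc, hc⟩ := hx.fst
  obtain ⟨p, Pp, hdp, hp⟩ := PolyFun.sizeStep
  refine ⟨.seq p₀ (.loop c p), P₀ + (Polynomial.X + 1) *
    (Pc.comp (2 * Polynomial.X + 10) + Pp.comp (2 * Polynomial.X + 10) + 1),
    fun h => ⟨hd₀ h, hdc h, hdp h⟩, fun v => ?_⟩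
  have key := Prog.Runs.loop (c := c) (p := p) (cf := fun x => x.fst)
    (f := fun x => PMF.pure x.sizeStep)
    (I := fun z => ∃ st n, z = Val.pair st (Val.num n) ∧ st.size ≤ v.size + 2 ∧
      n + st.stackSize ≤ v.size)
    (Cc := Pc.eval (2 * v.size + 10)) (Cp := Pp.eval (2 * v.size + 10))
    (fun z hz => (hc z).mono (Pc.eval_mono_nat ?_))
    (fun z hz _ => (hp z).mono (Pp.eval_mono_nat ?_)) (fun z => z.fst.stackSize)
    (fun z hz h0 => ?_)
    (Val.pair (Val.pair v (Val.num 0)) (Val.num 0))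
    ⟨_, _, rfl, by simp [Val.size], by simp [Val.stackSize]⟩ v.size (by simp [Val.stackSize])
  · have := Prog.Runs.seq (hp₀ v) (p' := .loop c p)
      (f := fun _ => PMF.pure (Val.pair (Val.num 0) (Val.num v.size)))
      (C' := (v.size + 1) * (Pc.eval (2 * v.size + 10) + Pp.eval (2 * v.size + 10) + 1))
      (fun y hy => by
        simp only [PMF.support_pure, Set.mem_singleton_iff] at hy
        subst hy
        rw [PMF.iterWhile_sizeStep _ _ _ (by simp [Val.stackSize])] at key
        simpa [Val.stackSize] using key)
    simpa using this
  · obtain ⟨st, n, rfl, h1, h2⟩ := hz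
    have := Val.size_num_le n
    simp only [Val.size] at this ⊢
    omega
  · obtain ⟨st, n, rfl, h1, h2⟩ := hz
    have := Val.size_num_le n
    simp only [Val.size] at this ⊢
    omega
  · obtain ⟨st, n, rfl, h1, h2⟩ := hz
    obtain ⟨st', h3, h4, h5⟩ := Val.sizeStep_pair st n h0
    refine ⟨by simp only [Val.fst_pair]; omega, fun y hy => ?_⟩
    simp only [h3, PMF.support_pure, Set.mem_singleton_iff] at hy
    subst hy
    exact ⟨by simp only [Val.fst_pair]; omega, _, _, rfl, by omega, by omega⟩

/-- A program can thus compute its own resource bound, which is what clipping requires. -/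
theorem PolyFun.polynomial_size (P : Polynomial ℕ) : PolyFun fun v => Val.num (P.eval v.size) := by
  induction P using Polynomial.induction_on' with
  | add p q hp hq =>
    exact ((PolyFun.instr .add).comp (hp.pair hq)).congr fun x => by
      simp [Instr.eval, Val.arith]
  | monomial n a =>
    induction n with
    | zero => exact (PolyFun.const (Val.num a)).congr fun x => by simp
    | succ n ih =>
      exact ((PolyFun.instr .mul).comp (ih.pair PolyFun.size)).congr fun x => by
        simp [Instr.eval, Val.arith, pow_succ, mul_assoc]

/-- Replace data whose size exceeds a bound. -/
def Val.clip (n : ℕ) (v : Val) : Val := if v.size ≤ n then v else num 0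

theorem Val.clip_of_le {n : ℕ} {v : Val} (h : v.size ≤ n) : v.clip n = v := if_pos h

theorem Val.size_clip_le (n : ℕ) (v : Val) : (v.clip n).size ≤ n + 1 := by
  rw [clip]
  split_ifs
  · omega
  · simp [size]

/-- Makes a function size-bounded on all data without changing it where the bound holds anyway. -/
theorem PolyFun.clip {g e : Val → Val} (hg : PolyFun g) (he : PolyFun e) (P : Polynomial ℕ) :
    PolyFun fun x => (g x).clip (P.eval (e x).size) := by
  have h1 := (PolyFun.instr .sub).comp
    ((PolyFun.size.comp hg).pair ((PolyFun.polynomial_size P).comp he))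
  refine (PolyFun.ite_eq h1 (.const (Val.num 0)) hg (.const (Val.num 0))).congr fun x => ?_
  simp [Instr.eval, Val.arith, Nat.sub_eq_zero_iff_le, Val.clip]

theorem Val.size_ofList_le {l : List Val} {W : ℕ} (h : ∀ x ∈ l, x.size ≤ W) :
    (ofList l).size ≤ l.length * (W + 1) + 1 := by
  induction l with
  | nil => simp [ofList, size]
  | cons a l ih =>
    have h1 := h a (by simp)
    have h2 := ih fun x hx => h x (by simp [hx])
    simp only [ofList, size, List.length_cons, add_mul]
    omega

theorem Val.length_le_size_ofList (l : List Val) : l.length + 1 ≤ (ofList l).size := by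
  induction l with
  | nil => simp [ofList, size]
  | cons a l ih =>
    simp only [ofList, size, List.length_cons]
    omega

theorem Val.size_le_size_ofList {l : List Val} {x : Val} (h : x ∈ l) :
    x.size ≤ (ofList l).size := by
  induction l with
  | nil => simp at h
  | cons a l ih =>
    simp only [ofList, size]
    rcases List.mem_cons.1 h with rfl | h
    · omega
    · have := ih h
      omega

/-! ### Efficiently computable functions between encoded types -/

instance (α : Type) [Enc α] : Enc (List α) :=
  ⟨fun l => Val.ofList (l.map Enc.enc), fun _ _ h =>
    Enc.enc_injective.list_map (Val.ofList_injective h)⟩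

/-- The size of the representation of an element. -/
def encSize {α : Type} [Enc α] (a : α) : ℕ := (Enc.enc a).size

theorem encSize_prod {α β : Type} [Enc α] [Enc β] (a : α × β) :
    encSize a = encSize a.1 + encSize a.2 + 1 := rfl

theorem encSize_list_le {α : Type} [Enc α] {l : List α} {W : ℕ}
    (h : ∀ x ∈ l, encSize x ≤ W) : encSize l ≤ l.length * (W + 1) + 1 := by
  have := Val.size_ofList_le (l := l.map Enc.enc) (W := W) (List.forall_mem_map.2 h)
  rwa [List.length_map] at this

theorem length_le_encSize {α : Type} [Enc α] (l : List α) : l.length + 1 ≤ encSize l := by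
  have := Val.length_le_size_ofList (l.map Enc.enc)
  rwa [List.length_map] at this

theorem encSize_le_of_mem {α : Type} [Enc α] {l : List α} {x : α} (h : x ∈ l) :
    encSize x ≤ encSize l :=
  Val.size_le_size_ofList (List.mem_map_of_mem h)

theorem encSize_nat_le (n : ℕ) : encSize n ≤ n + 1 := Val.size_num_le n

theorem encSize_bool_le (b : Bool) : encSize b ≤ 2 := by cases b <;> decide

/-- A function that is bounded by a polynomial in the size of the argument. -/
def PolySize {α : Type} [Enc α] (B : α → ℕ) : Prop :=
  ∃ P : Polynomial ℕ, ∀ a, B a ≤ P.eval (encSize a)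

namespace PolySize

variable {α : Type} [Enc α] {B C : α → ℕ}

theorem of_le (hC : PolySize C) (h : ∀ a, B a ≤ C a) : PolySize B := by
  obtain ⟨P, hP⟩ := hC
  exact ⟨P, fun a => (h a).trans (hP a)⟩

theorem const (n : ℕ) : PolySize fun _ : α => n := ⟨Polynomial.C n, fun _ => by simp⟩

theorem encSize : PolySize (encSize : α → ℕ) := ⟨Polynomial.X, fun _ => by simp⟩

theorem add (hB : PolySize B) (hC : PolySize C) : PolySize fun a => B a + C a := by
  obtain ⟨P, hP⟩ := hB
  obtain ⟨Q, hQ⟩ := hC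
  exact ⟨P + Q, fun a => by simpa using Nat.add_le_add (hP a) (hQ a)⟩

theorem mul (hB : PolySize B) (hC : PolySize C) : PolySize fun a => B a * C a := by
  obtain ⟨P, hP⟩ := hB
  obtain ⟨Q, hQ⟩ := hC
  exact ⟨P * Q, fun a => by simpa using Nat.mul_le_mul (hP a) (hQ a)⟩

theorem eval (P : Polynomial ℕ) (hB : PolySize B) : PolySize fun a => P.eval (B a) := by
  obtain ⟨Q, hQ⟩ := hB
  exact ⟨P.comp Q, fun a => by simpa using P.eval_mono_nat (hQ a)⟩

end PolySize

/-- Replaces point masses by functions on data, so that the closure properties become equations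
between data. -/
theorem efficientlyComputable_iff {α β : Type} [Enc α] [Enc β] {f : α → β} :
    EfficientlyComputable f ↔ ∃ g, PolyFun g ∧ ∀ a, g (Enc.enc a) = Enc.enc (f a) := by
  constructor
  · rintro ⟨D, hD, h⟩
    obtain ⟨g, hg, hDg⟩ := (D.polyLaw.weaken fun _ => hD).exists_fun
    refine ⟨g, hg, fun a => ?_⟩
    have h1 := (hDg (Enc.enc a)).symm.trans (h a)
    have h2 := congrArg PMF.support h1
    simpa using h2
  · rintro ⟨g, hg, h⟩
    obtain ⟨B, hB, hBg⟩ := PolyLaw.exists_ppt hg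
    exact ⟨B, hB trivial, fun a => by rw [hBg, h]⟩

theorem EfficientlyComputable.of_val {α β : Type} [Enc α] [Enc β] {f : α → β} {g : Val → Val}
    (hg : PolyFun g) (h : ∀ a, g (Enc.enc a) = Enc.enc (f a)) : EfficientlyComputable f :=
  efficientlyComputable_iff.2 ⟨g, hg, h⟩

namespace EfficientlyComputable

variable {α β γ δ : Type} [Enc α] [Enc β] [Enc γ] [Enc δ]

theorem congr {f g : α → β} (h : EfficientlyComputable f) (hfg : ∀ a, f a = g a) :
    EfficientlyComputable g := (funext hfg : f = g) ▸ h

theorem polySize {f : α → β} (h : EfficientlyComputable f) : PolySize fun a => encSize (f a) := by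
  obtain ⟨g, hg, h⟩ := efficientlyComputable_iff.1 h
  obtain ⟨P, hP⟩ := hg.size_bound
  exact ⟨P, fun a => by
    have := hP (Enc.enc a)
    rwa [h] at this⟩

theorem comp {g : β → γ} {f : α → β} (hg : EfficientlyComputable g)
    (hf : EfficientlyComputable f) : EfficientlyComputable fun a => g (f a) := by
  obtain ⟨g', hg', hg⟩ := efficientlyComputable_iff.1 hg
  obtain ⟨f', hf', hf⟩ := efficientlyComputable_iff.1 hf
  exact of_val (hg'.comp hf') fun a => by rw [hf, hg]

theorem id : EfficientlyComputable fun a : α => a := of_val .id fun _ => rfl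

theorem const (b : β) : EfficientlyComputable fun _ : α => b :=
  of_val (.const (Enc.enc b)) fun _ => rfl

theorem pair {f : α → β} {g : α → γ} (hf : EfficientlyComputable f)
    (hg : EfficientlyComputable g) : EfficientlyComputable fun a => (f a, g a) := by
  obtain ⟨g', hg', hg⟩ := efficientlyComputable_iff.1 hg
  obtain ⟨f', hf', hf⟩ := efficientlyComputable_iff.1 hf
  exact of_val (hf'.pair hg') fun a => by rw [hf, hg]; rfl

theorem fst {f : α → β × γ} (hf : EfficientlyComputable f) :
    EfficientlyComputable fun a => (f a).1 :=
  (of_val (PolyFun.instr .fst) fun _ => rfl : EfficientlyComputable (Prod.fst : β × γ → β)).comp hf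

theorem snd {f : α → β × γ} (hf : EfficientlyComputable f) :
    EfficientlyComputable fun a => (f a).2 :=
  (of_val (PolyFun.instr .snd) fun _ => rfl : EfficientlyComputable (Prod.snd : β × γ → γ)).comp hf

theorem enc {f : α → β} (hf : EfficientlyComputable f) :
    EfficientlyComputable fun a => Enc.enc (f a) := by
  obtain ⟨f', hf', hf⟩ := efficientlyComputable_iff.1 hf
  exact of_val hf' hf

theorem valFst {f : α → Val} (hf : EfficientlyComputable f) :
    EfficientlyComputable fun a => (f a).fst :=
  (of_val (PolyFun.instr .fst) fun _ => rfl : EfficientlyComputable Val.fst).comp hf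

theorem valSnd {f : α → Val} (hf : EfficientlyComputable f) :
    EfficientlyComputable fun a => (f a).snd :=
  (of_val (PolyFun.instr .snd) fun _ => rfl : EfficientlyComputable Val.snd).comp hf

theorem cond {c : α → Bool} {f g : α → β} (hc : EfficientlyComputable c)
    (hf : EfficientlyComputable f) (hg : EfficientlyComputable g) :
    EfficientlyComputable fun a => bif c a then f a else g a := by
  obtain ⟨c', hc', hc⟩ := efficientlyComputable_iff.1 hc
  obtain ⟨g', hg', hg⟩ := efficientlyComputable_iff.1 hg
  obtain ⟨f', hf', hf⟩ := efficientlyComputable_iff.1 hf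
  refine of_val (hc'.ite hf' hg') fun a => ?_
  have h0 : Enc.enc false = Val.num 0 := rfl
  have h1 : Enc.enc true = Val.num 1 := rfl
  rw [hc, hf, hg]
  cases c a
  · simp [h0]
  · simp [h1]

theorem ite {c : α → Prop} [DecidablePred c] {f g : α → β}
    (hc : EfficientlyComputable fun a => decide (c a))
    (hf : EfficientlyComputable f) (hg : EfficientlyComputable g) :
    EfficientlyComputable fun a => if c a then f a else g a :=
  (cond hc hf hg).congr fun a => by simp [Bool.cond_decide]

theorem decide_eq [DecidableEq β] {f g : α → β} (hf : EfficientlyComputable f)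
    (hg : EfficientlyComputable g) : EfficientlyComputable fun a => decide (f a = g a) := by
  obtain ⟨g', hg', hg⟩ := efficientlyComputable_iff.1 hg
  obtain ⟨f', hf', hf⟩ := efficientlyComputable_iff.1 hf
  refine of_val ((PolyFun.instr .eq).comp (hf'.pair hg')) fun a => ?_
  rw [hf, hg]
  by_cases h : f a = g a
  · simp [Instr.eval, Val.eqTest, h]
    rfl
  · have : Enc.enc (f a) ≠ Enc.enc (g a) := fun h' => h (Enc.enc_injective h')
    simp [Instr.eval, Val.eqTest, h, this]
    rfl

theorem not {c : α → Bool} (hc : EfficientlyComputable c) :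
    EfficientlyComputable fun a => !c a :=
  (cond hc (const false) (const true)).congr fun a => by cases c a <;> rfl

theorem and {c d : α → Bool} (hc : EfficientlyComputable c) (hd : EfficientlyComputable d) :
    EfficientlyComputable fun a => c a && d a :=
  (cond hc hd (const false)).congr fun a => by cases c a <;> rfl

theorem or {c d : α → Bool} (hc : EfficientlyComputable c) (hd : EfficientlyComputable d) :
    EfficientlyComputable fun a => c a || d a :=
  (cond hc (const true) hd).congr fun a => by cases c a <;> rfl

theorem natAdd {f g : α → ℕ} (hf : EfficientlyComputable f) (hg : EfficientlyComputable g) :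
    EfficientlyComputable fun a => f a + g a :=
  (of_val (PolyFun.instr .add) fun _ => rfl :
    EfficientlyComputable fun p : ℕ × ℕ => p.1 + p.2).comp (hf.pair hg)

theorem natSub {f g : α → ℕ} (hf : EfficientlyComputable f) (hg : EfficientlyComputable g) :
    EfficientlyComputable fun a => f a - g a :=
  (of_val (PolyFun.instr .sub) fun _ => rfl :
    EfficientlyComputable fun p : ℕ × ℕ => p.1 - p.2).comp (hf.pair hg)

theorem natMul {f g : α → ℕ} (hf : EfficientlyComputable f) (hg : EfficientlyComputable g) :
    EfficientlyComputable fun a => f a * g a :=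
  (of_val (PolyFun.instr .mul) fun _ => rfl :
    EfficientlyComputable fun p : ℕ × ℕ => p.1 * p.2).comp (hf.pair hg)

theorem natMod {f g : α → ℕ} (hf : EfficientlyComputable f) (hg : EfficientlyComputable g) :
    EfficientlyComputable fun a => f a % g a :=
  (of_val (PolyFun.instr .mod) fun _ => rfl :
    EfficientlyComputable fun p : ℕ × ℕ => p.1 % p.2).comp (hf.pair hg)

/-- The difference of two numbers as an integer. -/
theorem intSub {f g : α → ℕ} (hf : EfficientlyComputable f) (hg : EfficientlyComputable g) :
    EfficientlyComputable fun a => (f a : ℤ) - g a := by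
  obtain ⟨h, hh, h1⟩ := efficientlyComputable_iff.1 ((natSub hf hg).pair (natSub hg hf))
  refine of_val hh fun a => (h1 a).trans ?_
  change Val.pair (Val.num _) (Val.num _) = Val.pair (Val.num _) (Val.num _)
  congr 2 <;> omega

theorem cons {f : α → β} {l : α → List β} (hf : EfficientlyComputable f)
    (hl : EfficientlyComputable l) : EfficientlyComputable fun a => f a :: l a := by
  obtain ⟨g', hg', hg⟩ := efficientlyComputable_iff.1 hl
  obtain ⟨f', hf', hf⟩ := efficientlyComputable_iff.1 hf
  exact of_val (hf'.pair hg') fun a => by rw [hf, hg]; rfl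

/-- A fold is efficiently computable if its step is and all intermediate results are of
polynomial size. -/
theorem foldl {step : α → γ → β → γ} {l : α → List β} {b : α → γ} {B : α → ℕ}
    (hstep : EfficientlyComputable fun p : α × β × γ => step p.1 p.2.2 p.2.1)
    (hl : EfficientlyComputable l) (hb : EfficientlyComputable b) (hB : PolySize B)
    (hsize : ∀ a l₁ l₂, l a = l₁ ++ l₂ → encSize (l₁.foldl (step a) (b a)) ≤ B a) :
    EfficientlyComputable fun a => (l a).foldl (step a) (b a) := by
  obtain ⟨s', hs', hs⟩ := efficientlyComputable_iff.1 hstep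
  obtain ⟨l', hl', hl⟩ := efficientlyComputable_iff.1 hl
  obtain ⟨b', hb', hb⟩ := efficientlyComputable_iff.1 hb
  obtain ⟨P, hP⟩ := hB
  -- The program must be fast on all data, whereas `hsize` speaks only about genuine inputs;
  -- therefore every intermediate result is clipped at a polynomial in the size of the context.
  have hclip := PolyFun.clip hs' PolyFun.id.fst P
  obtain ⟨F, hF, hFeq⟩ := PolyLaw.fold hclip (P + 1) (fun e x c y hy => by
    simp only [PMF.support_pure, Set.mem_singleton_iff] at hy
    subst hy
    have := P.eval_mono_nat (Nat.le_add_right e.size x.size)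
    have := Val.size_clip_le (P.eval e.size) (s' (e.pair (x.pair c)))
    simp only [Val.fst_pair, Polynomial.eval_add, Polynomial.eval_one]
    omega)
  obtain ⟨G, hG, hFG⟩ := hF.exists_fun
  refine of_val (hG.comp (PolyFun.id.pair (hl'.pair hb'))) fun a => ?_
  have h1 := (hFG (Val.pair (Enc.enc a) (Val.pair (Enc.enc (l a)) (Enc.enc (b a))))).symm
  rw [show Enc.enc (l a) = Val.ofList ((l a).map Enc.enc) from rfl, hFeq,
    PMF.foldList_pure] at h1
  have h2 := congrArg PMF.support h1
  simp only [PMF.support_pure, Set.singleton_eq_singleton_iff] at h2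
  rw [hl, hb, show Enc.enc (l a) = Val.ofList ((l a).map Enc.enc) from rfl, h2]
  -- Induction over prefixes of the list: `hsize` bounds each intermediate accumulator, so on
  -- genuine inputs clipping has no effect.
  suffices h : ∀ l₁ l₂, l a = l₁ ++ l₂ →
      (l₁.map Enc.enc).foldl (fun b x =>
        (s' ((Enc.enc a).pair (x.pair b))).clip
          (P.eval ((Enc.enc a).pair (x.pair b)).fst.size)) (Enc.enc (b a)) =
      Enc.enc (l₁.foldl (step a) (b a)) from h (l a) [] (by simp)
  intro l₁
  induction l₁ using List.reverseRecOn with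
  | nil => intro l₂ _; rfl
  | append_singleton l₁ x ih =>
    intro l₂ h
    have h3 := hsize a _ _ h
    rw [List.map_append, List.foldl_append, ih ([x] ++ l₂) (by simpa using h)]
    have h4 := hs (a, x, l₁.foldl (step a) (b a))
    rw [List.foldl_append] at h3 ⊢
    simp only [List.map_cons, List.map_nil, List.foldl_cons, List.foldl_nil, Val.fst_pair] at h3 ⊢
    have h5 : s' ((Enc.enc a).pair ((Enc.enc x).pair (Enc.enc (l₁.foldl (step a) (b a))))) =
      Enc.enc (step a (l₁.foldl (step a) (b a)) x) := h4
    rw [h5]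
    exact Val.clip_of_le (h3.trans (hP a))

end EfficientlyComputable

/-! ### List operations in polynomial time -/

namespace EfficientlyComputable

variable {α β γ δ : Type} [Enc α] [Enc β] [Enc γ] [Enc δ]

theorem reverse {l : α → List β} (hl : EfficientlyComputable l) :
    EfficientlyComputable fun a => (l a).reverse := by
  have hS := hl.polySize
  refine (foldl (step := fun _ c x => x :: c) (b := fun _ => [])
    (cons id.snd.fst id.snd.snd) hl (const [])
    ((hS.mul (hS.add (.const 1))).add (.const 1)) fun a l₁ l₂ h => ?_).congr fun a => ?_
  · rw [List.foldl_flip_cons_eq_append', List.append_nil]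
    refine (encSize_list_le (W := encSize (l a)) fun x hx => encSize_le_of_mem ?_).trans ?_
    · rw [h]
      exact List.mem_append_left _ (List.mem_reverse.1 hx)
    · have := length_le_encSize (l a)
      have h2 : l₁.length ≤ (l a).length := by simp [h]
      rw [List.length_reverse]
      gcongr
      omega
  · rw [List.foldl_flip_cons_eq_append', List.append_nil]

theorem map {g : α → β → γ} {l : α → List β} (hg : EfficientlyComputable fun p : α × β => g p.1 p.2)
    (hl : EfficientlyComputable l) : EfficientlyComputable fun a => (l a).map (g a) := by
  have hS := hl.polySize
  obtain ⟨P, hP⟩ := hg.polySize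
  have hfold : ∀ a (l : List β),
      l.foldl (fun c x => g a x :: c) [] = (l.map (g a)).reverse := fun a l => by
    rw [← List.append_nil (l.map (g a)).reverse, ← List.foldl_flip_cons_eq_append',
      List.foldl_map]
  have hW : PolySize fun a => P.eval (encSize a + encSize (l a) + 1) :=
    ((PolySize.encSize.add hS).add (.const 1)).eval P
  refine (reverse (foldl (step := fun a c x => g a x :: c) (b := fun _ => [])
    (cons (hg.comp (id.fst.pair id.snd.fst)) id.snd.snd) hl (const [])
    ((hS.mul (hW.add (.const 1))).add (.const 1)) fun a l₁ l₂ h => ?_)).congr fun a => ?_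
  · rw [hfold]
    refine (encSize_list_le (W := P.eval (encSize a + encSize (l a) + 1)) fun x hx => ?_).trans ?_
    · rw [List.mem_reverse, List.mem_map] at hx
      obtain ⟨y, hy, rfl⟩ := hx
      refine (hP (a, y)).trans (P.eval_mono_nat ?_)
      have : encSize y ≤ encSize (l a) := encSize_le_of_mem (h ▸ List.mem_append_left _ hy)
      rw [encSize_prod]
      simp only
      omega
    · have := length_le_encSize (l a)
      have h2 : l₁.length ≤ (l a).length := by simp [h]
      rw [List.length_reverse, List.length_map]
      gcongr
      omega
  · rw [hfold, List.reverse_reverse]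

theorem any {p : α → β → Bool} {l : α → List β}
    (hp : EfficientlyComputable fun x : α × β => p x.1 x.2)
    (hl : EfficientlyComputable l) : EfficientlyComputable fun a => (l a).any (p a) := by
  refine (foldl (step := fun a c x => c || p a x) (b := fun _ => false)
    (or id.snd.snd (hp.comp (id.fst.pair id.snd.fst))) hl (const false) (.const 2)
    fun a l₁ l₂ h => encSize_bool_le _).congr fun a => ?_
  have : ∀ (l : List β) c, l.foldl (fun c x => c || p a x) c = (c || l.any (p a)) := fun l => by
    induction l with
    | nil => simp
    | cons x l ih => intro c; simp [ih, Bool.or_assoc]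
  simp [this]

theorem all {p : α → β → Bool} {l : α → List β}
    (hp : EfficientlyComputable fun x : α × β => p x.1 x.2)
    (hl : EfficientlyComputable l) : EfficientlyComputable fun a => (l a).all (p a) :=
  (not (any (p := fun a x => !p a x) (not hp) hl)).congr fun a => by simp [List.all_eq_not_any_not]

theorem length {l : α → List β} (hl : EfficientlyComputable l) :
    EfficientlyComputable fun a => (l a).length := by
  have hfold : ∀ (l : List β) c, l.foldl (fun c _ => c + 1) c = c + l.length := fun l => by
    induction l with
    | nil => simp
    | cons x l ih => intro c; simp [ih]; omega
  refine (foldl (step := fun _ c _ => c + 1) (b := fun _ => 0) (natAdd id.snd.snd (const 1)) hl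
    (const 0) hl.polySize fun a l₁ l₂ h => ?_).congr fun a => by simp [hfold]
  rw [hfold, zero_add]
  refine (encSize_nat_le _).trans (le_trans ?_ (length_le_encSize (l a)))
  simp [h]

theorem sum {l : α → List ℕ} (hl : EfficientlyComputable l) :
    EfficientlyComputable fun a => (l a).sum := by
  -- A sum needs no more room than the list of its summands; the possible carry digit is paid for by
  -- the leaf constants.
  have hsize : ∀ l : List ℕ, encSize l.sum ≤ encSize l := fun l => by
    induction l with
    | nil => exact le_rfl
    | cons x l ih =>
      have h1 : encSize (x + l.sum) ≤ encSize x + encSize l.sum := by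
        have := Nat.size_mono_add x l.sum
        change Nat.size _ + 1 ≤ Nat.size _ + 1 + (Nat.size _ + 1)
        omega
      rw [List.sum_cons, show encSize (x :: l) = encSize x + encSize l + 1 from rfl]
      omega
  have hpre : ∀ l₁ l₂ : List ℕ, encSize l₁ ≤ encSize (l₁ ++ l₂) := fun l₁ l₂ => by
    induction l₁ with
    | nil => exact (Nat.succ_le_succ (Nat.zero_le _)).trans (length_le_encSize l₂)
    | cons x l ih => exact Nat.succ_le_succ (Nat.add_le_add_left ih _)
  refine (foldl (step := fun _ c x => c + x) (b := fun _ => 0) (natAdd id.snd.snd id.snd.fst) hl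
    (const 0) hl.polySize fun a l₁ l₂ h => ?_).congr fun a => by rw [List.sum_eq_foldl]
  rw [← List.sum_eq_foldl, h]
  exact (hsize l₁).trans (hpre l₁ l₂)

theorem sumMap {g : α → β → ℕ} {l : α → List β}
    (hg : EfficientlyComputable fun p : α × β => g p.1 p.2) (hl : EfficientlyComputable l) :
    EfficientlyComputable fun a => ((l a).map (g a)).sum := sum (map hg hl)

theorem range {l : α → List β} (hl : EfficientlyComputable l) :
    EfficientlyComputable fun a => List.range (l a).length := by
  have hfold : ∀ l : List β, l.foldl (fun (c : ℕ × List ℕ) _ => (c.1 + 1, c.1 :: c.2)) (0, []) =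
      (l.length, (List.range l.length).reverse) := fun l => by
    induction l using List.reverseRecOn with
    | nil => rfl
    | append_singleton l x ih => simp [List.foldl_append, ih, List.range_succ]
  have hS := hl.polySize
  refine (reverse (snd (foldl (step := fun _ (c : ℕ × List ℕ) _ => (c.1 + 1, c.1 :: c.2))
    (b := fun _ => (0, []))
    ((natAdd id.snd.snd.fst (const 1)).pair (cons id.snd.snd.fst id.snd.snd.snd)) hl (const _)
    (hS.add ((hS.mul (hS.add (.const 1))).add (.const 2)))
    fun a l₁ l₂ h => ?_))).congr fun a => by simp [hfold]
  have := length_le_encSize (l a)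
  have h2 : l₁.length ≤ (l a).length := by simp [h]
  rw [hfold, encSize_prod]
  have h3 := encSize_nat_le l₁.length
  have h4 : encSize (List.range l₁.length).reverse ≤
      l₁.length * (encSize (l a) + 1) + 1 := by
    refine (encSize_list_le (W := encSize (l a)) fun x hx => ?_).trans (by simp)
    rw [List.mem_reverse, List.mem_range] at hx
    have := encSize_nat_le x
    omega
  have h5 : l₁.length * (encSize (l a) + 1) ≤ encSize (l a) * (encSize (l a) + 1) :=
    Nat.mul_le_mul_right _ (by omega)
  simp only
  omega

/-- Random access by a fold that counts positions and keeps the entry at which the counter equals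
the index. -/
theorem getD {l : α → List β} {i : α → ℕ} {d : α → β} (hl : EfficientlyComputable l)
    (hi : EfficientlyComputable i) (hd : EfficientlyComputable d) :
    EfficientlyComputable fun a => (l a).getD (i a) (d a) := by
  have hfold : ∀ (l : List β) i d,
      l.foldl (fun (c : ℕ × β) x => (c.1 + 1, if c.1 = i then x else c.2)) (0, d) =
        (l.length, l.getD i d) := fun l i d => by
    induction l using List.reverseRecOn with
    | nil => rfl
    | append_singleton l x ih =>
      rw [List.foldl_append, ih]
      simp only [List.foldl_cons, List.foldl_nil, List.length_append, List.length_singleton,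
        Prod.mk.injEq, true_and]
      rcases lt_trichotomy l.length i with h | h | h
      · rw [if_neg h.ne, List.getD_eq_default _ _ h.le, List.getD_eq_default _ _ (by simpa using h)]
      · subst h
        simp [List.getD_eq_getElem?_getD]
      · rw [if_neg h.ne', List.getD_append _ _ _ _ h]
  have hS := hl.polySize
  refine (snd (foldl (step := fun a (c : ℕ × β) x => (c.1 + 1, if c.1 = i a then x else c.2))
    (b := fun a => (0, d a))
    ((natAdd id.snd.snd.fst (const 1)).pair
      (ite (decide_eq id.snd.snd.fst (hi.comp id.fst)) id.snd.fst id.snd.snd.snd)) hl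
      ((const 0).pair hd) (hS.add ((hS.add hd.polySize).add (.const 1)))
    fun a l₁ l₂ h => ?_)).congr fun a => by simp [hfold]
  rw [hfold, encSize_prod]
  have := length_le_encSize (l a)
  have h2 : l₁.length ≤ (l a).length := by simp [h]
  have h3 := encSize_nat_le l₁.length
  have h4 : encSize (l₁.getD (i a) (d a)) ≤ encSize (l a) + encSize (d a) := by
    by_cases hlt : i a < l₁.length
    · rw [List.getD_eq_getElem _ _ hlt]
      have : encSize l₁[i a] ≤ encSize (l a) :=
        encSize_le_of_mem (h ▸ List.mem_append_left _ (List.getElem_mem _))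
      omega
    · rw [List.getD_eq_default _ _ (by omega)]
      omega
  simp only
  omega

theorem append {l₁ l₂ : α → List β} (h₁ : EfficientlyComputable l₁)
    (h₂ : EfficientlyComputable l₂) : EfficientlyComputable fun a => l₁ a ++ l₂ a := by
  have hS := h₁.polySize.add h₂.polySize
  refine (foldl (step := fun _ c x => x :: c) (b := l₂) (cons id.snd.fst id.snd.snd)
    (reverse h₁) h₂ ((hS.mul (hS.add (.const 1))).add (.const 1))
    fun a k₁ k₂ h => ?_).congr fun a => by rw [List.foldl_flip_cons_eq_append', List.reverse_reverse]
  rw [List.foldl_flip_cons_eq_append']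
  refine (encSize_list_le (W := encSize (l₁ a) + encSize (l₂ a)) fun x hx => ?_).trans ?_
  · rcases List.mem_append.1 hx with hx | hx
    · have hx' : x ∈ (l₁ a).reverse := h ▸ List.mem_append_left _ (List.mem_reverse.1 hx)
      have := encSize_le_of_mem (List.mem_reverse.1 hx')
      omega
    · have := encSize_le_of_mem hx
      omega
  · have h3 := congrArg List.length h
    have h4 := length_le_encSize (l₁ a)
    have h5 := length_le_encSize (l₂ a)
    simp only [List.length_append, List.length_reverse] at h3 ⊢
    gcongr
    · omega
    · omega

/-- This is the tool for nested searches. The total length stays polynomial because each piece is no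
longer than its encoding, which is polynomial in its argument. -/
theorem flatMap {g : α → β → List γ} {l : α → List β}
    (hg : EfficientlyComputable fun p : α × β => g p.1 p.2)
    (hl : EfficientlyComputable l) : EfficientlyComputable fun a => (l a).flatMap (g a) := by
  have hS := hl.polySize
  obtain ⟨P, hP⟩ := hg.polySize
  have hfold : ∀ a (l : List β),
      l.foldl (fun c x => c ++ g a x) [] = l.flatMap (g a) := fun a l => by
    induction l using List.reverseRecOn with
    | nil => rfl
    | append_singleton l x ih => simp [List.foldl_append, ih]
  have hW : PolySize fun a => P.eval (encSize a + encSize (l a) + 1) :=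
    ((PolySize.encSize.add hS).add (.const 1)).eval P
  refine (foldl (step := fun a c x => c ++ g a x) (b := fun _ => [])
    (append id.snd.snd (hg.comp (id.fst.pair id.snd.fst))) hl (const [])
    (((hS.mul hW).mul (hW.add (.const 1))).add (.const 1)) fun a l₁ l₂ h => ?_).congr
    fun a => hfold _ _
  rw [hfold]
  have hx : ∀ x ∈ l₁, encSize (g a x) ≤ P.eval (encSize a + encSize (l a) + 1) := fun x hx => by
    refine (hP (a, x)).trans (P.eval_mono_nat ?_)
    have : encSize x ≤ encSize (l a) := encSize_le_of_mem (h ▸ List.mem_append_left _ hx)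
    rw [encSize_prod]
    simp only
    omega
  refine (encSize_list_le (W := P.eval (encSize a + encSize (l a) + 1)) fun y hy => ?_).trans ?_
  · obtain ⟨x, hxl, hy⟩ := List.mem_flatMap.1 hy
    exact (encSize_le_of_mem hy).trans (hx x hxl)
  · have h1 : (l₁.flatMap (g a)).length ≤
        l₁.length * P.eval (encSize a + encSize (l a) + 1) := by
      rw [List.length_flatMap]
      refine (List.sum_le_card_nsmul _ (P.eval (encSize a + encSize (l a) + 1))
        fun n hn => ?_).trans (by simp)
      obtain ⟨x, hxl, rfl⟩ := List.mem_map.1 hn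
      have := length_le_encSize (g a x)
      have := hx x hxl
      omega
    have h2 : l₁.length ≤ (l a).length := by simp [h]
    have := length_le_encSize (l a)
    gcongr
    refine h1.trans ?_
    gcongr
    omega

theorem filter {p : α → β → Bool} {l : α → List β}
    (hp : EfficientlyComputable fun x : α × β => p x.1 x.2)
    (hl : EfficientlyComputable l) : EfficientlyComputable fun a => (l a).filter (p a) := by
  refine (flatMap (g := fun a x => bif p a x then [x] else [])
    (cond hp (cons id.snd (const [])) (const [])) hl).congr fun a => ?_
  generalize l a = l
  induction l with
  | nil => rfl
  | cons x l ih => rw [List.flatMap_cons, ih, List.filter_cons]; cases p a x <;> rfl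

/-- The representation of the first entry of a list (of `0` for the empty list). -/
theorem encHead {l : α → List β} (hl : EfficientlyComputable l) :
    EfficientlyComputable fun a => ((l a).map Enc.enc).headD (Val.num 0) :=
  hl.enc.valFst.congr fun a => by
    cases l a <;> rfl

end EfficientlyComputable

namespace Unary

/-- The list that represents a number in unary notation. -/
def toList (u : Unary) : List ℕ := List.replicate u.val 0

end Unary

namespace EfficientlyComputable

variable {α β : Type} [Enc α] [Enc β]

theorem unaryToList {f : α → Unary} (hf : EfficientlyComputable f) :
    EfficientlyComputable fun a => (f a).toList := by
  refine (of_val .id fun u => ?_ : EfficientlyComputable Unary.toList).comp hf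
  change Val.ofList _ = Val.ofList _
  rw [Unary.toList, List.map_replicate]
  rfl

theorem unaryRange {f : α → Unary} (hf : EfficientlyComputable f) :
    EfficientlyComputable fun a => List.range (f a).val :=
  (range hf.unaryToList).congr fun a => by simp [Unary.toList]

/-- Overwriting all entries by zero leaves exactly the unary representation of the length. -/
theorem unaryLength {l : α → List β} (hl : EfficientlyComputable l) :
    EfficientlyComputable fun a => Unary.mk (l a).length := by
  have h : EfficientlyComputable fun l : List ℕ => l.map fun _ => (0 : ℕ) :=
    map (const 0) id
  obtain ⟨g, hg, hg'⟩ := efficientlyComputable_iff.1 h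
  refine (of_val hg fun l => ?_ :
    EfficientlyComputable fun l : List ℕ => Unary.mk l.length).comp
      (map (g := fun _ _ => (0 : ℕ)) (const 0) hl) |>.congr fun a => by simp
  rw [hg']
  change Val.ofList _ = Val.ofList _
  rw [List.map_map]
  congr 1
  exact List.eq_replicate_iff.2 ⟨by simp, by simp; intros; rfl⟩

end EfficientlyComputable

/-! ### Random sampling in polynomial time -/

/-- The law is the output law of a probabilistic polynomial-time algorithm. -/
def PolyTimeLaw {α β : Type} [Enc α] [Enc β] (f : α → PMF β) : Prop :=
  ∃ B : PPT, ∀ a, B.law (Enc.enc a) = (f a).map Enc.enc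

/-- The law of the list of independent random values for the entries of a list. -/
noncomputable def PMF.mapList {α β : Type} (f : α → PMF β) : List α → PMF (List β)
  | [] => PMF.pure []
  | a :: l => (f a).bind fun b => (PMF.mapList f l).map (List.cons b)

theorem PMF.foldList_cons {α β : Type} (f : α → PMF β) (l : List α) (c : List β) :
    PMF.foldList (fun c x => (f x).map fun y => y :: c) c l =
      (PMF.mapList f l).map fun ys => ys.reverse ++ c := by
  induction l generalizing c with
  | nil => simp [PMF.foldList, PMF.mapList, PMF.pure_map]
  | cons a l ih =>
    simp only [PMF.foldList, PMF.mapList, PMF.bind_map, PMF.map_bind, PMF.map_comp]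
    refine congrArg _ (funext fun y => ?_)
    simp only [Function.comp_apply, ih]
    congr 1
    funext ys
    simp

namespace PolyTimeLaw

variable {α β γ : Type} [Enc α] [Enc β] [Enc γ]

theorem iff_polyLaw {f : α → PMF β} :
    PolyTimeLaw f ↔ ∃ F, PolyLaw False F ∧ ∀ a, F (Enc.enc a) = (f a).map Enc.enc := by
  constructor
  · rintro ⟨B, hB⟩
    exact ⟨B.law, B.polyLaw.weaken False.elim, hB⟩
  · rintro ⟨F, hF, h⟩
    obtain ⟨B, -, hB⟩ := hF.exists_ppt
    exact ⟨B, fun a => by rw [hB, h]⟩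

theorem congr {f g : α → PMF β} (h : PolyTimeLaw f) (hfg : ∀ a, f a = g a) : PolyTimeLaw g :=
  (funext hfg : f = g) ▸ h

theorem of_efficientlyComputable {f : α → β} (hf : EfficientlyComputable f) :
    PolyTimeLaw fun a => PMF.pure (f a) := by
  obtain ⟨D, -, hD⟩ := hf
  exact ⟨D, fun a => by rw [hD, PMF.pure_map]⟩

theorem comp {f : β → PMF γ} {g : α → β} (hf : PolyTimeLaw f) (hg : EfficientlyComputable g) :
    PolyTimeLaw fun a => f (g a) := by
  obtain ⟨F, hF, hf⟩ := iff_polyLaw.1 hf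
  obtain ⟨g', hg', hg⟩ := efficientlyComputable_iff.1 hg
  exact iff_polyLaw.2 ⟨_, PolyLaw.fun_comp hg' hF, fun a => by rw [hg, hf]⟩

/-- The continuation depends on the input as well, so the program carries the input along with the
drawn value. -/
theorem bind {f : α → PMF β} {g : α → β → PMF γ} (hf : PolyTimeLaw f)
    (hg : PolyTimeLaw fun p : α × β => g p.1 p.2) : PolyTimeLaw fun a => (f a).bind (g a) := by
  obtain ⟨F, hF, hf⟩ := iff_polyLaw.1 hf
  obtain ⟨G, hG, hg⟩ := iff_polyLaw.1 hg
  have hid : PolyLaw False fun x => PMF.pure x := PolyFun.id.weaken fun _ => trivial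
  refine iff_polyLaw.2 ⟨_, (hid.pair hF).comp hG, fun a => ?_⟩
  rw [PMF.pure_bind, hf, PMF.map_comp, PMF.bind_map, PMF.map_bind]
  exact congrArg _ (funext fun b => hg (a, b))

theorem map {f : α → PMF β} {g : α → β → γ} (hf : PolyTimeLaw f)
    (hg : EfficientlyComputable fun p : α × β => g p.1 p.2) :
    PolyTimeLaw fun a => (f a).map (g a) :=
  (hf.bind (of_efficientlyComputable hg)).congr fun _ => PMF.bind_pure_comp _ _

theorem uniform {N : α → ℕ} (hN : EfficientlyComputable N) :
    PolyTimeLaw fun a => (PMF.uniformOfFintype (Fin (N a + 1))).map Fin.val := by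
  obtain ⟨N', hN', hN⟩ := efficientlyComputable_iff.1 hN
  refine iff_polyLaw.2 ⟨_, PolyLaw.fun_comp hN' .rand, fun a => ?_⟩
  rw [hN, PMF.map_comp]
  exact Val.uniform_num _

/-- The fold prepends one sample per entry. The samples of a program are of polynomial size on all
data, hence no clipping is needed here. -/
theorem mapList {g : α → β → PMF γ} {l : α → List β}
    (hg : PolyTimeLaw fun p : α × β => g p.1 p.2) (hl : EfficientlyComputable l) :
    PolyTimeLaw fun a => PMF.mapList (g a) (l a) := by
  suffices h : PolyTimeLaw fun a =>
      PMF.foldList (fun c x => (g a x).map fun y => y :: c) [] (l a) from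
    (h.map (g := fun _ l => l.reverse) (EfficientlyComputable.reverse (.snd .id))).congr fun a => by
      rw [PMF.foldList_cons, PMF.map_comp]
      convert PMF.map_id _
      simp
  obtain ⟨G, hG, hg⟩ := iff_polyLaw.1 hg
  obtain ⟨l', hl', hl⟩ := efficientlyComputable_iff.1 hl
  obtain ⟨P, hP⟩ := hG.size_bound
  have hx := PolyFun.id
  have hid : PolyLaw False fun x => PMF.pure x := PolyFun.id.weaken fun _ => trivial
  have hstep : PolyLaw False fun x => (G (x.fst.pair x.snd.fst)).map fun y => y.pair x.snd.snd :=
    ((hid.pair (PolyLaw.fun_comp (hx.fst.pair hx.snd.fst) hG)).comp_fun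
      (hx.snd.pair hx.fst.snd.snd)).congr fun x => by
        rw [PMF.pure_bind, PMF.map_comp]
        rfl
  -- The argument of `G` is a pair, of size one more than its components; the outer one is the list
  -- node.
  obtain ⟨F, hF, hFeq⟩ := PolyLaw.fold hstep (P.comp (Polynomial.X + 1) + 1)
    (fun e x b y hy => by
      rw [PMF.mem_support_map_iff] at hy
      obtain ⟨z, hz, rfl⟩ := hy
      have := hP _ _ hz
      simp only [Val.size, Val.fst_pair, Val.snd_pair, Polynomial.eval_add, Polynomial.eval_comp,
        Polynomial.eval_X, Polynomial.eval_one] at this ⊢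
      omega)
  refine iff_polyLaw.2 ⟨_, PolyLaw.fun_comp (hx.pair (hl'.pair (.const (Enc.enc ([] : List γ)))))
    hF, fun a => ?_⟩
  rw [hl, show Enc.enc (l a) = Val.ofList ((l a).map Enc.enc) from rfl, hFeq]
  generalize ([] : List γ) = c
  generalize l a = l
  induction l generalizing c with
  | nil => simp [PMF.foldList, PMF.pure_map]
  | cons x l ih =>
    simp only [List.map_cons, PMF.foldList, Val.fst_pair, Val.snd_pair]
    have h1 : G ((Enc.enc a).pair (Enc.enc x)) = (g a x).map Enc.enc := hg (a, x)
    rw [h1, PMF.map_comp, PMF.bind_map, PMF.bind_map, PMF.map_bind]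
    exact congrArg _ (funext fun y => ih (y :: c))

end PolyTimeLaw

/-! ### The encoder and the decoder on lists of natural numbers -/

/-- Tuples whose length depends on the security parameter form a different type for each parameter.
Their data are also data of lists, which form one type, and this is what allows a single algorithm
for all parameters. -/
theorem Enc.enc_fun_eq {N : ℕ} {α β : Type} [Enc α] [Enc β] {v : Fin N → α} {w : Fin N → β}
    (h : ∀ i, Enc.enc (v i) = Enc.enc (w i)) : Enc.enc v = Enc.enc (List.ofFn w) := by
  change Val.ofList _ = Val.ofList _
  rw [List.map_ofFn]
  congr 2
  funext i
  exact h i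

theorem Enc.enc_finset_eq {N : ℕ} (X : Finset (Fin N)) :
    Enc.enc X = Enc.enc (List.ofFn fun x => decide (x ∈ X)) := Enc.enc_fun_eq fun _ => rfl

theorem Enc.enc_matrix_eq {n m q : ℕ} [NeZero q] (A : Matrix (Fin n) (Fin m) (ZMod q)) :
    Enc.enc A = Enc.enc (List.ofFn fun i => List.ofFn fun j => (A i j).val) :=
  Enc.enc_fun_eq fun _ => Enc.enc_fun_eq fun _ => rfl

theorem List.map_range_eq_ofFn {α : Type*} {N : ℕ} {f : ℕ → α} {g : Fin N → α}
    (h : ∀ i : Fin N, f i = g i) : (List.range N).map f = List.ofFn g := by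
  refine List.ext_getElem (by simp) fun i h1 h2 => ?_
  simpa using h ⟨i, by simpa using h1⟩

theorem List.getD_ofFn {α : Type*} {N : ℕ} (f : Fin N → α) (i : Fin N) (d : α) :
    (List.ofFn f).getD i d = f i := by simp

theorem List.any_ofFn {α : Type*} {N : ℕ} (f : Fin N → α) (p : α → Bool) :
    (List.ofFn f).any p = decide (∃ i, p (f i) = true) := by
  rw [Bool.eq_iff_iff]
  simp [List.any_eq_true, List.mem_ofFn]

theorem List.any_range {N : ℕ} (p : ℕ → Bool) :
    (List.range N).any p = decide (∃ i : Fin N, p i = true) := by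
  rw [Bool.eq_iff_iff]
  simp [List.any_eq_true, Fin.exists_iff]

theorem List.sum_map_range_eq {M : Type*} [AddCommMonoid M] {N : ℕ} (f : ℕ → M) :
    ((List.range N).map f).sum = ∑ i : Fin N, f i := by
  rw [← Finset.sum_range]
  rfl

namespace IBLT

section Lists

variable (k T n m q : ℕ) (r A : ℕ → ℕ → ℕ)

/-- The table with the given entries, as a list of lists. -/
def listTable (g : ℕ → ℕ → ℕ → ℕ) : List (List (List ℕ)) :=
  (List.range k).map fun i => (List.range T).map fun j => (List.range n).map fun a => g i j a

def listEncode (X : ℕ → Bool) : List (List (List ℕ)) :=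
  listTable k T n fun i j a =>
    ((List.range m).map fun x => bif X x && decide (r i x = j) then A a x else 0).sum % q

/-- For representatives below `q` the truncated subtraction from `q` is exact and represents the
negative. -/
def listSub (H₀ H₁ : List (List (List ℕ))) : List (List (List ℕ)) :=
  listTable k T n fun i j a =>
    (((H₀.getD i []).getD j []).getD a 0 + (q - ((H₁.getD i []).getD j []).getD a 0)) % q

/-- Membership of a vector in a table. -/
def listMem (H : List (List (List ℕ))) (w : List ℕ) : Bool :=
  H.any fun row => row.any fun c => decide (c = w)

def listCol (x : ℕ) : List ℕ := (List.range n).map fun a => A a x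

def listNegCol (x : ℕ) : List ℕ := (List.range n).map fun a => (q - A a x) % q

/-- The column of `x` is the content of a cell. -/
def listPlus (H : List (List (List ℕ))) (x : ℕ) : Bool := listMem H (listCol n A x)

/-- The negative of the column of `x` is the content of a cell, and different from the column. -/
def listMinus (H : List (List (List ℕ))) (x : ℕ) : Bool :=
  listMem H (listNegCol n q A x) && !decide (listNegCol n q A x = listCol n A x)

/-- Subtracting a column means adding `q` minus its entries, and subtracting its negative means
adding the entries. Both can happen in one round; `listMinus` excludes a negative equal to the
column, so that such a pair is counted once, as in a set. -/
def listPeel (H : List (List (List ℕ))) : List (List (List ℕ)) :=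
  listTable k T n fun i j a =>
    (((H.getD i []).getD j []).getD a 0 +
      ((List.range m).map fun x => bif decide (r i x = j) then
        (bif listPlus n A H x then q - A a x else 0) + (bif listMinus n q A H x then A a x else 0)
        else 0).sum) % q

def listRound (S : List (List (List ℕ)) × List Bool) : List (List (List ℕ)) × List Bool :=
  (listPeel k T n m q r A S.1, (List.range m).map fun x =>
    S.2.getD x false || (listPlus n A S.1 x || listMinus n q A S.1 x))

/-- All `m` rounds are executed without a test for termination, since a round without peelable pairs
changes nothing. -/
def listRounds (H : List (List (List ℕ))) : List (List (List ℕ)) × List Bool :=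
  (List.range m).foldl (fun S _ => listRound k T n m q r A S)
    (H, (List.range m).map fun _ => false)

/-- The result of the decoder in terms of the state after `m` rounds. -/
def listResult (S : List (List (List ℕ)) × List Bool) : Option (List Bool) :=
  if (!((List.range m).any fun x => listPlus n A S.1 x || listMinus n q A S.1 x) &&
      S.1.all fun row => row.all fun c => c.all fun z => decide (z = 0)) = true
  then some S.2 else none

def listDecode (H₀ H₁ : List (List (List ℕ))) : Option (List Bool) :=
  listResult n m q A (listRounds k T n m q r A (listSub k T n q H₀ H₁))

end Lists

/-! ### The list algorithms agree with the construction -/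

section Correctness

variable {n m q k : ℕ} {t : ℕ+}
  (r : Fin k → Fin m → Fin (2 * t)) (A : Matrix (Fin n) (Fin m) (ZMod q))

/-- A table as a list of lists of lists of representatives. -/
def Table.toLists (H : Table n q k t) : List (List (List ℕ)) :=
  List.ofFn fun i => List.ofFn fun j => List.ofFn fun a => (H i j a).val

/-- A set as its list of membership values. -/
def finsetToList (X : Finset (Fin m)) : List Bool := List.ofFn fun x => decide (x ∈ X)

theorem listTable_eq {g : ℕ → ℕ → ℕ → ℕ} {H : Table n q k t}
    (h : ∀ (i : Fin k) (j : Fin (2 * t)) (a : Fin n), g i j a = (H i j a).val) :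
    listTable k (2 * t) n g = H.toLists :=
  List.map_range_eq_ofFn fun i => List.map_range_eq_ofFn fun j => List.map_range_eq_ofFn fun a =>
    h i j a

theorem getD_toLists (H : Table n q k t) (i : Fin k) (j : Fin (2 * t)) (a : Fin n) :
    ((H.toLists.getD i []).getD j []).getD a 0 = (H i j a).val := by
  rw [Table.toLists, List.getD_ofFn, List.getD_ofFn, List.getD_ofFn]

theorem column_apply (x : Fin m) (a : Fin n) : column A x a = A a x := by
  simp [column]

variable {r A} {r' A' : ℕ → ℕ → ℕ}

theorem listCol_eq (hA : ∀ (a : Fin n) (x : Fin m), A' a x = (A a x).val) (x : Fin m) :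
    listCol n A' x = List.ofFn fun a => (column A x a).val :=
  List.map_range_eq_ofFn fun a => by rw [hA, column_apply]

variable [NeZero q]

theorem enc_table (H : Table n q k t) : Enc.enc H = Enc.enc H.toLists :=
  Enc.enc_fun_eq fun _ => Enc.enc_fun_eq fun _ => Enc.enc_fun_eq fun _ => rfl

theorem listSub_eq (H₀ H₁ : Table n q k t) :
    listSub k (2 * t) n q H₀.toLists H₁.toLists = (H₀ - H₁).toLists := by
  refine listTable_eq fun i j a => ?_
  rw [getD_toLists, getD_toLists, ← ZMod.val_natCast, Nat.cast_add,
    Nat.cast_sub (ZMod.val_lt _).le]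
  simp [sub_eq_add_neg]

theorem listEncode_eq (hr : ∀ (i : Fin k) (x : Fin m), r' i x = r i x)
    (hA : ∀ (a : Fin n) (x : Fin m), A' a x = (A a x).val) {X' : ℕ → Bool} {X : Finset (Fin m)}
    (hX : ∀ x : Fin m, X' x = decide (x ∈ X)) :
    listEncode k (2 * t) n m q r' A' X' = (encode r A X).toLists := by
  refine listTable_eq fun i j a => ?_
  rw [← ZMod.val_natCast, List.sum_map_range_eq, encode, Finset.sum_apply, Finset.sum_filter,
    Nat.cast_sum]
  congr 1
  rw [← Finset.sum_subset (Finset.subset_univ X)]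
  · refine Finset.sum_congr rfl fun x hx => ?_
    rw [hX, hr, hA, column_apply]
    by_cases h : r i x = j <;> simp [hx, h, Fin.val_inj]
  · intro x _ hx
    simp [hX, hx]

theorem listMem_eq (H : Table n q k t) (w : Fin n → ZMod q) {l : List ℕ}
    (hl : l = List.ofFn fun a => (w a).val) :
    listMem H.toLists l = decide (∃ i j, H i j = w) := by
  subst hl
  rw [listMem, Table.toLists, List.any_ofFn]
  congr 1
  simp only [List.any_ofFn, decide_eq_true_eq, eq_iff_iff]
  refine exists_congr fun i => exists_congr fun j => ?_
  rw [List.ofFn_inj, funext_iff, funext_iff]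
  exact forall_congr' fun a => (ZMod.val_injective q).eq_iff

theorem listNegCol_eq (hA : ∀ (a : Fin n) (x : Fin m), A' a x = (A a x).val) (x : Fin m) :
    listNegCol n q A' x = List.ofFn fun a => ((-column A x) a).val :=
  List.map_range_eq_ofFn fun a => by
    rw [hA, ← ZMod.val_natCast, Nat.cast_sub (ZMod.val_lt _).le, Pi.neg_apply, column_apply]
    simp

theorem listPlus_eq (hA : ∀ (a : Fin n) (x : Fin m), A' a x = (A a x).val) (H : Table n q k t)
    (x : Fin m) : listPlus n A' H.toLists x = decide (∃ i j, H i j = column A x) :=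
  listMem_eq H _ (listCol_eq hA x)

theorem listMinus_eq (hA : ∀ (a : Fin n) (x : Fin m), A' a x = (A a x).val) (H : Table n q k t)
    (x : Fin m) : listMinus n q A' H.toLists x =
      decide ((∃ i j, H i j = -column A x) ∧ -column A x ≠ column A x) := by
  rw [listMinus, listMem_eq H _ (listNegCol_eq hA x), listCol_eq hA, listNegCol_eq hA,
    Bool.decide_and, ← decide_not]
  congr 2
  rw [List.ofFn_inj]
  simp only [ne_eq, eq_iff_iff, not_iff_not, funext_iff]
  exact forall_congr' fun a => (ZMod.val_injective q).eq_iff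

/-- The second summand carries `d ≠ c` because a common value is to be counted once; for `d = -c`
this concerns columns that equal their negatives. -/
theorem sum_ite_eq_or_eq {W : Type*} [Fintype W] [DecidableEq W] [AddCommMonoid W]
    (p : W → Prop) [DecidablePred p] (c d : W) :
    (∑ w, if p w ∧ (w = c ∨ w = d) then w else 0) =
      (if p c then c else 0) + if p d ∧ d ≠ c then d else 0 := by
  have h : ∀ w, (if p w ∧ (w = c ∨ w = d) then w else 0) =
      (if w = c then (if p c then c else 0) else 0) +
        if w = d then (if p d ∧ d ≠ c then d else 0) else 0 := by
    intro w
    by_cases h1 : w = c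
    · subst h1
      by_cases h2 : w = d
      · subst h2
        simp
      · simp [h2]
    · by_cases h2 : w = d
      · subst h2
        simp [h1]
      · simp [h1, h2]
  simp only [h, Finset.sum_add_distrib, Finset.sum_ite_eq', Finset.mem_univ, if_true]

theorem sum_peelable (H : Table n q k t) (i : Fin k) (j : Fin (2 * t)) :
    ∑ z ∈ peelable A H with r i z.1 = j, z.2 =
      ∑ x : Fin m, if r i x = j then
        (if ∃ i j, H i j = column A x then column A x else 0) +
        (if (∃ i j, H i j = -column A x) ∧ -column A x ≠ column A x then -column A x else 0)
        else 0 := by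
  rw [peelable, Finset.filter_filter, Finset.sum_filter, Fintype.sum_prod_type]
  refine Finset.sum_congr rfl fun x _ => ?_
  by_cases h : r i x = j
  · simp only [h, and_true, if_true]
    exact sum_ite_eq_or_eq (fun w => ∃ i j, H i j = w) _ _
  · simp [h]

theorem listPeel_eq (hr : ∀ (i : Fin k) (x : Fin m), r' i x = r i x)
    (hA : ∀ (a : Fin n) (x : Fin m), A' a x = (A a x).val) (H : Table n q k t) :
    listPeel k (2 * t) n m q r' A' H.toLists = (peel r H (peelable A H)).toLists := by
  refine listTable_eq fun i j a => ?_
  rw [← ZMod.val_natCast, List.sum_map_range_eq, peel, sum_peelable, getD_toLists, Pi.sub_apply,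
    Finset.sum_apply, Nat.cast_add, sub_eq_add_neg, ← Finset.sum_neg_distrib, Nat.cast_sum,
    ZMod.natCast_zmod_val]
  congr 2
  refine Finset.sum_congr rfl fun x _ => ?_
  rw [listPlus_eq hA, listMinus_eq hA, hr, hA]
  simp only [Fin.val_inj]
  by_cases h1 : r i x = j
  · by_cases h2 : ∃ i j, H i j = column A x <;>
      by_cases h3 : (∃ i j, H i j = -column A x) ∧ -column A x ≠ column A x <;>
      simp [h1, h2, h3, Nat.cast_sub (ZMod.val_lt (A a x)).le, column_apply]
  · simp [h1]

theorem mem_image_peelable (H : Table n q k t) (x : Fin m) :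
    x ∈ (peelable A H).image Prod.fst ↔ (∃ i j, H i j = column A x) ∨
      ((∃ i j, H i j = -column A x) ∧ -column A x ≠ column A x) := by
  simp only [peelable, Finset.mem_image, Finset.mem_filter, Finset.mem_univ, true_and]
  constructor
  · rintro ⟨⟨x, w⟩, ⟨h1, h2 | h2⟩, rfl⟩
    · exact Or.inl (h2 ▸ h1)
    · simp only at h2 h1 ⊢
      subst h2
      by_cases h : -column A x = column A x
      · exact Or.inl (by simpa [h] using h1)
      · exact Or.inr ⟨h1, h⟩
  · rintro (h | ⟨h, -⟩)
    · exact ⟨(x, _), ⟨h, Or.inl rfl⟩, rfl⟩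
    · exact ⟨(x, _), ⟨h, Or.inr rfl⟩, rfl⟩

/-- One round of the decoder. -/
def round (r : Fin k → Fin m → Fin (2 * t)) (A : Matrix (Fin n) (Fin m) (ZMod q))
    (S : Table n q k t × Finset (Fin m)) : Table n q k t × Finset (Fin m) :=
  (peel r S.1 (peelable A S.1), S.2 ∪ (peelable A S.1).image Prod.fst)

theorem round_eq_self {S : Table n q k t × Finset (Fin m)} (h : peelable A S.1 = ∅) :
    round r A S = S := by
  refine Prod.ext ?_ ?_
  · funext i j
    simp [round, peel, h]
  · simp [round, h]

/-- A state without peelable pairs is a fixed point of `round`, so leaving the loop early or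
iterating further gives the same state. A budget of `c + 1` covers `c` effective rounds and the
final empty one. -/
theorem decodeLoop_eq (c : ℕ) (S : Table n q k t × Finset (Fin m)) :
    decodeLoop r A (c + 1) S.1 S.2 =
      if peelable A ((round r A)^[c] S).1 = ∅ then some ((round r A)^[c] S) else none := by
  induction c generalizing S with
  | zero =>
    rw [decodeLoop, Function.iterate_zero, id_eq]
    split_ifs with h
    · exact congrArg some (round_eq_self (r := r) h)
    · rfl
  | succ c ih =>
    rw [decodeLoop]
    split_ifs with h1 h2 h2
    · rw [Function.iterate_fixed (round_eq_self h1)]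
      exact congrArg some (round_eq_self (r := r) h1)
    · rw [Function.iterate_fixed (round_eq_self h1)] at h2
      exact absurd h1 h2
    · have := ih (round r A S)
      rw [← Function.iterate_succ_apply, if_pos h2] at this
      exact this
    · have := ih (round r A S)
      rw [← Function.iterate_succ_apply, if_neg h2] at this
      exact this

theorem listRound_eq (hr : ∀ (i : Fin k) (x : Fin m), r' i x = r i x)
    (hA : ∀ (a : Fin n) (x : Fin m), A' a x = (A a x).val) (S : Table n q k t × Finset (Fin m)) :
    listRound k (2 * t) n m q r' A' (S.1.toLists, finsetToList S.2) =
      ((round r A S).1.toLists, finsetToList (round r A S).2) := by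
  refine Prod.ext (listPeel_eq hr hA _) (List.map_range_eq_ofFn fun x => ?_)
  rw [finsetToList, List.getD_ofFn, listPlus_eq hA, listMinus_eq hA, Bool.eq_iff_iff]
  simp only [Bool.or_eq_true, decide_eq_true_eq, round, Finset.mem_union, mem_image_peelable]

theorem listRounds_eq (hr : ∀ (i : Fin k) (x : Fin m), r' i x = r i x)
    (hA : ∀ (a : Fin n) (x : Fin m), A' a x = (A a x).val) (H : Table n q k t) :
    listRounds k (2 * t) n m q r' A' H.toLists =
      (((round r A)^[m] (H, ∅)).1.toLists, finsetToList ((round r A)^[m] (H, ∅)).2) := by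
  have h : ∀ c, (List.range c).foldl (fun S _ => listRound k (2 * t) n m q r' A' S)
      (H.toLists, finsetToList ∅) =
      (((round r A)^[c] (H, ∅)).1.toLists, finsetToList ((round r A)^[c] (H, ∅)).2) := fun c => by
    induction c with
    | zero => rfl
    | succ c ih =>
      rw [List.range_succ, List.foldl_append, ih]
      simp only [List.foldl_cons, List.foldl_nil]
      rw [listRound_eq hr hA, Function.iterate_succ_apply']
  rw [← h, listRounds, List.map_range_eq_ofFn]
  · rfl
  · simp

theorem listDecode_eq (hr : ∀ (i : Fin k) (x : Fin m), r' i x = r i x)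
    (hA : ∀ (a : Fin n) (x : Fin m), A' a x = (A a x).val) (H₀ H₁ : Table n q k t) :
    listDecode k (2 * t) n m q r' A' H₀.toLists H₁.toLists =
      (decode r A H₀ H₁).map finsetToList := by
  rw [listDecode, listSub_eq, listRounds_eq hr hA, decode,
    decodeLoop_eq m (H₀ - H₁, (∅ : Finset (Fin m)))]
  set S := (round r A)^[m] (H₀ - H₁, ∅)
  have h1 : ((List.range m).any fun x => listPlus n A' S.1.toLists x ||
      listMinus n q A' S.1.toLists x) = decide (peelable A S.1 ≠ ∅) := by
    rw [List.any_range, decide_eq_decide, ← Finset.nonempty_iff_ne_empty,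
      ← Finset.image_nonempty (f := Prod.fst)]
    refine exists_congr fun x => ?_
    rw [mem_image_peelable, listPlus_eq hA, listMinus_eq hA]
    simp only [Bool.or_eq_true, decide_eq_true_eq]
  have h2 : (S.1.toLists.all fun row => row.all fun c => c.all fun z => decide (z = 0)) =
      decide (S.1 = 0) := by
    rw [Bool.eq_iff_iff]
    simp [Table.toLists, List.mem_ofFn, funext_iff]
  rw [listResult, h1, h2]
  by_cases h3 : peelable A S.1 = ∅
  · rw [if_pos h3]
    by_cases h4 : S.1 = 0
    · rw [if_pos (by rw [decide_eq_true h4, decide_eq_false (not_not.2 h3)]; rfl)]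
      simp [h4]
    · rw [if_neg (by simp [h4])]
      simp [h4]
  · rw [if_neg h3, if_neg (by simp [h3])]
    rfl

end Correctness

end IBLT

/-! ### Running times of the list algorithms -/

theorem EfficientlyComputable.some {α β : Type} [Enc α] [Enc β] {f : α → β}
    (hf : EfficientlyComputable f) : EfficientlyComputable fun a => Option.some (f a) := by
  obtain ⟨g, hg, h⟩ := efficientlyComputable_iff.1 hf
  exact .of_val ((PolyFun.const (Val.num 1)).pair hg) fun a => by rw [h]; rfl

namespace IBLT

open EfficientlyComputable

section

variable {α : Type} [Enc α] {k T n m q : α → ℕ} {r A : α → ℕ → ℕ → ℕ}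

theorem efficient_listTable {g : α → ℕ → ℕ → ℕ → ℕ}
    (hk : EfficientlyComputable fun a => List.range (k a))
    (hT : EfficientlyComputable fun a => List.range (T a))
    (hn : EfficientlyComputable fun a => List.range (n a))
    (hg : EfficientlyComputable fun p : α × ℕ × ℕ × ℕ => g p.1 p.2.1 p.2.2.1 p.2.2.2) :
    EfficientlyComputable fun a => listTable (k a) (T a) (n a) (g a) :=
  map (g := fun a i => (List.range (T a)).map fun j => (List.range (n a)).map fun b => g a i j b)
    (map (g := fun (p : α × ℕ) j => (List.range (n p.1)).map fun b => g p.1 p.2 j b)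
      (map (g := fun (p : (α × ℕ) × ℕ) b => g p.1.1 p.1.2 p.2 b)
        (hg.comp (id.fst.fst.fst.pair (id.fst.fst.snd.pair (id.fst.snd.pair id.snd))))
        (hn.comp id.fst.fst)) (hT.comp id.fst)) hk

theorem efficient_entry {H : α → List (List (List ℕ))} {i j b : α → ℕ}
    (hH : EfficientlyComputable H) (hi : EfficientlyComputable i) (hj : EfficientlyComputable j)
    (hb : EfficientlyComputable b) :
    EfficientlyComputable fun a => (((H a).getD (i a) []).getD (j a) []).getD (b a) 0 :=
  getD (getD (getD hH hi (const [])) hj (const [])) hb (const 0)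

theorem efficient_listEncode {X : α → ℕ → Bool}
    (hk : EfficientlyComputable fun a => List.range (k a))
    (hT : EfficientlyComputable fun a => List.range (T a))
    (hn : EfficientlyComputable fun a => List.range (n a))
    (hm : EfficientlyComputable fun a => List.range (m a)) (hq : EfficientlyComputable q)
    (hr : EfficientlyComputable fun p : α × ℕ × ℕ => r p.1 p.2.1 p.2.2)
    (hA : EfficientlyComputable fun p : α × ℕ × ℕ => A p.1 p.2.1 p.2.2)
    (hX : EfficientlyComputable fun p : α × ℕ => X p.1 p.2) :
    EfficientlyComputable fun a =>
      listEncode (k a) (T a) (n a) (m a) (q a) (r a) (A a) (X a) :=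
  efficient_listTable (g := fun a i j b => ((List.range (m a)).map fun x =>
      bif X a x && decide (r a i x = j) then A a b x else 0).sum % q a) hk hT hn
    (natMod (sumMap (g := fun (p : α × ℕ × ℕ × ℕ) x =>
        bif X p.1 x && decide (r p.1 p.2.1 x = p.2.2.1) then A p.1 p.2.2.2 x else 0)
      (cond (and (hX.comp (id.fst.fst.pair id.snd))
        (decide_eq (hr.comp (id.fst.fst.pair (id.fst.snd.fst.pair id.snd))) id.fst.snd.snd.fst))
        (hA.comp (id.fst.fst.pair (id.fst.snd.snd.snd.pair id.snd))) (const 0))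
      (hm.comp id.fst)) (hq.comp id.fst))

theorem efficient_listSub {H₀ H₁ : α → List (List (List ℕ))}
    (hk : EfficientlyComputable fun a => List.range (k a))
    (hT : EfficientlyComputable fun a => List.range (T a))
    (hn : EfficientlyComputable fun a => List.range (n a)) (hq : EfficientlyComputable q)
    (h₀ : EfficientlyComputable H₀) (h₁ : EfficientlyComputable H₁) :
    EfficientlyComputable fun a => listSub (k a) (T a) (n a) (q a) (H₀ a) (H₁ a) :=
  efficient_listTable (g := fun a i j b => ((((H₀ a).getD i []).getD j []).getD b 0 +
      (q a - (((H₁ a).getD i []).getD j []).getD b 0)) % q a) hk hT hn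
    (natMod (natAdd
      (efficient_entry (h₀.comp id.fst) id.snd.fst id.snd.snd.fst id.snd.snd.snd)
      (natSub (hq.comp id.fst)
        (efficient_entry (h₁.comp id.fst) id.snd.fst id.snd.snd.fst id.snd.snd.snd)))
      (hq.comp id.fst))

theorem efficient_listMem {H : α → List (List (List ℕ))} {w : α → List ℕ}
    (hH : EfficientlyComputable H) (hw : EfficientlyComputable w) :
    EfficientlyComputable fun a => listMem (H a) (w a) :=
  any (p := fun a (row : List (List ℕ)) => row.any fun c => decide (c = w a))
    (any (p := fun (p : α × List (List ℕ)) c => decide (c = w p.1))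
      (decide_eq id.snd (hw.comp id.fst.fst)) id.snd) hH

theorem efficient_listCol {x : α → ℕ} (hn : EfficientlyComputable fun a => List.range (n a))
    (hA : EfficientlyComputable fun p : α × ℕ × ℕ => A p.1 p.2.1 p.2.2)
    (hx : EfficientlyComputable x) :
    EfficientlyComputable fun a => listCol (n a) (A a) (x a) :=
  map (g := fun a b => A a b (x a)) (hA.comp (id.fst.pair (id.snd.pair (hx.comp id.fst)))) hn

theorem efficient_listNegCol {x : α → ℕ} (hn : EfficientlyComputable fun a => List.range (n a))
    (hq : EfficientlyComputable q)
    (hA : EfficientlyComputable fun p : α × ℕ × ℕ => A p.1 p.2.1 p.2.2)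
    (hx : EfficientlyComputable x) :
    EfficientlyComputable fun a => listNegCol (n a) (q a) (A a) (x a) :=
  map (g := fun a b => (q a - A a b (x a)) % q a)
    (natMod (natSub (hq.comp id.fst) (hA.comp (id.fst.pair (id.snd.pair (hx.comp id.fst)))))
      (hq.comp id.fst)) hn

theorem efficient_listPlus {H : α → List (List (List ℕ))} {x : α → ℕ}
    (hn : EfficientlyComputable fun a => List.range (n a))
    (hA : EfficientlyComputable fun p : α × ℕ × ℕ => A p.1 p.2.1 p.2.2)
    (hH : EfficientlyComputable H) (hx : EfficientlyComputable x) :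
    EfficientlyComputable fun a => listPlus (n a) (A a) (H a) (x a) :=
  efficient_listMem hH (efficient_listCol hn hA hx)

theorem efficient_listMinus {H : α → List (List (List ℕ))} {x : α → ℕ}
    (hn : EfficientlyComputable fun a => List.range (n a)) (hq : EfficientlyComputable q)
    (hA : EfficientlyComputable fun p : α × ℕ × ℕ => A p.1 p.2.1 p.2.2)
    (hH : EfficientlyComputable H) (hx : EfficientlyComputable x) :
    EfficientlyComputable fun a => listMinus (n a) (q a) (A a) (H a) (x a) :=
  and (efficient_listMem hH (efficient_listNegCol hn hq hA hx))
    (not (decide_eq (efficient_listNegCol hn hq hA hx) (efficient_listCol hn hA hx)))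

theorem efficient_listPeel {H : α → List (List (List ℕ))}
    (hk : EfficientlyComputable fun a => List.range (k a))
    (hT : EfficientlyComputable fun a => List.range (T a))
    (hn : EfficientlyComputable fun a => List.range (n a))
    (hm : EfficientlyComputable fun a => List.range (m a)) (hq : EfficientlyComputable q)
    (hr : EfficientlyComputable fun p : α × ℕ × ℕ => r p.1 p.2.1 p.2.2)
    (hA : EfficientlyComputable fun p : α × ℕ × ℕ => A p.1 p.2.1 p.2.2)
    (hH : EfficientlyComputable H) :
    EfficientlyComputable fun a =>
      listPeel (k a) (T a) (n a) (m a) (q a) (r a) (A a) (H a) := by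
  have hA' : EfficientlyComputable fun p : (α × ℕ × ℕ × ℕ) × ℕ => A p.1.1 p.1.2.2.2 p.2 :=
    hA.comp (id.fst.fst.pair (id.fst.snd.snd.snd.pair id.snd))
  have hA'' : EfficientlyComputable fun p : ((α × ℕ × ℕ × ℕ) × ℕ) × ℕ × ℕ =>
    A p.1.1.1 p.2.1 p.2.2 := hA.comp (id.fst.fst.fst.pair id.snd)
  exact efficient_listTable (g := fun a i j b => ((((H a).getD i []).getD j []).getD b 0 +
      ((List.range (m a)).map fun x => bif decide (r a i x = j) then
        (bif listPlus (n a) (A a) (H a) x then q a - A a b x else 0) +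
          (bif listMinus (n a) (q a) (A a) (H a) x then A a b x else 0)
        else 0).sum) % q a) hk hT hn
    (natMod (natAdd
      (efficient_entry (hH.comp id.fst) id.snd.fst id.snd.snd.fst id.snd.snd.snd)
      (sumMap (g := fun (p : α × ℕ × ℕ × ℕ) x => bif decide (r p.1 p.2.1 x = p.2.2.1) then
        (bif listPlus (n p.1) (A p.1) (H p.1) x then q p.1 - A p.1 p.2.2.2 x else 0) +
          (bif listMinus (n p.1) (q p.1) (A p.1) (H p.1) x then A p.1 p.2.2.2 x else 0)
        else 0)
        (cond
          (decide_eq (hr.comp (id.fst.fst.pair (id.fst.snd.fst.pair id.snd))) id.fst.snd.snd.fst)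
          (natAdd
            (cond (efficient_listPlus (hn.comp id.fst.fst) hA'' (hH.comp id.fst.fst) id.snd)
              (natSub (hq.comp id.fst.fst) hA') (const 0))
            (cond (efficient_listMinus (hn.comp id.fst.fst) (hq.comp id.fst.fst) hA''
              (hH.comp id.fst.fst) id.snd) hA' (const 0)))
          (const 0))
        (hm.comp id.fst)))
      (hq.comp id.fst))

theorem encSize_listTable_le {k T n W : ℕ} {g : ℕ → ℕ → ℕ → ℕ}
    (h : ∀ i j b, encSize (g i j b) ≤ W) :
    encSize (listTable k T n g) ≤ k * (T * (n * (W + 1) + 1 + 1) + 1 + 1) + 1 := by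
  refine (encSize_list_le (W := T * (n * (W + 1) + 1 + 1) + 1) fun row hrow => ?_).trans
    (by simp [listTable])
  obtain ⟨i, -, rfl⟩ := List.mem_map.1 hrow
  refine (encSize_list_le (W := n * (W + 1) + 1) fun c hc => ?_).trans (by simp)
  obtain ⟨j, -, rfl⟩ := List.mem_map.1 hc
  refine (encSize_list_le (W := W) fun z hz => ?_).trans (by simp)
  obtain ⟨b, -, rfl⟩ := List.mem_map.1 hz
  exact h i j b

theorem encSize_mod_le {q : ℕ} (hq : 0 < q) (z : ℕ) : encSize (z % q) ≤ encSize q :=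
  Nat.succ_le_succ (Nat.size_le_size (Nat.mod_lt z hq).le)

theorem polySize_of_range {f : α → ℕ} (h : EfficientlyComputable fun a => List.range (f a)) :
    PolySize f :=
  h.polySize.of_le fun a => by
    have := length_le_encSize (List.range (f a))
    rw [List.length_range] at this
    omega

theorem efficient_listRound {S : α → List (List (List ℕ)) × List Bool}
    (hk : EfficientlyComputable fun a => List.range (k a))
    (hT : EfficientlyComputable fun a => List.range (T a))
    (hn : EfficientlyComputable fun a => List.range (n a))
    (hm : EfficientlyComputable fun a => List.range (m a)) (hq : EfficientlyComputable q)
    (hr : EfficientlyComputable fun p : α × ℕ × ℕ => r p.1 p.2.1 p.2.2)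
    (hA : EfficientlyComputable fun p : α × ℕ × ℕ => A p.1 p.2.1 p.2.2)
    (hS : EfficientlyComputable S) :
    EfficientlyComputable fun a =>
      listRound (k a) (T a) (n a) (m a) (q a) (r a) (A a) (S a) := by
  have hA' : EfficientlyComputable fun p : (α × ℕ) × ℕ × ℕ => A p.1.1 p.2.1 p.2.2 :=
    hA.comp (id.fst.fst.pair id.snd)
  exact (efficient_listPeel hk hT hn hm hq hr hA hS.fst).pair
    (map (g := fun a x => (S a).2.getD x false ||
        (listPlus (n a) (A a) (S a).1 x || listMinus (n a) (q a) (A a) (S a).1 x))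
      (or (getD (hS.comp id.fst).snd id.snd (const false))
        (or (efficient_listPlus (hn.comp id.fst) hA' (hS.comp id.fst).fst id.snd)
          (efficient_listMinus (hn.comp id.fst) (hq.comp id.fst) hA' (hS.comp id.fst).fst id.snd)))
      hm)

/-- Every round reduces all entries modulo `q`, so the size of the state does not grow with the
number of rounds. Only the initial table may be unreduced; its size enters the bound separately. -/
theorem efficient_listRounds {H : α → List (List (List ℕ))}
    (hk : EfficientlyComputable fun a => List.range (k a))
    (hT : EfficientlyComputable fun a => List.range (T a))
    (hn : EfficientlyComputable fun a => List.range (n a))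
    (hm : EfficientlyComputable fun a => List.range (m a)) (hq : EfficientlyComputable q)
    (hq0 : ∀ a, 0 < q a)
    (hr : EfficientlyComputable fun p : α × ℕ × ℕ => r p.1 p.2.1 p.2.2)
    (hA : EfficientlyComputable fun p : α × ℕ × ℕ => A p.1 p.2.1 p.2.2)
    (hH : EfficientlyComputable H) :
    EfficientlyComputable fun a =>
      listRounds (k a) (T a) (n a) (m a) (q a) (r a) (A a) (H a) := by
  have pk := polySize_of_range hk
  have pT := polySize_of_range hT
  have pn := polySize_of_range hn
  have pm := polySize_of_range hm
  have one : PolySize fun _ : α => 1 := .const 1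
  have hbool : ∀ (a : α) (f : ℕ → Bool), encSize ((List.range (m a)).map f) ≤ m a * 3 + 1 :=
    fun a f => (encSize_list_le (W := 2) fun x hx => encSize_bool_le x).trans (by simp)
  refine foldl (l := fun a => List.range (m a))
    (b := fun a => (H a, (List.range (m a)).map fun _ => false))
    (B := fun a => encSize (H a) +
      (k a * (T a * (n a * (encSize (q a) + 1) + 1 + 1) + 1 + 1) + 1) + (m a * 3 + 1) + 1)
    (step := fun a S _ => listRound (k a) (T a) (n a) (m a) (q a) (r a) (A a) S)
    (efficient_listRound (hk.comp id.fst) (hT.comp id.fst) (hn.comp id.fst) (hm.comp id.fst)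
      (hq.comp id.fst) (hr.comp (id.fst.fst.pair id.snd)) (hA.comp (id.fst.fst.pair id.snd))
      id.snd.snd) hm
    (hH.pair (map (const false) hm))
    (((hH.polySize.add ((pk.mul (((pT.mul (((pn.mul (hq.polySize.add one)).add one).add
      one)).add one).add one)).add one)).add ((pm.mul (.const 3)).add one)).add one)
    fun a l₁ l₂ _ => ?_
  rcases List.eq_nil_or_concat l₁ with rfl | ⟨l, x, rfl⟩
  · rw [List.foldl_nil, encSize_prod]
    have := hbool a fun _ => false
    simp only
    omega
  · rw [List.concat_eq_append, List.foldl_append, List.foldl_cons, List.foldl_nil]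
    generalize List.foldl _ _ l = S
    rw [encSize_prod]
    have h1 : encSize (listRound (k a) (T a) (n a) (m a) (q a) (r a) (A a) S).1 ≤ _ :=
      encSize_listTable_le (W := encSize (q a)) fun i j b => encSize_mod_le (hq0 a) _
    have h2 : encSize (listRound (k a) (T a) (n a) (m a) (q a) (r a) (A a) S).2 ≤ m a * 3 + 1 :=
      hbool a _
    omega

theorem efficient_listResult {S : α → List (List (List ℕ)) × List Bool}
    (hn : EfficientlyComputable fun a => List.range (n a))
    (hm : EfficientlyComputable fun a => List.range (m a)) (hq : EfficientlyComputable q)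
    (hA : EfficientlyComputable fun p : α × ℕ × ℕ => A p.1 p.2.1 p.2.2)
    (hS : EfficientlyComputable S) :
    EfficientlyComputable fun a => listResult (n a) (m a) (q a) (A a) (S a) := by
  have hA' : EfficientlyComputable fun p : (α × ℕ) × ℕ × ℕ => A p.1.1 p.2.1 p.2.2 :=
    hA.comp (id.fst.fst.pair id.snd)
  refine EfficientlyComputable.ite ?_ hS.snd.some (const none)
  refine EfficientlyComputable.congr (and
    (not (any (p := fun a x => listPlus (n a) (A a) (S a).1 x ||
        listMinus (n a) (q a) (A a) (S a).1 x)
      (or (efficient_listPlus (hn.comp id.fst) hA' (hS.comp id.fst).fst id.snd)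
        (efficient_listMinus (hn.comp id.fst) (hq.comp id.fst) hA' (hS.comp id.fst).fst id.snd))
      hm))
    (all (p := fun _ (row : List (List ℕ)) => row.all fun c => c.all fun z => decide (z = 0))
      (all (p := fun _ (c : List ℕ) => c.all fun z => decide (z = 0))
        (all (p := fun _ (z : ℕ) => decide (z = 0)) (decide_eq id.snd (const 0)) id.snd) id.snd)
      hS.fst)) fun a => ?_
  rw [Bool.decide_eq_true]

theorem efficient_listDecode {H₀ H₁ : α → List (List (List ℕ))}
    (hk : EfficientlyComputable fun a => List.range (k a))
    (hT : EfficientlyComputable fun a => List.range (T a))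
    (hn : EfficientlyComputable fun a => List.range (n a))
    (hm : EfficientlyComputable fun a => List.range (m a)) (hq : EfficientlyComputable q)
    (hq0 : ∀ a, 0 < q a)
    (hr : EfficientlyComputable fun p : α × ℕ × ℕ => r p.1 p.2.1 p.2.2)
    (hA : EfficientlyComputable fun p : α × ℕ × ℕ => A p.1 p.2.1 p.2.2)
    (h₀ : EfficientlyComputable H₀) (h₁ : EfficientlyComputable H₁) :
    EfficientlyComputable fun a =>
      listDecode (k a) (T a) (n a) (m a) (q a) (r a) (A a) (H₀ a) (H₁ a) :=
  efficient_listResult hn hm hq hA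
    (efficient_listRounds hk hT hn hm hq hq0 hr hA (efficient_listSub hk hT hn hq h₀ h₁))

end

end IBLT

/-! ### Independent samples and uniform matrices as lists -/

namespace PMF

variable {α β : Type}

theorem iid_apply [Fintype α] (μ : PMF α) (N : ℕ) (v : Fin N → α) :
    μ.iid N v = ∏ i, μ (v i) := by
  classical
  induction N with
  | zero => simp [iid, Subsingleton.elim v Fin.elim0]
  | succ N ih =>
    rw [iid, bind_apply, tsum_eq_single (v 0)]
    · rw [map_apply, tsum_eq_single (Fin.tail v)]
      · rw [if_pos (Fin.cons_self_tail v).symm, ih, Fin.prod_univ_succ]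
        rfl
      · intro w hw
        exact if_neg fun h => hw ((congrArg Fin.tail h).trans (Fin.tail_cons _ _)).symm
    · intro a ha
      rw [map_apply, ENNReal.tsum_eq_zero.2, mul_zero]
      intro w
      exact if_neg fun h => ha ((congrFun h 0).trans (Fin.cons_zero _ _)).symm

theorem iid_uniformOfFintype [Fintype α] [Nonempty α] (N : ℕ) :
    (uniformOfFintype α).iid N = uniformOfFintype (Fin N → α) := by
  ext v
  rw [iid_apply]
  simp [ENNReal.inv_pow]

/-- The list `l` contributes only its length; it is what the sampling loop runs over. -/
theorem map_ofFn_iid (μ : PMF α) {N : ℕ} {l : List β} (hl : l.length = N) :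
    (μ.iid N).map List.ofFn = mapList (fun _ => μ) l := by
  induction N generalizing l with
  | zero =>
    rw [List.length_eq_zero_iff.1 hl]
    simp [iid, mapList, pure_map]
  | succ N ih =>
    obtain ⟨b, l, rfl⟩ := List.exists_cons_of_length_eq_add_one hl
    rw [iid, mapList, map_bind]
    refine congrArg _ (funext fun a => ?_)
    rw [map_comp, ← ih (by simpa using hl), map_comp]
    congr 1
    funext v
    simp [List.ofFn_succ]

theorem mem_support_iid {μ : PMF α} {N : ℕ} {v : Fin N → α} (h : v ∈ (μ.iid N).support)
    (i : Fin N) : v i ∈ μ.support := by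
  induction N with
  | zero => exact i.elim0
  | succ N ih =>
    simp only [iid, mem_support_bind_iff, mem_support_map_iff] at h
    obtain ⟨a, ha, w, hw, rfl⟩ := h
    refine Fin.cases ?_ (fun j => ?_) i
    · simpa using ha
    · simpa using ih hw j

theorem map_mapList {γ : Type} (f : α → PMF β) (g : β → γ) (l : List α) :
    (mapList f l).map (List.map g) = mapList (fun a => (f a).map g) l := by
  induction l with
  | nil => simp [mapList, pure_map]
  | cons a l ih =>
    rw [mapList, mapList, map_bind, bind_map]
    refine congrArg _ (funext fun b => ?_)
    rw [Function.comp_apply, ← ih, map_comp, map_comp]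
    rfl

theorem map_ofFn_uniformOfFintype [Fintype α] [Nonempty α] (f : α → β) {γ : Type} {N : ℕ}
    {l : List γ} (hl : l.length = N) :
    (uniformOfFintype (Fin N → α)).map (fun v => List.ofFn fun i => f (v i)) =
      mapList (fun _ => (uniformOfFintype α).map f) l := by
  rw [← map_mapList, ← map_ofFn_iid _ hl, map_comp, iid_uniformOfFintype]
  congr 1
  funext v
  simp only [Function.comp_apply, List.map_ofFn]
  rfl

/-- The random instruction on `N` draws one of `N + 1` numbers, hence the form `q - 1 + 1`. -/
theorem map_val_uniformOfFintype_zmod (q : ℕ) [NeZero q] :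
    (uniformOfFintype (ZMod q)).map ZMod.val =
      (uniformOfFintype (Fin (q - 1 + 1))).map Fin.val := by
  cases q with
  | zero => exact absurd rfl (NeZero.ne 0)
  | succ q => rfl

/-- A uniformly random matrix as a list of independent lists of independent entries. -/
theorem map_uniformOfFintype_matrix (n m q : ℕ) [NeZero q] :
    (uniformOfFintype (Matrix (Fin n) (Fin m) (ZMod q))).map
      (fun A => List.ofFn fun i => List.ofFn fun j => (A i j).val) =
    mapList (fun _ => mapList (fun _ => (uniformOfFintype (Fin (q - 1 + 1))).map Fin.val)
      (List.range m)) (List.range n) := by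
  rw [← map_val_uniformOfFintype_zmod, ← map_ofFn_uniformOfFintype ZMod.val List.length_range,
    ← map_ofFn_uniformOfFintype _ List.length_range]
  rfl

end PMF

/-! ### Efficiency of sampling, encoding and decoding -/

/-- The number that a datum represents. -/
def Val.toNat : Val → ℕ
  | num a => a
  | pair _ _ => 0

theorem EfficientlyComputable.toNat {α : Type} [Enc α] {f : α → Val}
    (hf : EfficientlyComputable f) : EfficientlyComputable fun a => (f a).toNat :=
  (of_val ((PolyFun.instr .add).comp (PolyFun.id.pair (.const (Val.num 0)))) fun v => by
    cases v <;> rfl : EfficientlyComputable Val.toNat).comp hf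

namespace IBLT

open EfficientlyComputable

/-- The security parameter, the threshold, and an encoding function. -/
abbrev KeyData : Type := Unary × Unary × (List Val × List (List ℕ))

namespace KeyData

/-- The hash values, where `g` evaluates hash functions. -/
def hash (g : Val → Val) (c : KeyData) (i x : ℕ) : ℕ :=
  (g (Enc.enc (c.1, c.2.1, c.2.2.1.getD i (Val.num 0), x))).toNat

def entry (c : KeyData) (a x : ℕ) : ℕ := (c.2.2.2.getD a []).getD x 0

/-- The data of a member of the construction. -/
def of {n m k q : ℕ} (lam : ℕ) (t : ℕ+)
    (f : (Fin k → Val) × Matrix (Fin n) (Fin m) (ZMod q)) : KeyData :=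
  (Unary.mk lam, Unary.mk t, List.ofFn f.1, List.ofFn fun a => List.ofFn fun x => (f.2 a x).val)

theorem efficient_hash {g : Val → Val} (hg : PolyFun g) :
    EfficientlyComputable fun p : KeyData × ℕ × ℕ => p.1.hash g p.2.1 p.2.2 :=
  toNat ((of_val hg fun _ => rfl : EfficientlyComputable g).comp (enc
    (id.fst.fst.pair (id.fst.snd.fst.pair
      ((getD id.fst.snd.snd.fst id.snd.fst (const (Val.num 0))).pair id.snd.snd)))))

theorem efficient_entry :
    EfficientlyComputable fun p : KeyData × ℕ × ℕ => p.1.entry p.2.1 p.2.2 :=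
  getD (getD id.fst.snd.snd.snd id.snd.fst (const [])) id.snd.snd (const 0)

theorem enc_key {n m k q : ℕ} [NeZero q] (f : (Fin k → Val) × Matrix (Fin n) (Fin m) (ZMod q)) :
    Enc.enc f = Enc.enc (List.ofFn f.1, List.ofFn fun a => List.ofFn fun x => (f.2 a x).val) := by
  refine congrArg₂ Val.pair ?_ (Enc.enc_matrix_eq f.2)
  exact Enc.enc_fun_eq fun _ => rfl

theorem entry_of {n m k q : ℕ} (lam : ℕ) (t : ℕ+)
    (f : (Fin k → Val) × Matrix (Fin n) (Fin m) (ZMod q)) (a : Fin n) (x : Fin m) :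
    (of lam t f).entry a x = (f.2 a x).val := by
  rw [entry, of, List.getD_ofFn, List.getD_ofFn]

end KeyData

theorem efficient_range_two_mul {α : Type} [Enc α] {f : α → Unary}
    (hf : EfficientlyComputable f) :
    EfficientlyComputable fun a => List.range (2 * (f a).val) :=
  (range (append hf.unaryToList hf.unaryToList)).congr fun a => by
    simp [Unary.toList, two_mul]

section Parameters

variable {n m q k : ℕ → ℕ}

/-- A polynomial time function that evaluates the hash functions. -/
def Evaluates (g : Val → Val) (R : HashFamily m) : Prop :=
  ∀ (lam : ℕ) (t : ℕ+), ∀ r ∈ (R.sample lam t).support, ∀ x : Fin (m lam),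
    g (Enc.enc (Unary.mk lam, Unary.mk t, r, x)) = Enc.enc (R.hash lam t r x)

theorem exists_evaluates {R : HashFamily m} (hR : R.Efficient) :
    ∃ g, PolyFun g ∧ Evaluates g R := by
  obtain ⟨-, D, hD, h⟩ := hR
  obtain ⟨g, hg, hDg⟩ := (D.polyLaw.weaken fun _ => hD).exists_fun
  refine ⟨g, hg, fun lam t r hr x => ?_⟩
  have h2 := congrArg PMF.support ((hDg _).symm.trans (h lam t r hr x))
  simpa using h2

/-- The evaluation algorithm is specified only for descriptions that can be sampled, so this is as
far as the agreement goes. -/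
theorem Evaluates.hash_of {g : Val → Val} {R : HashFamily m} (hg : Evaluates g R) {lam : ℕ}
    {t : ℕ+} {f : (Fin (k lam) → Val) × Matrix (Fin (n lam)) (Fin (m lam)) (ZMod (q lam))}
    (hf : ∀ i, f.1 i ∈ (R.sample lam t).support) (i : Fin (k lam)) (x : Fin (m lam)) :
    (KeyData.of lam t f).hash g i x = R.hash lam t (f.1 i) x := by
  rw [KeyData.hash, KeyData.of, List.getD_ofFn]
  exact congrArg Val.toNat (hg lam t _ (hf i) x)

/-- The law of the lists that represent a sampled encoding function. -/
theorem polyTimeLaw_key {S : PPT} (hn : EfficientlyComputable fun lam : Unary => Unary.mk (n lam.val))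
    (hm : EfficientlyComputable fun lam : Unary => Unary.mk (m lam.val))
    (hq : EfficientlyComputable fun lam : Unary => q lam.val)
    (hk : EfficientlyComputable fun lam : Unary => Unary.mk (k lam.val)) :
    PolyTimeLaw fun a : Unary × Unary =>
      (PMF.mapList (fun _ => S.law (Enc.enc a)) (List.range (k a.1.val))).bind fun r =>
        (PMF.mapList (fun _ => PMF.mapList (fun _ =>
          (PMF.uniformOfFintype (Fin (q a.1.val - 1 + 1))).map Fin.val)
            (List.range (m a.1.val))) (List.range (n a.1.val))).map fun A => (r, A) := by
  have hS : PolyTimeLaw fun a : Unary × Unary => S.law (Enc.enc a) :=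
    ⟨S, fun a => (PMF.map_id _).symm⟩
  refine PolyTimeLaw.bind (PolyTimeLaw.mapList (hS.comp id.fst) (unaryRange (hk.comp id.fst)))
    (PolyTimeLaw.map ?_ (id.fst.snd.pair id.snd))
  exact PolyTimeLaw.mapList (PolyTimeLaw.mapList
    (PolyTimeLaw.uniform (natSub (hq.comp id.fst.fst.fst.fst) (const 1)))
      (unaryRange (hm.comp id.fst.fst.fst)))
    (unaryRange (hn.comp id.fst.fst))

variable [∀ lam, NeZero (q lam)]

theorem mem_support_sample {R : HashFamily m} {lam : ℕ} {t : ℕ+}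
    {f : (Fin (k lam) → Val) × Matrix (Fin (n lam)) (Fin (m lam)) (ZMod (q lam))}
    (hf : f ∈ ((setEncoding n m q k R).sample lam t).support) (i : Fin (k lam)) :
    f.1 i ∈ (R.sample lam t).support := by
  obtain ⟨r, hr, hf⟩ := (PMF.mem_support_bind_iff _ _ _).1 hf
  obtain ⟨A, -, rfl⟩ := (PMF.mem_support_map_iff _ _ _).1 hf
  exact PMF.mem_support_iid hr i

theorem map_sample {R : HashFamily m} (lam : ℕ) (t : ℕ+) :
    ((setEncoding n m q k R).sample lam t).map
      (fun f => (List.ofFn f.1, List.ofFn fun a => List.ofFn fun x => (f.2 a x).val)) =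
    (PMF.mapList (fun _ => R.sample lam t) (List.range (k lam))).bind fun r =>
        (PMF.mapList (fun _ => PMF.mapList (fun _ =>
          (PMF.uniformOfFintype (Fin (q lam - 1 + 1))).map Fin.val)
            (List.range (m lam))) (List.range (n lam))).map fun A => (r, A) := by
  rw [← PMF.map_uniformOfFintype_matrix, ← PMF.map_ofFn_iid _ List.length_range]
  simp only [setEncoding, PMF.map_bind, PMF.bind_map, PMF.map_comp]
  rfl

theorem sample_efficient {R : HashFamily m} (hR : R.Efficient)
    (hn : EfficientlyComputable fun lam : Unary => Unary.mk (n lam.val))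
    (hm : EfficientlyComputable fun lam : Unary => Unary.mk (m lam.val))
    (hq : EfficientlyComputable fun lam : Unary => q lam.val)
    (hk : EfficientlyComputable fun lam : Unary => Unary.mk (k lam.val)) :
    ∃ S : PPT, ∀ (lam : ℕ) (t : ℕ+), S.law (Enc.enc (Unary.mk lam, Unary.mk t)) =
      ((setEncoding n m q k R).sample lam t).map Enc.enc := by
  obtain ⟨⟨S, hS⟩, -⟩ := hR
  obtain ⟨B, hB⟩ := polyTimeLaw_key (S := S) hn hm hq hk
  refine ⟨B, fun lam t => ?_⟩
  rw [hB]
  beta_reduce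
  rw [hS, ← map_sample (R := R), PMF.map_comp]
  congr 1
  funext f
  exact (KeyData.enc_key f).symm

theorem encode_efficient {R : HashFamily m} (hR : R.Efficient)
    (hn : EfficientlyComputable fun lam : Unary => Unary.mk (n lam.val))
    (hm : EfficientlyComputable fun lam : Unary => Unary.mk (m lam.val))
    (hq : EfficientlyComputable fun lam : Unary => q lam.val)
    (hk : EfficientlyComputable fun lam : Unary => Unary.mk (k lam.val)) :
    ∃ D : PPT, D.IsDeterministic ∧ ∀ (lam : ℕ) (t : ℕ+),
      ∀ f ∈ ((setEncoding n m q k R).sample lam t).support, ∀ X : Finset (Fin (m lam)),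
      D.law (Enc.enc (Unary.mk lam, Unary.mk t, f, X)) =
        PMF.pure (Enc.enc ((setEncoding n m q k R).encode lam t f X)) := by
  obtain ⟨g, hg, hgR⟩ := exists_evaluates hR
  have hc : EfficientlyComputable
      fun p : Unary × Unary × (List Val × List (List ℕ)) × List Bool =>
        ((p.1, p.2.1, p.2.2.1) : KeyData) := id.fst.pair (id.snd.fst.pair id.snd.snd.fst)
  obtain ⟨D, hD, h⟩ := efficient_listEncode
    (k := fun p : Unary × Unary × (List Val × List (List ℕ)) × List Bool => k p.1.val)
    (T := fun p => 2 * p.2.1.val) (n := fun p => n p.1.val) (m := fun p => m p.1.val)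
    (q := fun p => q p.1.val) (r := fun p => KeyData.hash g (p.1, p.2.1, p.2.2.1))
    (A := fun p => KeyData.entry (p.1, p.2.1, p.2.2.1)) (X := fun p x => p.2.2.2.getD x false)
    (unaryRange (hk.comp id.fst)) (efficient_range_two_mul id.snd.fst)
    (unaryRange (hn.comp id.fst)) (unaryRange (hm.comp id.fst)) (hq.comp id.fst)
    ((KeyData.efficient_hash hg).comp ((hc.comp id.fst).pair id.snd))
    (KeyData.efficient_entry.comp ((hc.comp id.fst).pair id.snd))
    (getD id.fst.snd.snd.snd id.snd (const false))
  refine ⟨D, hD, fun lam t f hf X => ?_⟩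
  have h1 := h (Unary.mk lam, Unary.mk t,
    (List.ofFn f.1, List.ofFn fun a => List.ofFn fun x => (f.2 a x).val), finsetToList X)
  have h2 : listEncode (k lam) (2 * t) (n lam) (m lam) (q lam) ((KeyData.of lam t f).hash g)
      (KeyData.of lam t f).entry (fun x => (finsetToList X).getD x false) = _ :=
    listEncode_eq (r := fun i => R.hash lam t (f.1 i)) (A := f.2) (X := X)
      (hgR.hash_of fun i => mem_support_sample hf i) (KeyData.entry_of lam t f)
      fun x => List.getD_ofFn _ x _
  refine Eq.trans ?_ (h1.trans (congrArg PMF.pure ?_))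
  · refine congrArg D.law (congrArg₂ Val.pair rfl (congrArg₂ Val.pair rfl
      (congrArg₂ Val.pair (KeyData.enc_key f) (Enc.enc_finset_eq X))))
  · exact (congrArg Enc.enc h2).trans (enc_table _).symm

theorem decode_efficient {R : HashFamily m} (hR : R.Efficient)
    (hn : EfficientlyComputable fun lam : Unary => Unary.mk (n lam.val))
    (hm : EfficientlyComputable fun lam : Unary => Unary.mk (m lam.val))
    (hq : EfficientlyComputable fun lam : Unary => q lam.val)
    (hk : EfficientlyComputable fun lam : Unary => Unary.mk (k lam.val)) :
    ∃ D : PPT, D.IsDeterministic ∧ ∀ (lam : ℕ) (t : ℕ+),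
      ∀ f ∈ ((setEncoding n m q k R).sample lam t).support,
      ∀ y₀ y₁ : (setEncoding n m q k R).Code lam t,
      D.law (Enc.enc (Unary.mk lam, Unary.mk t, f, y₀, y₁)) =
        PMF.pure (Enc.enc ((setEncoding n m q k R).decode lam t f y₀ y₁)) := by
  obtain ⟨g, hg, hgR⟩ := exists_evaluates hR
  have hc : EfficientlyComputable fun p : Unary × Unary × (List Val × List (List ℕ)) ×
    (List (List (List ℕ)) × List (List (List ℕ))) =>
        ((p.1, p.2.1, p.2.2.1) : KeyData) := id.fst.pair (id.snd.fst.pair id.snd.snd.fst)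
  obtain ⟨D, hD, h⟩ := efficient_listDecode
    (k := fun p : Unary × Unary × (List Val × List (List ℕ)) ×
      (List (List (List ℕ)) × List (List (List ℕ))) => k p.1.val)
    (T := fun p => 2 * p.2.1.val) (n := fun p => n p.1.val) (m := fun p => m p.1.val)
    (q := fun p => q p.1.val) (r := fun p => KeyData.hash g (p.1, p.2.1, p.2.2.1))
    (A := fun p => KeyData.entry (p.1, p.2.1, p.2.2.1))
    (H₀ := fun p => p.2.2.2.1) (H₁ := fun p => p.2.2.2.2)
    (unaryRange (hk.comp id.fst)) (efficient_range_two_mul id.snd.fst)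
    (unaryRange (hn.comp id.fst)) (unaryRange (hm.comp id.fst)) (hq.comp id.fst)
    (fun p => NeZero.pos _)
    ((KeyData.efficient_hash hg).comp ((hc.comp id.fst).pair id.snd))
    (KeyData.efficient_entry.comp ((hc.comp id.fst).pair id.snd))
    id.snd.snd.snd.fst id.snd.snd.snd.snd
  refine ⟨D, hD, fun lam t f hf y₀ y₁ => ?_⟩
  have h1 := h (Unary.mk lam, Unary.mk t,
    (List.ofFn f.1, List.ofFn fun a => List.ofFn fun x => (f.2 a x).val),
    Table.toLists y₀, Table.toLists y₁)
  have h2 : listDecode (k lam) (2 * t) (n lam) (m lam) (q lam) ((KeyData.of lam t f).hash g)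
      (KeyData.of lam t f).entry (Table.toLists y₀) (Table.toLists y₁) = _ :=
    listDecode_eq (r := fun i => R.hash lam t (f.1 i)) (A := f.2)
      (hgR.hash_of fun i => mem_support_sample hf i) (KeyData.entry_of lam t f) y₀ y₁
  refine Eq.trans ?_ (h1.trans (congrArg PMF.pure ?_))
  · refine congrArg D.law (congrArg₂ Val.pair rfl (congrArg₂ Val.pair rfl
      (congrArg₂ Val.pair (KeyData.enc_key f)
        (congrArg₂ Val.pair (enc_table y₀) (enc_table y₁)))))
  · refine (congrArg Enc.enc h2).trans ?_
    change Enc.enc (Option.map _ (decode _ _ _ _)) = Enc.enc (decode _ _ _ _)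
    cases decode (fun i => R.hash lam t (f.1 i)) f.2 y₀ y₁ with
    | none => rfl
    | some X => exact congrArg₂ Val.pair rfl (Enc.enc_finset_eq X).symm

end Parameters

end IBLT

/-! ### The peeling process in the absence of kernel candidates -/

namespace IBLT

section Peeling

variable {n m q k : ℕ} {t : ℕ+} (r : Fin k → Fin m → Fin (2 * t))
  (A : Matrix (Fin n) (Fin m) (ZMod q)) (s : Fin m → ℤ)

/-- The elements that share all their cells with other elements of the set. -/
def shrink (D : Finset (Fin m)) : Finset (Fin m) :=
  {x ∈ D | ¬∃ i, ∀ y ∈ D, r i y = r i x → y = x}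

/-- The image of an integral vector modulo `q`. -/
def intMulVec (v : Fin m → ℤ) : Fin n → ZMod q := A *ᵥ fun x => (v x : ZMod q)

/-- The difference of the part of `s` in a cell and `σ e_x`. -/
def candidate (D : Finset (Fin m)) (i : Fin k) (j : Fin (2 * t)) (x : Fin m) (σ : ℤ) :
    Fin m → ℤ :=
  fun y => (if y ∈ D ∧ r i y = j then s y else 0) - if y = x then σ else 0

/-- The encoding of the restriction of `s` to `D`. -/
def signedTable (D : Finset (Fin m)) : Table n q k t :=
  fun i j => ∑ x ∈ D with r i x = j, (s x : ZMod q) • column A x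

/-- No candidate for `D` is a solution. -/
def NoSolution (D : Finset (Fin m)) : Prop :=
  ∀ i j x, ∀ σ ∈ ({0, 1, -1} : Finset ℤ), intMulVec A (candidate r s D i j x σ) = 0 →
    candidate r s D i j x σ = 0

variable {r A s}

theorem shrink_subset (D : Finset (Fin m)) : shrink r D ⊆ D := Finset.filter_subset _ _

theorem intMulVec_eq_sum (v : Fin m → ℤ) :
    intMulVec A v = ∑ x, (v x : ZMod q) • column A x := by
  funext a
  simp [intMulVec, Matrix.mulVec, dotProduct, Finset.sum_apply, column_apply, mul_comm]

theorem intMulVec_candidate (D : Finset (Fin m)) (i : Fin k) (j : Fin (2 * t)) (x : Fin m)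
    (σ : ℤ) : intMulVec A (candidate r s D i j x σ) =
      signedTable r A s D i j - (σ : ZMod q) • column A x := by
  rw [intMulVec_eq_sum]
  simp only [candidate, Int.cast_sub, sub_smul, Finset.sum_sub_distrib, signedTable]
  congr 1
  · rw [← Finset.sum_subset (Finset.subset_univ (D.filter fun y => r i y = j))]
    · refine Finset.sum_congr rfl fun y hy => ?_
      rw [if_pos (Finset.mem_filter.1 hy)]
    · intro y _ hy
      rw [if_neg fun h => hy (Finset.mem_filter.2 h)]
      simp
  · rw [Finset.sum_eq_single x]
    · simp
    · intro y _ hy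
      simp [hy]
    · simp

/-- At `x`, the nonzero `σ` must be cancelled by `s x`; at any other element of `D` in the cell,
nothing could cancel the nonzero entry of `s`. -/
theorem candidate_eq_zero {D : Finset (Fin m)}
    (hD : ∀ x ∈ D, s x ≠ 0) {i : Fin k} {j : Fin (2 * t)} {x : Fin m} {σ : ℤ} (hσ : σ ≠ 0)
    (h : candidate r s D i j x σ = 0) :
    x ∈ D ∧ r i x = j ∧ s x = σ ∧ ∀ y ∈ D, r i y = j → y = x := by
  have hx := congrFun h x
  simp only [candidate, Pi.zero_apply, if_true] at hx
  have hxD : x ∈ D ∧ r i x = j := by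
    by_contra hn
    rw [if_neg hn] at hx
    omega
  rw [if_pos hxD] at hx
  refine ⟨hxD.1, hxD.2, by omega, fun y hy hj => ?_⟩
  by_contra hne
  have := congrFun h y
  simp only [candidate, Pi.zero_apply, if_neg hne, if_pos (And.intro hy hj), sub_zero] at this
  exact hD y hy this

/-- If a cell holds `σ A e_x` with `σ = ± 1`, the corresponding candidate lies in the kernel and
hence vanishes, which means that `x` is alone in the cell and has sign `σ`. Conversely, a lone
element displays its signed column. -/
theorem mem_peelable_signedTable [NeZero q] (hs : ∀ x, s x = 0 ∨ s x = 1 ∨ s x = -1)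
    {D : Finset (Fin m)} (hD : ∀ x ∈ D, s x ≠ 0) (hno : NoSolution r A s D)
    (z : Fin m × (Fin n → ZMod q)) :
    z ∈ peelable A (signedTable r A s D) ↔
      z.1 ∈ D \ shrink r D ∧ z.2 = (s z.1 : ZMod q) • column A z.1 := by
  obtain ⟨x, w⟩ := z
  have hmem : x ∈ D \ shrink r D ↔ x ∈ D ∧ ∃ i, ∀ y ∈ D, r i y = r i x → y = x := by
    simp only [shrink, Finset.mem_sdiff, Finset.mem_filter]
    tauto
  simp only [peelable, Finset.mem_filter, Finset.mem_univ, true_and]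
  rw [hmem]
  constructor
  · rintro ⟨⟨i, j, hij⟩, hw⟩
    obtain ⟨σ, hσ, hσ0, hwσ⟩ : ∃ σ ∈ ({0, 1, -1} : Finset ℤ), σ ≠ 0 ∧
        w = (σ : ZMod q) • column A x := by
      rcases hw with hw | hw
      · exact ⟨1, by simp, by simp, by simpa using hw⟩
      · exact ⟨-1, by simp, by simp, by simpa using hw⟩
    have h0 : intMulVec A (candidate r s D i j x σ) = 0 := by
      rw [intMulVec_candidate, hij, hwσ, sub_self]
    obtain ⟨h1, h2, h3, h4⟩ := candidate_eq_zero hD hσ0 (hno i j x σ hσ h0)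
    exact ⟨⟨h1, i, fun y hy h => h4 y hy (h.trans h2)⟩, by rw [h3, hwσ]⟩
  · rintro ⟨⟨hx, i, hi⟩, rfl⟩
    refine ⟨⟨i, r i x, ?_⟩, ?_⟩
    · have : D.filter (fun y => r i y = r i x) = {x} := by
        ext y
        simp only [Finset.mem_filter, Finset.mem_singleton]
        exact ⟨fun h => hi y h.1 h.2, by rintro rfl; exact ⟨hx, rfl⟩⟩
      rw [signedTable, this, Finset.sum_singleton]
    · rcases hs x with h | h | h
      · exact absurd h (hD x hx)
      · exact Or.inl (by simp [h])
      · exact Or.inr (by simp [h])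

/-- Each removed element occurs in exactly one peelable pair, with its correct sign, so each cell
sum over `D` splits into the removed and the surviving part. -/
theorem round_signedTable [NeZero q] (hs : ∀ x, s x = 0 ∨ s x = 1 ∨ s x = -1)
    {D : Finset (Fin m)} (hD : ∀ x ∈ D, s x ≠ 0) (hno : NoSolution r A s D)
    (X : Finset (Fin m)) :
    round r A (signedTable r A s D, X) =
      (signedTable r A s (shrink r D), X ∪ (D \ shrink r D)) := by
  have himage : peelable A (signedTable r A s D) =
      (D \ shrink r D).image fun x => (x, (s x : ZMod q) • column A x) := by
    ext z
    rw [mem_peelable_signedTable hs hD hno, Finset.mem_image]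
    constructor
    · rintro ⟨h1, h2⟩
      exact ⟨z.1, h1, Prod.ext rfl h2.symm⟩
    · rintro ⟨x, hx, rfl⟩
      exact ⟨hx, rfl⟩
  refine Prod.ext ?_ ?_
  · funext i j
    simp only [round, peel, himage, signedTable]
    rw [Finset.filter_image, Finset.sum_image (fun x _ y _ h => congrArg Prod.fst h),
      sub_eq_iff_eq_add, ← Finset.sum_union]
    · congr 1
      rw [← Finset.filter_union, Finset.union_sdiff_of_subset (shrink_subset D)]
    · exact Finset.disjoint_filter_filter Finset.disjoint_sdiff
  · simp only [round, himage, Finset.image_image]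
    congr 1
    exact Finset.image_id

theorem peelable_signedTable_eq_empty [NeZero q] (hs : ∀ x, s x = 0 ∨ s x = 1 ∨ s x = -1)
    {D : Finset (Fin m)} (hD : ∀ x ∈ D, s x ≠ 0) (hno : NoSolution r A s D)
    (h : shrink r D = D) : peelable A (signedTable r A s D) = ∅ := by
  refine Finset.eq_empty_of_forall_notMem fun z hz => ?_
  rw [mem_peelable_signedTable hs hD hno, h, Finset.sdiff_self] at hz
  exact absurd hz.1 (Finset.notMem_empty _)

theorem iterate_shrink_subset (c : ℕ) (D : Finset (Fin m)) : (shrink r)^[c] D ⊆ D := by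
  induction c with
  | zero => exact subset_rfl
  | succ c ih =>
    rw [Function.iterate_succ_apply']
    exact (shrink_subset _).trans ih

/-- The elements that remain after `m` rounds share all their cells. -/
theorem shrink_iterate (D : Finset (Fin m)) :
    shrink r ((shrink r)^[m] D) = (shrink r)^[m] D := by
  -- As long as the process is not stable, every round costs an element, and there are at most `m`
  -- of them.
  have key : ∀ c, shrink r ((shrink r)^[c] D) = (shrink r)^[c] D ∨
      ((shrink r)^[c] D).card + c ≤ D.card := fun c => by
    induction c with
    | zero => exact Or.inr le_rfl
    | succ c ih =>
      rw [Function.iterate_succ_apply']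
      by_cases h : shrink r ((shrink r)^[c] D) = (shrink r)^[c] D
      · exact Or.inl (by rw [h, h])
      · have h1 := Finset.card_lt_card ((shrink_subset ((shrink r)^[c] D)).ssubset_of_ne h)
        have := ih.resolve_left h
        exact Or.inr (by omega)
  rcases key m with h | h
  · exact h
  · have h1 : D.card ≤ m := by simpa using D.card_le_univ
    rw [Finset.card_eq_zero.1 (by omega : ((shrink r)^[m] D).card = 0)]
    rfl

theorem iterate_round_signedTable [NeZero q] (hs : ∀ x, s x = 0 ∨ s x = 1 ∨ s x = -1)
    {D : Finset (Fin m)} (hD : ∀ x ∈ D, s x ≠ 0) (c : ℕ)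
    (hno : ∀ c' < c, NoSolution r A s ((shrink r)^[c'] D)) :
    (round r A)^[c] (signedTable r A s D, ∅) =
      (signedTable r A s ((shrink r)^[c] D), D \ (shrink r)^[c] D) := by
  induction c with
  | zero => simp
  | succ c ih =>
    rw [Function.iterate_succ_apply', ih fun c' hc => hno c' (by omega),
      round_signedTable hs (fun x hx => hD x (iterate_shrink_subset c D hx)) (hno c (by omega)),
      Function.iterate_succ_apply']
    congr 1
    have h1 := iterate_shrink_subset (r := r) c D
    have h2 := shrink_subset (r := r) ((shrink r)^[c] D)
    ext x
    simp only [Finset.mem_union, Finset.mem_sdiff]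
    have := @h1 x
    have := @h2 x
    tauto

variable (X₀ X₁ : Finset (Fin m))

/-- The difference of the characteristic vectors of two sets. -/
def signVector (x : Fin m) : ℤ := (if x ∈ X₀ then 1 else 0) - if x ∈ X₁ then 1 else 0

theorem signVector_eq (x : Fin m) :
    signVector X₀ X₁ x = 0 ∨ signVector X₀ X₁ x = 1 ∨ signVector X₀ X₁ x = -1 := by
  unfold signVector
  split_ifs <;> simp

theorem signVector_ne_zero {x : Fin m} (hx : x ∈ symmDiff X₀ X₁) : signVector X₀ X₁ x ≠ 0 := by
  unfold signVector
  rw [Finset.mem_symmDiff] at hx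
  rcases hx with ⟨h1, h2⟩ | ⟨h1, h2⟩ <;> simp [h1, h2]

/-- Elements of both sets cancel; the others keep the sign of the set they belong to. -/
theorem encode_sub_encode : encode r A X₀ - encode r A X₁ =
    signedTable r A (signVector X₀ X₁) (symmDiff X₀ X₁) := by
  funext i j
  have h : ∀ X : Finset (Fin m), encode r A X i j =
      ∑ x, if r i x = j then (if x ∈ X then column A x else 0) else 0 := fun X => by
    rw [encode, ← Finset.sum_filter, ← Finset.sum_filter, Finset.filter_filter]
    congr 1
    ext x
    simp [and_comm]
  rw [Pi.sub_apply, Pi.sub_apply, h, h, signedTable, ← Finset.sum_sub_distrib,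
    ← Finset.sum_subset (Finset.subset_univ ((symmDiff X₀ X₁).filter fun x => r i x = j))]
  · refine Finset.sum_congr rfl fun x hx => ?_
    have hx := Finset.mem_filter.1 hx
    rw [if_pos hx.2, if_pos hx.2, signVector]
    split_ifs <;> simp
  · intro x _ hx
    simp only [Finset.mem_filter, Finset.mem_symmDiff] at hx
    by_cases h1 : r i x = j
    · by_cases h2 : x ∈ X₀ <;> by_cases h3 : x ∈ X₁ <;> simp_all
    · simp [h1]

variable {X₀ X₁}

/-- If no candidate is a solution, then the loop of the decoder ends, and decoding can fail only
if a set of elements that share all their cells remains. -/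
theorem decode_spec [NeZero q] (hk : 0 < k)
    (hno : ∀ c ≤ m, NoSolution r A (signVector X₀ X₁) ((shrink r)^[c] (symmDiff X₀ X₁))) :
    decodeLoop r A (m + 1) (encode r A X₀ - encode r A X₁) ∅ ≠ none ∧
    (decode r A (encode r A X₀) (encode r A X₁) = some (symmDiff X₀ X₁) ∨
      decode r A (encode r A X₀) (encode r A X₁) = none ∧
        (shrink r)^[m] (symmDiff X₀ X₁) ≠ ∅) := by
  set D := symmDiff X₀ X₁ with hDdef
  set s := signVector X₀ X₁ with hsdef
  have hs := signVector_eq X₀ X₁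
  have hD : ∀ x ∈ D, s x ≠ 0 := fun x => signVector_ne_zero X₀ X₁
  have hDm : ∀ x ∈ (shrink r)^[m] D, s x ≠ 0 := fun x hx => hD x (iterate_shrink_subset m D hx)
  have hloop : decodeLoop r A (m + 1) (encode r A X₀ - encode r A X₁) ∅ =
      some (signedTable r A s ((shrink r)^[m] D), D \ (shrink r)^[m] D) := by
    rw [decodeLoop_eq m (encode r A X₀ - encode r A X₁, (∅ : Finset (Fin m))), encode_sub_encode,
      iterate_round_signedTable hs hD m fun c hc => hno c hc.le, if_pos]
    exact peelable_signedTable_eq_empty hs hDm (hno m le_rfl) (shrink_iterate D)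
  refine ⟨by rw [hloop]; simp, ?_⟩
  rw [decode, hloop]
  by_cases hempty : (shrink r)^[m] D = ∅
  · left
    simp only [hempty, Finset.sdiff_empty]
    rw [if_pos]
    funext i j
    simp [signedTable]
  · right
    refine ⟨if_neg fun h0 => ?_, hempty⟩
    obtain ⟨x, hx⟩ := Finset.nonempty_iff_ne_empty.2 hempty
    -- If the final table were zero, the part of `s` in the cell of `x` in the first row would be a
    -- kernel vector. This is the purpose of `σ = 0`, and the place where `0 < k` matters.
    have h1 : intMulVec A (candidate r s ((shrink r)^[m] D) ⟨0, hk⟩ (r ⟨0, hk⟩ x) x 0) = 0 := by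
      rw [intMulVec_candidate, h0]
      simp
    have h2 := congrFun (hno m le_rfl ⟨0, hk⟩ (r ⟨0, hk⟩ x) x 0 (by simp) h1) x
    simp only [candidate, ite_self, sub_zero, Pi.zero_apply] at h2
    rw [if_pos ⟨hx, trivial⟩] at h2
    exact hDm x hx h2

/-- All entries are at most one in absolute value, except that the entry at `x` may reach two. The
sum of squares is thus at most `(m - 1) + 4`. -/
theorem isSISSolution_candidate (hs : ∀ x, s x = 0 ∨ s x = 1 ∨ s x = -1) {D : Finset (Fin m)}
    {i : Fin k} {j : Fin (2 * t)} {x : Fin m} {σ : ℤ} (hσ : σ ∈ ({0, 1, -1} : Finset ℤ))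
    (h0 : intMulVec A (candidate r s D i j x σ) = 0) (hne : candidate r s D i j x σ ≠ 0) :
    IsSISSolution (Real.sqrt ((m : ℝ) + 3)) 3 A (candidate r s D i j x σ) := by
  have hσ' : σ = 0 ∨ σ = 1 ∨ σ = -1 := by simpa using hσ
  have hp : ∀ y, (if y ∈ D ∧ r i y = j then s y else 0) = 0 ∨
      (if y ∈ D ∧ r i y = j then s y else 0) = 1 ∨
      (if y ∈ D ∧ r i y = j then s y else 0) = -1 := fun y => by
    split_ifs
    · exact hs y
    · exact Or.inl rfl
  refine ⟨hne, Real.sqrt_le_sqrt ?_, fun y => ?_, h0⟩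
  · have h1 : ∀ y, candidate r s D i j x σ y ^ 2 ≤ 1 + if y = x then 3 else 0 := fun y => by
      unfold candidate
      rcases hp y with h | h | h <;> rw [h] <;> split_ifs <;>
        rcases hσ' with rfl | rfl | rfl <;> norm_num
    have h2 : ∑ y, candidate r s D i j x σ y ^ 2 ≤ (m : ℤ) + 3 := by
      refine (Finset.sum_le_sum fun y _ => h1 y).trans ?_
      simp [Finset.sum_add_distrib]
    exact_mod_cast h2
  · have h1 : |candidate r s D i j x σ y| ≤ 3 := by
      unfold candidate
      rcases hp y with h | h | h <;> rw [h] <;> split_ifs <;>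
        rcases hσ' with rfl | rfl | rfl <;> norm_num
    exact_mod_cast h1

end Peeling

end IBLT

/-! ### Searching for a kernel candidate -/

theorem List.all_range {N : ℕ} (p : ℕ → Bool) :
    (List.range N).all p = decide (∀ i : Fin N, p i = true) := by
  rw [Bool.eq_iff_iff]
  simp [List.all_eq_true, Fin.forall_iff]

namespace IBLT

section Lists

variable (k T n m q : ℕ) (r A : ℕ → ℕ → ℕ) (X₀ X₁ : ℕ → Bool)

def listShrink (D : List Bool) : List Bool :=
  (List.range m).map fun x => D.getD x false && !((List.range k).any fun i =>
    (List.range m).all fun y => !(D.getD y false && decide (r i y = r i x)) || decide (y = x))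

/-- The sets that remain in the rounds `m, …, 0`. -/
def listShrinks (D : List Bool) : List (List Bool) :=
  (List.range m).foldl (fun L _ => listShrink k m r (L.getD 0 []) :: L) [D]

/-- The parameters of a candidate: a set, a cell, an element, and the positive and the negative
part of a sign. -/
abbrev CandidateData : Type := List Bool × ℕ × ℕ × ℕ × ℕ × ℕ

/-- The part of a candidate that comes from the elements of `X₀`, where `b` is the multiple of
the unit vector that is added. -/
def listPart (X : ℕ → Bool) (b : ℕ) (c : CandidateData) (y : ℕ) : ℕ :=
  (bif c.1.getD y false && (decide (r c.2.1 y = c.2.2.1) && X y) then 1 else 0) +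
    bif decide (y = c.2.2.2.1) then b else 0

/-- A candidate subtracts `σ e_x`, so the negative part of `σ` is added here and the positive part
in `listNeg`. -/
def listPos (c : CandidateData) (y : ℕ) : ℕ := listPart r X₀ c.2.2.2.2.2 c y

def listNeg (c : CandidateData) (y : ℕ) : ℕ := listPart r X₁ c.2.2.2.2.1 c y

def listVector (c : CandidateData) : List ℤ :=
  (List.range m).map fun y => (listPos r X₀ c y : ℤ) - listNeg r X₁ c y

/-- Comparing the images of the two nonnegative parts keeps the whole test inside the natural
numbers. -/
def listIsSolution (c : CandidateData) : Bool :=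
  ((List.range m).any fun y => !decide (listPos r X₀ c y = listNeg r X₁ c y)) &&
  (List.range n).all fun a =>
    decide (((List.range m).map fun y => A a y * listPos r X₀ c y).sum % q =
      ((List.range m).map fun y => A a y * listNeg r X₁ c y).sum % q)

def listCandidates (D : List (List Bool)) : List CandidateData :=
  D.flatMap fun d => (List.range k).flatMap fun i => (List.range T).flatMap fun j =>
    (List.range m).flatMap fun x => [(0, 0), (1, 0), (0, 1)].map fun σ => (d, i, j, x, σ)

/-- Search for a solution among the candidates. -/
def listSearch : Val :=
  ((((listCandidates k T m (listShrinks k m r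
    ((List.range m).map fun x => X₀ x ^^ X₁ x))).filter
      (listIsSolution n m q r A X₀ X₁)).map (listVector m r X₀ X₁)).map Enc.enc).headD (Val.num 0)

end Lists

section Efficient

open EfficientlyComputable

variable {α : Type} [Enc α] {k T n m q : α → ℕ} {r A : α → ℕ → ℕ → ℕ} {X₀ X₁ : α → ℕ → Bool}

theorem efficient_listShrink {D : α → List Bool}
    (hk : EfficientlyComputable fun a => List.range (k a))
    (hm : EfficientlyComputable fun a => List.range (m a))
    (hr : EfficientlyComputable fun p : α × ℕ × ℕ => r p.1 p.2.1 p.2.2)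
    (hD : EfficientlyComputable D) :
    EfficientlyComputable fun a => listShrink (k a) (m a) (r a) (D a) :=
  map (g := fun a x => (D a).getD x false && !((List.range (k a)).any fun i =>
      (List.range (m a)).all fun y =>
        !((D a).getD y false && decide (r a i y = r a i x)) || decide (y = x)))
    (and (getD (hD.comp id.fst) id.snd (const false))
      (not (any (p := fun (p : α × ℕ) i => (List.range (m p.1)).all fun y =>
          !((D p.1).getD y false && decide (r p.1 i y = r p.1 i p.2)) || decide (y = p.2))
        (all (p := fun (p : (α × ℕ) × ℕ) y =>
            !((D p.1.1).getD y false && decide (r p.1.1 p.2 y = r p.1.1 p.2 p.1.2)) ||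
              decide (y = p.1.2))
          (or (not (and (getD (hD.comp id.fst.fst.fst) id.snd (const false))
            (decide_eq (hr.comp (id.fst.fst.fst.pair (id.fst.snd.pair id.snd)))
              (hr.comp (id.fst.fst.fst.pair (id.fst.snd.pair id.fst.fst.snd))))))
            (decide_eq id.snd id.fst.fst.snd))
          (hm.comp id.fst.fst))
        (hk.comp id.fst)))) hm

/-- There are at most `m + 1` sets, and every set after the initial one is a Boolean list of length
`m`, whatever it was computed from. -/
theorem efficient_listShrinks {D : α → List Bool}
    (hk : EfficientlyComputable fun a => List.range (k a))
    (hm : EfficientlyComputable fun a => List.range (m a))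
    (hr : EfficientlyComputable fun p : α × ℕ × ℕ => r p.1 p.2.1 p.2.2)
    (hD : EfficientlyComputable D) :
    EfficientlyComputable fun a => listShrinks (k a) (m a) (r a) (D a) := by
  have pm := polySize_of_range hm
  refine foldl (l := fun a => List.range (m a)) (b := fun a => [D a])
    (step := fun a L _ => listShrink (k a) (m a) (r a) (L.getD 0 []) :: L)
    (B := fun a => (m a + 1) * (encSize (D a) + (m a * 3 + 1) + 1) + 1)
    (cons (efficient_listShrink (hk.comp id.fst) (hm.comp id.fst)
      (hr.comp (id.fst.fst.pair id.snd)) (getD id.snd.snd (const 0) (const []))) id.snd.snd)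
    hm (cons hD (const []))
    (((pm.add (.const 1)).mul ((hD.polySize.add ((pm.mul (.const 3)).add (.const 1))).add
      (.const 1))).add (.const 1)) fun a l₁ l₂ h => ?_
  have hlen : l₁.length ≤ m a := by
    have := congrArg List.length h
    simp only [List.length_range, List.length_append] at this
    omega
  clear h
  suffices hs : ∀ l : List ℕ,
      (l.foldl (fun L _ => listShrink (k a) (m a) (r a) (L.getD 0 []) :: L) [D a]).length =
        l.length + 1 ∧
      ∀ d ∈ l.foldl (fun L _ => listShrink (k a) (m a) (r a) (L.getD 0 []) :: L) [D a],
        encSize d ≤ encSize (D a) + (m a * 3 + 1) by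
    refine (encSize_list_le (hs l₁).2).trans ?_
    rw [(hs l₁).1]
    gcongr
  intro l
  induction l using List.reverseRecOn with
  | nil => simp
  | append_singleton l x ih =>
    rw [List.foldl_append]
    simp only [List.foldl_cons, List.foldl_nil, List.length_cons, List.length_append,
      List.length_nil, List.mem_cons, forall_eq_or_imp]
    refine ⟨by rw [ih.1], ?_, ih.2⟩
    generalize List.getD _ 0 [] = d
    have : encSize (listShrink (k a) (m a) (r a) d) ≤ m a * 3 + 1 :=
      (encSize_list_le (W := 2) fun x hx => encSize_bool_le x).trans (by simp [listShrink])
    omega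

theorem efficient_listPart {X : α → ℕ → Bool} {b : α → ℕ} {c : α → CandidateData}
    {y : α → ℕ} (hr : EfficientlyComputable fun p : α × ℕ × ℕ => r p.1 p.2.1 p.2.2)
    (hX : EfficientlyComputable fun p : α × ℕ => X p.1 p.2) (hb : EfficientlyComputable b)
    (hc : EfficientlyComputable c) (hy : EfficientlyComputable y) :
    EfficientlyComputable fun a => listPart (r a) (X a) (b a) (c a) (y a) :=
  natAdd (cond (and (getD hc.fst hy (const false))
      (and (decide_eq (hr.comp (id.pair (hc.snd.fst.pair hy))) hc.snd.snd.fst)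
        (hX.comp (id.pair hy)))) (const 1) (const 0))
    (cond (decide_eq hy hc.snd.snd.snd.fst) hb (const 0))

theorem efficient_listVector {c : α → CandidateData}
    (hm : EfficientlyComputable fun a => List.range (m a))
    (hr : EfficientlyComputable fun p : α × ℕ × ℕ => r p.1 p.2.1 p.2.2)
    (h₀ : EfficientlyComputable fun p : α × ℕ => X₀ p.1 p.2)
    (h₁ : EfficientlyComputable fun p : α × ℕ => X₁ p.1 p.2)
    (hc : EfficientlyComputable c) :
    EfficientlyComputable fun a => listVector (m a) (r a) (X₀ a) (X₁ a) (c a) :=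
  have hr' : EfficientlyComputable fun p : (α × ℕ) × ℕ × ℕ => r p.1.1 p.2.1 p.2.2 :=
    hr.comp (id.fst.fst.pair id.snd)
  have hc' : EfficientlyComputable fun p : α × ℕ => c p.1 := hc.comp id.fst
  map (g := fun a y => (listPos (r a) (X₀ a) (c a) y : ℤ) - listNeg (r a) (X₁ a) (c a) y)
    (intSub
      (efficient_listPart hr' (h₀.comp (id.fst.fst.pair id.snd)) hc'.snd.snd.snd.snd.snd hc' id.snd)
      (efficient_listPart hr' (h₁.comp (id.fst.fst.pair id.snd)) hc'.snd.snd.snd.snd.fst hc' id.snd))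
    hm

theorem efficient_listIsSolution {c : α → CandidateData}
    (hn : EfficientlyComputable fun a => List.range (n a))
    (hm : EfficientlyComputable fun a => List.range (m a)) (hq : EfficientlyComputable q)
    (hr : EfficientlyComputable fun p : α × ℕ × ℕ => r p.1 p.2.1 p.2.2)
    (hA : EfficientlyComputable fun p : α × ℕ × ℕ => A p.1 p.2.1 p.2.2)
    (h₀ : EfficientlyComputable fun p : α × ℕ => X₀ p.1 p.2)
    (h₁ : EfficientlyComputable fun p : α × ℕ => X₁ p.1 p.2)
    (hc : EfficientlyComputable c) :
    EfficientlyComputable fun a =>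
      listIsSolution (n a) (m a) (q a) (r a) (A a) (X₀ a) (X₁ a) (c a) := by
  have hr' : EfficientlyComputable fun p : (α × ℕ) × ℕ × ℕ => r p.1.1 p.2.1 p.2.2 :=
    hr.comp (id.fst.fst.pair id.snd)
  have hc' : EfficientlyComputable fun p : α × ℕ => c p.1 := hc.comp id.fst
  have hpos : EfficientlyComputable fun p : α × ℕ => listPos (r p.1) (X₀ p.1) (c p.1) p.2 :=
    efficient_listPart hr' (h₀.comp (id.fst.fst.pair id.snd)) hc'.snd.snd.snd.snd.snd hc' id.snd
  have hneg : EfficientlyComputable fun p : α × ℕ => listNeg (r p.1) (X₁ p.1) (c p.1) p.2 :=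
    efficient_listPart hr' (h₁.comp (id.fst.fst.pair id.snd)) hc'.snd.snd.snd.snd.fst hc' id.snd
  have hA' : EfficientlyComputable fun p : (α × ℕ) × ℕ => A p.1.1 p.1.2 p.2 :=
    hA.comp (id.fst.fst.pair (id.fst.snd.pair id.snd))
  have hmul : ∀ {f : α → ℕ → ℕ}, (EfficientlyComputable fun p : α × ℕ => f p.1 p.2) →
      EfficientlyComputable fun p : α × ℕ =>
        ((List.range (m p.1)).map fun y => A p.1 p.2 y * f p.1 y).sum % q p.1 := fun {f} hf =>
    natMod (sumMap (g := fun (p : α × ℕ) y => A p.1 p.2 y * f p.1 y)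
      (natMul hA' (hf.comp (id.fst.fst.pair id.snd))) (hm.comp id.fst)) (hq.comp id.fst)
  exact and (any (p := fun a y => !decide (listPos (r a) (X₀ a) (c a) y =
      listNeg (r a) (X₁ a) (c a) y)) (not (decide_eq hpos hneg)) hm)
    (all (p := fun a b => decide
      (((List.range (m a)).map fun y => A a b y * listPos (r a) (X₀ a) (c a) y).sum % q a =
        ((List.range (m a)).map fun y => A a b y * listNeg (r a) (X₁ a) (c a) y).sum % q a))
      (decide_eq (hmul (f := fun a y => listPos (r a) (X₀ a) (c a) y) hpos)
        (hmul (f := fun a y => listNeg (r a) (X₁ a) (c a) y) hneg)) hn)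

theorem efficient_listCandidates {D : α → List (List Bool)}
    (hk : EfficientlyComputable fun a => List.range (k a))
    (hT : EfficientlyComputable fun a => List.range (T a))
    (hm : EfficientlyComputable fun a => List.range (m a)) (hD : EfficientlyComputable D) :
    EfficientlyComputable fun a => listCandidates (k a) (T a) (m a) (D a) :=
  flatMap (g := fun a d => (List.range (k a)).flatMap fun i => (List.range (T a)).flatMap fun j =>
      (List.range (m a)).flatMap fun x => [(0, 0), (1, 0), (0, 1)].map fun σ => (d, i, j, x, σ))
    (flatMap (g := fun (p : α × List Bool) i => (List.range (T p.1)).flatMap fun j =>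
        (List.range (m p.1)).flatMap fun x =>
          [(0, 0), (1, 0), (0, 1)].map fun σ => (p.2, i, j, x, σ))
      (flatMap (g := fun (p : (α × List Bool) × ℕ) j => (List.range (m p.1.1)).flatMap fun x =>
          [(0, 0), (1, 0), (0, 1)].map fun σ => (p.1.2, p.2, j, x, σ))
        (flatMap (g := fun (p : ((α × List Bool) × ℕ) × ℕ) x =>
            [(0, 0), (1, 0), (0, 1)].map fun σ => (p.1.1.2, p.1.2, p.2, x, σ))
          (map (g := fun (p : (((α × List Bool) × ℕ) × ℕ) × ℕ) (σ : ℕ × ℕ) =>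
              (p.1.1.1.2, p.1.1.2, p.1.2, p.2, σ))
            (id.fst.fst.fst.fst.snd.pair (id.fst.fst.fst.snd.pair
              (id.fst.fst.snd.pair (id.fst.snd.pair id.snd)))) (const _))
          (hm.comp id.fst.fst.fst)) (hT.comp id.fst.fst)) (hk.comp id.fst)) hD

theorem efficient_xor {c d : α → Bool} (hc : EfficientlyComputable c) (hd : EfficientlyComputable d) :
    EfficientlyComputable fun a => c a ^^ d a :=
  (cond hc (not hd) hd).congr fun a => by cases c a <;> simp

theorem efficient_listSearch
    (hk : EfficientlyComputable fun a => List.range (k a))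
    (hT : EfficientlyComputable fun a => List.range (T a))
    (hn : EfficientlyComputable fun a => List.range (n a))
    (hm : EfficientlyComputable fun a => List.range (m a)) (hq : EfficientlyComputable q)
    (hr : EfficientlyComputable fun p : α × ℕ × ℕ => r p.1 p.2.1 p.2.2)
    (hA : EfficientlyComputable fun p : α × ℕ × ℕ => A p.1 p.2.1 p.2.2)
    (h₀ : EfficientlyComputable fun p : α × ℕ => X₀ p.1 p.2)
    (h₁ : EfficientlyComputable fun p : α × ℕ => X₁ p.1 p.2) :
    EfficientlyComputable fun a =>
      listSearch (k a) (T a) (n a) (m a) (q a) (r a) (A a) (X₀ a) (X₁ a) := by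
  have hr' : EfficientlyComputable fun p : (α × CandidateData) × ℕ × ℕ => r p.1.1 p.2.1 p.2.2 :=
    hr.comp (id.fst.fst.pair id.snd)
  have h₀' : EfficientlyComputable fun p : (α × CandidateData) × ℕ => X₀ p.1.1 p.2 :=
    h₀.comp (id.fst.fst.pair id.snd)
  have h₁' : EfficientlyComputable fun p : (α × CandidateData) × ℕ => X₁ p.1.1 p.2 :=
    h₁.comp (id.fst.fst.pair id.snd)
  refine encHead (map (g := fun a c => listVector (m a) (r a) (X₀ a) (X₁ a) c)
    (efficient_listVector (hm.comp id.fst) hr' h₀' h₁' id.snd)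
    (filter (p := fun a c => listIsSolution (n a) (m a) (q a) (r a) (A a) (X₀ a) (X₁ a) c)
      (efficient_listIsSolution (hn.comp id.fst) (hm.comp id.fst) (hq.comp id.fst) hr'
        (hA.comp (id.fst.fst.pair id.snd)) h₀' h₁' id.snd)
      (efficient_listCandidates hk hT hm (efficient_listShrinks hk hm hr
        (map (g := fun a x => X₀ a x ^^ X₁ a x) (efficient_xor h₀ h₁) hm)))))

end Efficient

section Correctness

variable {n m q k : ℕ} {t : ℕ+} {r : Fin k → Fin m → Fin (2 * t)}
  {A : Matrix (Fin n) (Fin m) (ZMod q)} {r' A' : ℕ → ℕ → ℕ} {X₀' X₁' : ℕ → Bool}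
  {X₀ X₁ : Finset (Fin m)}

theorem listShrink_eq (hr : ∀ (i : Fin k) (x : Fin m), r' i x = r i x) (D : Finset (Fin m)) :
    listShrink k m r' (finsetToList D) = finsetToList (shrink r D) := by
  refine List.map_range_eq_ofFn fun x => ?_
  have hget : ∀ y : Fin m, (finsetToList D).getD y false = decide (y ∈ D) := fun y =>
    List.getD_ofFn _ y _
  rw [hget, List.any_range, Bool.eq_iff_iff]
  simp only [List.all_range, hget, hr, shrink, Finset.mem_filter, Bool.and_eq_true,
    Bool.not_eq_true', decide_eq_true_eq, decide_eq_false_iff_not, Bool.or_eq_true,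
    Fin.val_inj, Bool.and_eq_false_iff]
  refine and_congr_right fun _ => not_congr (exists_congr fun i => forall_congr' fun y => ?_)
  tauto

theorem mem_listShrinks (hr : ∀ (i : Fin k) (x : Fin m), r' i x = r i x) (D : Finset (Fin m))
    (d : List Bool) : d ∈ listShrinks k m r' (finsetToList D) ↔
      ∃ c ≤ m, d = finsetToList ((shrink r)^[c] D) := by
  have key : ∀ N, ((List.range N).foldl (fun L _ => listShrink k m r' (L.getD 0 []) :: L)
        [finsetToList D]).getD 0 [] = finsetToList ((shrink r)^[N] D) ∧
      ∀ d, d ∈ (List.range N).foldl (fun L _ => listShrink k m r' (L.getD 0 []) :: L)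
        [finsetToList D] ↔ ∃ c ≤ N, d = finsetToList ((shrink r)^[c] D) := fun N => by
    induction N with
    | zero => simp
    | succ N ih =>
      rw [List.range_succ, List.foldl_append]
      simp only [List.foldl_cons, List.foldl_nil, List.getD_cons_zero, List.mem_cons]
      rw [ih.1, listShrink_eq hr, ← Function.iterate_succ_apply' (shrink r)]
      refine ⟨rfl, fun d => ?_⟩
      rw [ih.2]
      constructor
      · rintro (rfl | ⟨c, hc, rfl⟩)
        · exact ⟨N + 1, le_rfl, rfl⟩
        · exact ⟨c, by omega, rfl⟩
      · rintro ⟨c, hc, rfl⟩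
        rcases Nat.le_succ_iff.1 hc with h | rfl
        · exact Or.inr ⟨c, h, rfl⟩
        · exact Or.inl rfl
  exact (key m).2 d

theorem mem_listCandidates (T : ℕ) (D : List (List Bool)) (c : CandidateData) :
    c ∈ listCandidates k T m D ↔ c.1 ∈ D ∧ c.2.1 < k ∧ c.2.2.1 < T ∧ c.2.2.2.1 < m ∧
      c.2.2.2.2 ∈ [(0, 0), (1, 0), (0, 1)] := by
  obtain ⟨d, i, j, x, σ⟩ := c
  simp only [listCandidates, List.mem_flatMap, List.mem_range, List.mem_map, Prod.mk.injEq]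
  constructor
  · rintro ⟨d, hd, i, hi, j, hj, x, hx, σ, hσ, rfl, rfl, rfl, rfl, rfl⟩
    exact ⟨hd, hi, hj, hx, hσ⟩
  · rintro ⟨hd, hi, hj, hx, hσ⟩
    exact ⟨d, hd, i, hi, j, hj, x, hx, σ, hσ, rfl, rfl, rfl, rfl, rfl⟩

theorem listPos_sub_listNeg (hr : ∀ (i : Fin k) (x : Fin m), r' i x = r i x)
    (h₀ : ∀ x : Fin m, X₀' x = decide (x ∈ X₀)) (h₁ : ∀ x : Fin m, X₁' x = decide (x ∈ X₁))
    (D : Finset (Fin m)) (i : Fin k) (j : Fin (2 * t)) (x : Fin m) (σ : ℕ × ℕ) (y : Fin m) :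
    (listPos r' X₀' (finsetToList D, i, j, x, σ) y : ℤ) -
      listNeg r' X₁' (finsetToList D, i, j, x, σ) y =
      candidate r (signVector X₀ X₁) D i j x ((σ.1 : ℤ) - σ.2) y := by
  have hget : (finsetToList D).getD y false = decide (y ∈ D) := List.getD_ofFn _ y _
  simp only [listPos, listNeg, listPart, hget, hr, h₀, h₁, candidate, signVector, Fin.val_inj,
    Nat.cast_add]
  have hx : ((bif decide (y = x) then σ.2 else 0 : ℕ) : ℤ) -
      ((bif decide (y = x) then σ.1 else 0 : ℕ) : ℤ) = -(if y = x then (σ.1 : ℤ) - σ.2 else 0) := by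
    by_cases hx : y = x <;> simp [hx]
  -- The contribution of `σ` is made opaque, so that the case distinction below concerns only `D`,
  -- the cell and the two sets.
  generalize (if y = x then (σ.1 : ℤ) - σ.2 else 0) = u at hx ⊢
  generalize ((bif decide (y = x) then σ.2 else 0 : ℕ) : ℤ) = v at hx ⊢
  generalize ((bif decide (y = x) then σ.1 else 0 : ℕ) : ℤ) = w at hx ⊢
  by_cases hD : y ∈ D <;> by_cases hj : r i y = j <;>
    by_cases hy₀ : y ∈ X₀ <;> by_cases hy₁ : y ∈ X₁ <;>
    simp only [hD, hj, hy₀, hy₁, decide_true, decide_false, Bool.and_true,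
      Bool.and_false, cond_true, cond_false, if_true, if_false, and_true, and_false] <;>
    push_cast <;> linarith

theorem listIsSolution_iff (hr : ∀ (i : Fin k) (x : Fin m), r' i x = r i x)
    [NeZero q] (hA : ∀ (a : Fin n) (x : Fin m), A' a x = (A a x).val)
    (h₀ : ∀ x : Fin m, X₀' x = decide (x ∈ X₀)) (h₁ : ∀ x : Fin m, X₁' x = decide (x ∈ X₁))
    (D : Finset (Fin m)) (i : Fin k) (j : Fin (2 * t)) (x : Fin m) (σ : ℕ × ℕ) :
    listIsSolution n m q r' A' X₀' X₁' (finsetToList D, i, j, x, σ) = true ↔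
      candidate r (signVector X₀ X₁) D i j x ((σ.1 : ℤ) - σ.2) ≠ 0 ∧
      intMulVec A (candidate r (signVector X₀ X₁) D i j x ((σ.1 : ℤ) - σ.2)) = 0 := by
  have hc := listPos_sub_listNeg hr h₀ h₁ D i j x σ
  rw [listIsSolution, Bool.and_eq_true, List.any_range, List.all_range, decide_eq_true_eq,
    decide_eq_true_eq]
  refine and_congr ?_ ?_
  · rw [Function.ne_iff]
    refine exists_congr fun y => ?_
    rw [← hc, Pi.zero_apply, sub_ne_zero, Bool.not_eq_true', decide_eq_false_iff_not, Ne,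
      Nat.cast_inj]
  · rw [funext_iff]
    refine forall_congr' fun a => ?_
    rw [decide_eq_true_eq, ← Nat.ModEq, ← ZMod.natCast_eq_natCast_iff, List.sum_map_range_eq,
      List.sum_map_range_eq, ← sub_eq_zero, Nat.cast_sum, Nat.cast_sum, ← Finset.sum_sub_distrib,
      Pi.zero_apply, intMulVec, Matrix.mulVec, dotProduct]
    refine Eq.congr (Finset.sum_congr rfl fun y _ => ?_) rfl
    rw [← hc, hA]
    push_cast
    rw [ZMod.natCast_zmod_val]
    ring

/-- Everything that passes the filter is a solution, and a failure of `NoSolution` in one of the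
rounds supplies an entry that passes; the head of the filtered list is therefore a solution. -/
theorem listSearch_spec (hr : ∀ (i : Fin k) (x : Fin m), r' i x = r i x)
    [NeZero q] (hA : ∀ (a : Fin n) (x : Fin m), A' a x = (A a x).val)
    (h₀ : ∀ x : Fin m, X₀' x = decide (x ∈ X₀)) (h₁ : ∀ x : Fin m, X₁' x = decide (x ∈ X₁))
    (hno : ¬∀ c ≤ m, NoSolution r A (signVector X₀ X₁) ((shrink r)^[c] (symmDiff X₀ X₁))) :
    ∃ s : Fin m → ℤ, listSearch k (2 * t) n m q r' A' X₀' X₁' = Enc.enc s ∧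
      IsSISSolution (Real.sqrt ((m : ℝ) + 3)) 3 A s := by
  have hD : ((List.range m).map fun x => X₀' x ^^ X₁' x) = finsetToList (symmDiff X₀ X₁) :=
    List.map_range_eq_ofFn fun x => by
      rw [h₀, h₁, Bool.eq_iff_iff]
      by_cases h : x ∈ X₀ <;> by_cases h' : x ∈ X₁ <;> simp [h, h', Finset.mem_symmDiff]
  rw [listSearch, hD]
  set L := (listCandidates k (2 * t) m (listShrinks k m r' (finsetToList (symmDiff X₀ X₁)))).filter
    (listIsSolution n m q r' A' X₀' X₁') with hL
  have hmem : ∀ c ∈ L, ∃ s : Fin m → ℤ, Enc.enc (listVector m r' X₀' X₁' c) = Enc.enc s ∧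
      IsSISSolution (Real.sqrt ((m : ℝ) + 3)) 3 A s := by
    rintro ⟨d, i, j, x, σ⟩ hc
    rw [hL, List.mem_filter, mem_listCandidates, mem_listShrinks hr] at hc
    obtain ⟨⟨⟨c, -, hd⟩, hi, hj, hx, hσ⟩, hsol⟩ := hc
    simp only at hd hi hj hx hσ
    subst hd
    have h1 := (listIsSolution_iff hr hA h₀ h₁ ((shrink r)^[c] (symmDiff X₀ X₁)) ⟨i, hi⟩ ⟨j, hj⟩
      ⟨x, hx⟩ σ).1 hsol
    refine ⟨_, ?_, isSISSolution_candidate (signVector_eq X₀ X₁) ?_ h1.2 h1.1⟩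
    · refine ((Enc.enc_fun_eq fun _ => rfl).trans (congrArg Enc.enc ?_)).symm
      refine (List.map_range_eq_ofFn fun y => ?_).symm
      exact listPos_sub_listNeg hr h₀ h₁ _ ⟨i, hi⟩ ⟨j, hj⟩ ⟨x, hx⟩ σ y
    · simp only [List.mem_cons, List.not_mem_nil, or_false] at hσ
      rcases hσ with rfl | rfl | rfl <;> simp
  have hne : L ≠ [] := by
    simp only [NoSolution] at hno
    push Not at hno
    obtain ⟨c, hc, i, j, x, σ, hσ, h0, h1⟩ := hno
    obtain ⟨τ, hτ, rfl⟩ : ∃ τ ∈ [((0 : ℕ), (0 : ℕ)), (1, 0), (0, 1)], σ = (τ.1 : ℤ) - τ.2 := by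
      simp only [Finset.mem_insert, Finset.mem_singleton] at hσ
      rcases hσ with rfl | rfl | rfl
      · exact ⟨(0, 0), by simp, by simp⟩
      · exact ⟨(1, 0), by simp, by simp⟩
      · exact ⟨(0, 1), by simp, by simp⟩
    have hmemL : ((finsetToList ((shrink r)^[c] (symmDiff X₀ X₁)), (i : ℕ), (j : ℕ), (x : ℕ), τ) :
        CandidateData) ∈ L := by
      rw [hL, List.mem_filter, mem_listCandidates, mem_listShrinks hr]
      exact ⟨⟨⟨c, hc, rfl⟩, i.2, j.2, x.2, hτ⟩,
        (listIsSolution_iff hr hA h₀ h₁ _ i j x τ).2 ⟨h1, h0⟩⟩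
    exact List.ne_nil_of_mem hmemL
  obtain ⟨c, L', hcL⟩ := List.exists_cons_of_ne_nil hne
  rw [hcL, List.map_cons, List.map_cons, List.headD_cons]
  exact hmem c (by rw [hcL]; exact List.mem_cons_self)

end Correctness

end IBLT

/-! ### Probability that a small set cannot be peeled -/

theorem PMF.toOuterMeasure_le_one {α : Type} (μ : PMF α) (E : Set α) : μ.toOuterMeasure E ≤ 1 := by
  rw [toOuterMeasure_apply, ← μ.tsum_coe]
  exact ENNReal.tsum_le_tsum fun a => Set.indicator_le_self E μ a

theorem PMF.toOuterMeasure_ne_top {α : Type} (μ : PMF α) (E : Set α) : μ.toOuterMeasure E ≠ ⊤ :=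
  ((μ.toOuterMeasure_le_one E).trans_lt ENNReal.one_lt_top).ne

/-- This is the only use of the independence of the rows. -/
theorem PMF.toOuterMeasure_iid_forall {α : Type} (μ : PMF α) (E : Set α) (N : ℕ) :
    (μ.iid N).toOuterMeasure {v | ∀ i, v i ∈ E} = μ.toOuterMeasure E ^ N := by
  induction N with
  | zero =>
    rw [toOuterMeasure_apply, pow_zero, ← (μ.iid 0).tsum_coe]
    exact tsum_congr fun v => Set.indicator_of_mem (fun i => i.elim0) _
  | succ N ih =>
    rw [iid, toOuterMeasure_bind_apply, pow_succ', ← ih, toOuterMeasure_apply,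
      ← ENNReal.tsum_mul_right]
    refine tsum_congr fun a => ?_
    rw [toOuterMeasure_map_apply]
    by_cases ha : a ∈ E
    · rw [Set.indicator_of_mem ha]
      congr 2
      ext v
      simp [Fin.forall_fin_succ, ha]
    · rw [Set.indicator_of_notMem ha, zero_mul]
      convert mul_zero _
      convert MeasureTheory.measure_empty (μ := (μ.iid N).toOuterMeasure)
      ext v
      simp [Fin.forall_fin_succ, ha]

/-- A function on a set takes at most half as many values as the set has elements if every
value is taken twice. -/
theorem Finset.card_image_le_half {α β : Type} [DecidableEq α] [DecidableEq β] (S : Finset α)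
    (f : α → β) (h : ∀ x ∈ S, ∃ y ∈ S, y ≠ x ∧ f y = f x) : (S.image f).card ≤ S.card / 2 := by
  rw [Nat.le_div_iff_mul_le two_pos, mul_comm]
  refine mul_card_image_le_card S 2 fun b hb => ?_
  obtain ⟨x, hx, rfl⟩ := mem_image.1 hb
  obtain ⟨y, hy, hne, hxy⟩ := h x hx
  exact one_lt_card.2 ⟨y, mem_filter.2 ⟨hy, hxy⟩, x, mem_filter.2 ⟨hx, rfl⟩, hne⟩

/-- Union bound for the event that every element of `S` collides with another one. -/
theorem PMF.toOuterMeasure_collision_le {Ω α : Type} [DecidableEq α] (μ : PMF Ω) {N : ℕ}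
    (f : Ω → α → Fin N) (S : Finset α) (p : ENNReal) (hS : S.card / 2 ≤ N)
    (hp : ∀ y : S → Fin N, μ.toOuterMeasure {ω | ∀ x : S, f ω x = y x} ≤ p) :
    μ.toOuterMeasure {ω | ∀ x ∈ S, ∃ y ∈ S, y ≠ x ∧ f ω y = f ω x} ≤
      (N.choose (S.card / 2) * (S.card / 2) ^ S.card : ℕ) * p := by
  have hsub : {ω | ∀ x ∈ S, ∃ y ∈ S, y ≠ x ∧ f ω y = f ω x} ⊆
      ⋃ T ∈ Finset.powersetCard (S.card / 2) (Finset.univ : Finset (Fin N)),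
        ⋃ y ∈ Fintype.piFinset fun _ : S => T, {ω | ∀ x : S, f ω x = y x} := by
    intro ω hω
    -- The set of values is enlarged to exactly `|S| / 2` cells, so that the union runs over sets of
    -- one fixed size.
    obtain ⟨T, hT, hcard⟩ := Finset.exists_superset_card_eq (S.card_image_le_half (f ω) hω)
      (by simpa using hS)
    simp only [Set.mem_iUnion]
    exact ⟨T, Finset.mem_powersetCard.2 ⟨Finset.subset_univ _, hcard⟩, fun x => f ω x,
      Fintype.mem_piFinset.2 fun x => hT (Finset.mem_image_of_mem _ x.2), fun _ => rfl⟩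
  refine (MeasureTheory.measure_mono hsub).trans
    ((MeasureTheory.measure_biUnion_finset_le _ _).trans ?_)
  have hT : ∀ T ∈ Finset.powersetCard (S.card / 2) (Finset.univ : Finset (Fin N)),
      μ.toOuterMeasure (⋃ y ∈ Fintype.piFinset fun _ : S => T, {ω | ∀ x : S, f ω x = y x}) ≤
        ((S.card / 2) ^ S.card : ℕ) * p := fun T hT => by
    refine (MeasureTheory.measure_biUnion_finset_le _ _).trans
      ((Finset.sum_le_sum fun y _ => hp y).trans ?_)
    rw [Finset.sum_const, nsmul_eq_mul, Fintype.card_piFinset, Finset.prod_const,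
      (Finset.mem_powersetCard.1 hT).2, Finset.card_univ, Fintype.card_coe]
  refine (Finset.sum_le_sum hT).trans ?_
  rw [Finset.sum_const, nsmul_eq_mul, Finset.card_powersetCard, Finset.card_univ,
    Fintype.card_fin, ← mul_assoc, ← Nat.cast_mul]

/-- The bound for the collision probability of `l` elements in `2 * t` cells. -/
theorem choose_mul_pow_div_le {l t : ℕ} (ht : 0 < t) (hl : l ≤ t) :
    (((2 * t).choose (l / 2) * (l / 2) ^ l : ℕ) : ℝ) * (1 / (2 * (t : ℝ))) ^ l ≤
      Real.sqrt (Real.exp 1 / 4) ^ l := by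
  set h := l / 2 with hh
  have hle : h ≤ l := Nat.div_le_self _ _
  have ht' : (0 : ℝ) < 2 * t := by positivity
  set u : ℝ := h / (2 * t) with hu
  have hu0 : 0 ≤ u := by positivity
  have hu4 : u ≤ 1 / 4 := by
    rw [hu, div_le_iff₀ ht']
    have h1 : 2 * h ≤ t := by omega
    have h2 : (2 : ℝ) * h ≤ t := by exact_mod_cast h1
    linarith
  have h1 : (((2 * t).choose h * h ^ l : ℕ) : ℝ) * (1 / (2 * (t : ℝ))) ^ l ≤
      Real.exp h * (1 / 4) ^ (l - h) := by
    calc (((2 * t).choose h * h ^ l : ℕ) : ℝ) * (1 / (2 * (t : ℝ))) ^ l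
        = ((2 * t).choose h : ℝ) * u ^ l := by
          rw [hu, div_pow (h : ℝ), one_div, inv_pow, div_eq_mul_inv]
          push_cast
          ring
      _ ≤ ((2 * t : ℕ) : ℝ) ^ h / h.factorial * u ^ l := by
          gcongr
          exact Nat.choose_le_pow_div h (2 * t)
      -- The factor `u ^ h` is split off and cancels `(2t)^h`.
      _ = (h : ℝ) ^ h / h.factorial * u ^ (l - h) := by
          rw [← Nat.sub_add_cancel hle, Nat.add_sub_cancel, pow_add, hu, div_pow _ _ h]
          push_cast
          field_simp
      _ ≤ Real.exp h * (1 / 4) ^ (l - h) := by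
          gcongr
          exact Real.pow_div_factorial_le_exp _ h.cast_nonneg h
  -- Squaring removes the root. Rounding down in `h` is harmless for both factors, since `2h ≤ l ≤
  -- 2(l - h)`.
  refine h1.trans (le_of_sq_le_sq ?_ (by positivity))
  rw [← pow_mul, mul_comm l 2, pow_mul, Real.sq_sqrt (by positivity), div_pow (Real.exp 1),
    ← Real.exp_nat_mul, mul_pow, ← pow_mul, ← Real.exp_nat_mul, mul_one, div_eq_mul_inv _ (4 ^ l),
    ← inv_pow, ← one_div]
  have h2 : (2 : ℕ) * (h : ℝ) ≤ l := by
    have : 2 * h ≤ l := by omega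
    exact_mod_cast this
  refine mul_le_mul (Real.exp_le_exp.2 h2) ?_ (by positivity) (by positivity)
  exact pow_le_pow_of_le_one (by norm_num) (by norm_num) (by omega)

/-- The hypothesis says `m² ≤ (3/e)^k` for positive `m`; multiplied by `(e/4)^k` this leaves
`(3/4)^k`, and `3/4 ≤ (7/8)²`. -/
theorem mul_sqrt_pow_le {m k : ℕ} (h : 2 * Real.logb (3 / Real.exp 1) (m : ℝ) ≤ (k : ℝ)) :
    (m : ℝ) * Real.sqrt (Real.exp 1 / 4) ^ k ≤ (7 / 8) ^ k := by
  rcases Nat.eq_zero_or_pos m with rfl | hm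
  · simp only [Nat.cast_zero, zero_mul]
    positivity
  have he : Real.exp 1 < 3 := Real.exp_one_lt_d9.trans (by norm_num)
  have hb : 1 < 3 / Real.exp 1 := (one_lt_div (Real.exp_pos 1)).2 he
  have hm2 : (m : ℝ) ^ 2 ≤ (3 / Real.exp 1) ^ k := by
    rw [← Real.rpow_natCast _ k, ← Real.logb_le_iff_le_rpow hb (by positivity), Real.logb_pow]
    exact_mod_cast h
  refine le_of_sq_le_sq ?_ (by positivity)
  calc ((m : ℝ) * Real.sqrt (Real.exp 1 / 4) ^ k) ^ 2
      = (m : ℝ) ^ 2 * (Real.exp 1 / 4) ^ k := by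
        rw [mul_pow, ← pow_mul, mul_comm k 2, pow_mul, Real.sq_sqrt (by positivity)]
    _ ≤ (3 / Real.exp 1) ^ k * (Real.exp 1 / 4) ^ k := by gcongr
    _ = (3 / 4) ^ k := by
        rw [← mul_pow]
        congr 1
        have := (Real.exp_pos 1).ne'
        field_simp
    _ ≤ ((7 / 8) ^ k) ^ 2 := by
        rw [← pow_mul, mul_comm k 2, pow_mul]
        gcongr
        norm_num

namespace IBLT

variable {m : ℕ → ℕ} {R : HashFamily m}

theorem _root_.HashFamily.IsTWiseIndependent.toOuterMeasure_le (hR : R.IsTWiseIndependent)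
    (lam : ℕ) (t : ℕ+) (S : Finset (Fin (m lam))) (hS : S.card ≤ t) (y : S → Fin (2 * t)) :
    (R.sample lam t).toOuterMeasure {r | ∀ x : S, R.hash lam t r x = y x} ≤
      ENNReal.ofReal ((1 / (2 * (t : ℕ)) : ℝ) ^ S.card) := by
  -- Independence is stated for prescribed values on all of `[m]`; the values outside `S` are
  -- irrelevant.
  have h := hR lam t S (fun x => if hx : x ∈ S then y ⟨x, hx⟩ else ⟨0, by have := t.pos; omega⟩) hS
  rw [← h, PMF.prob, ENNReal.ofReal_toReal]
  · refine MeasureTheory.measure_mono fun r hr x hx => ?_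
    rw [dif_pos hx]
    exact hr ⟨x, hx⟩
  · exact PMF.toOuterMeasure_ne_top _ _

/-- In some nonempty set of fewer than `t` elements, every element collides with another one in
every row. -/
def Stuck {m k : ℕ} {t : ℕ+} (r : Fin k → Fin m → Fin (2 * t)) : Prop :=
  ∃ D : Finset (Fin m), D.Nonempty ∧ D.card < t ∧
    ∀ i, ∀ x ∈ D, ∃ y ∈ D, y ≠ x ∧ r i y = r i x

/-- The leftover set is a fixed point of `shrink`, so none of its elements is alone in any row. -/
theorem stuck_of_shrink {m k : ℕ} {t : ℕ+} {r : Fin k → Fin m → Fin (2 * t)}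
    {D : Finset (Fin m)} (hcard : D.card < t) (hD : (shrink r)^[m] D ≠ ∅) : Stuck r := by
  refine ⟨_, Finset.nonempty_iff_ne_empty.2 hD, lt_of_le_of_lt (Finset.card_le_card
    (iterate_shrink_subset _ _)) hcard, fun i x hx => ?_⟩
  have hx' := hx
  rw [← shrink_iterate, shrink, Finset.mem_filter] at hx'
  have h := hx'.2
  push Not at h
  obtain ⟨y, hy, h1, h2⟩ := h i
  exact ⟨y, hy, h2, h1⟩

/-- Union bound over all sets of each size `l < t`. Quantifying over every set makes the event
independent of the choices of the adversary, and `l < t` is what makes `t`-wise independence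
applicable. -/
theorem toOuterMeasure_stuck_le (hR : R.IsTWiseIndependent) (lam : ℕ) (t : ℕ+) {k : ℕ}
    (hk : 2 * Real.logb (3 / Real.exp 1) (m lam : ℝ) ≤ (k : ℝ)) :
    ((R.sample lam t).iid k).toOuterMeasure {r | Stuck fun i => R.hash lam t (r i)} ≤
      ENNReal.ofReal (t * (7 / 8) ^ k) := by
  set μ := R.sample lam t
  have hsub : {r : Fin k → Val | Stuck fun i => R.hash lam t (r i)} ⊆
      ⋃ l ∈ Finset.Ico 1 (t : ℕ), ⋃ S ∈ Finset.powersetCard l (Finset.univ : Finset (Fin (m lam))),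
        {r | ∀ i, r i ∈ {ρ | ∀ x ∈ S, ∃ y ∈ S, y ≠ x ∧ R.hash lam t ρ y = R.hash lam t ρ x}} := by
    rintro r ⟨D, hne, hcard, hD⟩
    simp only [Set.mem_iUnion]
    exact ⟨D.card, Finset.mem_Ico.2 ⟨hne.card_pos, hcard⟩, D,
      Finset.mem_powersetCard.2 ⟨Finset.subset_univ _, rfl⟩, hD⟩
  have hset : ∀ S : Finset (Fin (m lam)), S.card ≤ t →
      (μ.iid k).toOuterMeasure
        {r | ∀ i, r i ∈ {ρ | ∀ x ∈ S, ∃ y ∈ S, y ≠ x ∧ R.hash lam t ρ y = R.hash lam t ρ x}} ≤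
      ENNReal.ofReal ((Real.sqrt (Real.exp 1 / 4) ^ S.card) ^ k) := fun S hS => by
    rw [PMF.toOuterMeasure_iid_forall, ENNReal.ofReal_pow (by positivity)]
    refine pow_le_pow_left' ((PMF.toOuterMeasure_collision_le μ (R.hash lam t) S _ (by omega)
      fun y => hR.toOuterMeasure_le lam t S hS y).trans ?_) k
    rw [← ENNReal.ofReal_natCast, ← ENNReal.ofReal_mul (Nat.cast_nonneg _)]
    exact ENNReal.ofReal_le_ofReal (choose_mul_pow_div_le t.pos hS)
  have hsize : ∀ l ∈ Finset.Ico 1 (t : ℕ), (μ.iid k).toOuterMeasure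
      (⋃ S ∈ Finset.powersetCard l (Finset.univ : Finset (Fin (m lam))),
        {r | ∀ i, r i ∈ {ρ | ∀ x ∈ S, ∃ y ∈ S, y ≠ x ∧ R.hash lam t ρ y = R.hash lam t ρ x}}) ≤
      ENNReal.ofReal ((7 / 8) ^ k) := fun l hl => by
    rw [Finset.mem_Ico] at hl
    refine (MeasureTheory.measure_biUnion_finset_le _ _).trans ((Finset.sum_le_sum fun S hS =>
      hset S ((Finset.mem_powersetCard.1 hS).2.trans_le hl.2.le)).trans ?_)
    rw [Finset.sum_congr rfl fun S hS => by rw [(Finset.mem_powersetCard.1 hS).2],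
      Finset.sum_const, nsmul_eq_mul, Finset.card_powersetCard, Finset.card_univ, Fintype.card_fin,
      ← ENNReal.ofReal_natCast, ← ENNReal.ofReal_mul (Nat.cast_nonneg _)]
    refine ENNReal.ofReal_le_ofReal ?_
    calc ((m lam).choose l : ℝ) * (Real.sqrt (Real.exp 1 / 4) ^ l) ^ k
        ≤ (m lam : ℝ) ^ l * (Real.sqrt (Real.exp 1 / 4) ^ l) ^ k := by
          gcongr
          exact_mod_cast Nat.choose_le_pow _ _
      _ = ((m lam : ℝ) * Real.sqrt (Real.exp 1 / 4) ^ k) ^ l := by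
          rw [mul_pow, ← pow_mul, ← pow_mul, mul_comm l k]
      _ ≤ ((7 / 8) ^ k) ^ l := by
          gcongr
          exact mul_sqrt_pow_le hk
      -- Here `l ≥ 1` is needed, that is, the set is not empty.
      _ ≤ (7 / 8) ^ k := pow_le_of_le_one (by positivity)
          (pow_le_one₀ (by norm_num) (by norm_num)) (by omega)
  refine (MeasureTheory.measure_mono hsub).trans
    ((MeasureTheory.measure_biUnion_finset_le _ _).trans ((Finset.sum_le_sum hsize).trans ?_))
  rw [Finset.sum_const, nsmul_eq_mul, Nat.card_Ico, ← ENNReal.ofReal_natCast,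
    ← ENNReal.ofReal_mul (Nat.cast_nonneg _)]
  refine ENNReal.ofReal_le_ofReal ?_
  gcongr
  exact Nat.sub_le _ _

end IBLT

/-! ### The reduction to SIS -/

namespace EfficientlyComputable

variable {α : Type} [Enc α]

/-- Arithmetic in unary: sums are concatenations and products are nested ranges, so all lists have
polynomial length. -/
theorem range_eval (P : Polynomial ℕ) {f : α → Unary} (hf : EfficientlyComputable f) :
    EfficientlyComputable fun a => List.range (P.eval (f a).val) := by
  induction P using Polynomial.induction_on' with
  | add p q hp hq => exact (range (append hp hq)).congr fun a => by simp
  | monomial n c =>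
    induction n with
    | zero => exact (const (List.range c)).congr fun a => by simp
    | succ n ih =>
      refine (range (flatMap (g := fun a _ => List.range (f a).val) (unaryRange (hf.comp id.fst))
        ih)).congr fun a => ?_
      simp [pow_succ, mul_assoc]

end EfficientlyComputable

/-- Move the first entry of a list to another list. -/
def Val.readStep (c : Val × List Val) : Val × List Val := (c.1.snd, c.1.fst :: c.2)

/-- The first `N` entries of a list. -/
def Val.readList (N : ℕ) (v : Val) : List Val :=
  ((List.range N).foldl (fun c _ => Val.readStep c) (v, [])).2.reverse

namespace Val

theorem readList_ofList (l : List Val) : readList l.length (ofList l) = l := by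
  have key : ∀ (l r : List Val) (N : List ℕ), N.length = l.length →
      N.foldl (fun c _ => readStep c) (ofList l, r) = (num 0, l.reverse ++ r) := fun l => by
    induction l with
    | nil => intro r N h; rw [List.length_eq_zero_iff.1 h]; rfl
    | cons x l ih =>
      intro r N h
      obtain ⟨y, N, rfl⟩ := List.exists_cons_of_length_eq_add_one h
      rw [List.foldl_cons]
      refine (ih (x :: r) N (by simpa using h)).trans ?_
      simp
  rw [readList, key l [] _ List.length_range]
  simp

end Val

theorem EfficientlyComputable.readList {α : Type} [Enc α] {N : α → ℕ} {v : α → Val}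
    (hN : EfficientlyComputable fun a => List.range (N a)) (hv : EfficientlyComputable v) :
    EfficientlyComputable fun a => Val.readList (N a) (v a) := by
  have pN := IBLT.polySize_of_range hN
  refine reverse (snd (foldl (l := fun a => List.range (N a)) (b := fun a => (v a, []))
    (step := fun _ c _ => Val.readStep c)
    (B := fun a => encSize (v a) + (N a * (encSize (v a) + 1) + 1) + 1)
    (pair id.snd.snd.fst.valSnd (cons id.snd.snd.fst.valFst id.snd.snd.snd)) hN
    (pair hv (const [])) ((hv.polySize.add ((pN.mul (hv.polySize.add (.const 1))).add
      (.const 1))).add (.const 1)) fun a l₁ l₂ h => ?_))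
  have hlen : l₁.length ≤ N a := by
    have := congrArg List.length h
    simp only [List.length_range, List.length_append] at this
    omega
  clear h
  suffices hs : ∀ l : List ℕ, ∀ c : Val × List Val, c = l.foldl (fun c _ => Val.readStep c) (v a, []) →
      encSize c.1 ≤ encSize (v a) ∧ c.2.length = l.length ∧
      ∀ d ∈ c.2, encSize d ≤ encSize (v a) by
    obtain ⟨h1, h2, h3⟩ := hs l₁ _ rfl
    rw [encSize_prod]
    have h4 := encSize_list_le h3
    rw [h2] at h4
    have h5 := Nat.mul_le_mul_right (encSize (v a) + 1) hlen
    omega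
  intro l
  induction l using List.reverseRecOn with
  | nil => rintro c rfl; simp
  | append_singleton l x ih =>
    rintro c rfl
    rw [List.foldl_append]
    obtain ⟨h1, h2, h3⟩ := ih _ rfl
    refine ⟨(Val.size_snd_le _).trans h1, ?_, ?_⟩
    · exact (congrArg (· + 1) h2).trans (by simp)
    · intro d hd
      rcases List.mem_cons.1 hd with rfl | hd
      · exact (Val.size_fst_le _).trans h1
      · exact h3 d hd

namespace IBLT

/-- The set that is represented by a characteristic vector. -/
def readSet (M : ℕ) (v : Val) (x : ℕ) : Bool :=
  decide ((Val.readList M v).getD x (Val.num 0) = Val.num 1)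

theorem readSet_enc {M : ℕ} (X : Finset (Fin M)) (x : Fin M) :
    readSet M (Enc.enc X) x = decide (x ∈ X) := by
  have h := Val.readList_ofList (List.ofFn fun x : Fin M => Enc.enc (decide (x ∈ X)))
  rw [List.length_ofFn] at h
  rw [readSet, show (Enc.enc X : Val) =
    Val.ofList (List.ofFn fun x : Fin M => Enc.enc (decide (x ∈ X))) from rfl, h, List.getD_ofFn]
  by_cases hx : x ∈ X <;> simp [hx, Enc.enc]

open EfficientlyComputable

variable {n m q k : ℕ → ℕ}

/-- The solution of the SIS problem that the attacker finds if the adversary answers with `v`. -/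
def attack (n m q k : ℕ → ℕ) (g : Val → Val) (c : KeyData) (v : Val) : Val :=
  listSearch (k c.1.val) (2 * c.2.1.val) (n c.1.val) (m c.1.val) (q c.1.val) (c.hash g) c.entry
    (readSet (m c.1.val) v.fst) (readSet (m c.1.val) v.snd)

theorem efficient_attack {g : Val → Val} (hg : PolyFun g)
    (hn : EfficientlyComputable fun lam : Unary => Unary.mk (n lam.val))
    (hm : EfficientlyComputable fun lam : Unary => Unary.mk (m lam.val))
    (hq : EfficientlyComputable fun lam : Unary => q lam.val)
    (hk : EfficientlyComputable fun lam : Unary => Unary.mk (k lam.val)) :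
    EfficientlyComputable fun p : KeyData × Val => attack n m q k g p.1 p.2 := by
  have hlam : EfficientlyComputable fun p : KeyData × Val => p.1.1 := id.fst.fst
  have hX : ∀ {f : KeyData × Val → Val}, EfficientlyComputable f → EfficientlyComputable
      fun p : (KeyData × Val) × ℕ => readSet (m p.1.1.1.val) (f p.1) p.2 := fun hf =>
    decide_eq (getD (readList (unaryRange (hm.comp (hlam.comp id.fst))) (hf.comp id.fst)) id.snd
      (const _)) (const _)
  exact efficient_listSearch (k := fun p : KeyData × Val => k p.1.1.val)
    (T := fun p => 2 * p.1.2.1.val) (n := fun p => n p.1.1.val) (m := fun p => m p.1.1.val)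
    (q := fun p => q p.1.1.val) (r := fun p => p.1.hash g) (A := fun p => p.1.entry)
    (X₀ := fun p => readSet (m p.1.1.val) p.2.fst) (X₁ := fun p => readSet (m p.1.1.val) p.2.snd)
    (unaryRange (hk.comp hlam)) (efficient_range_two_mul id.fst.snd.fst)
    (unaryRange (hn.comp hlam)) (unaryRange (hm.comp hlam)) (hq.comp hlam)
    ((KeyData.efficient_hash hg).comp (id.fst.fst.pair id.snd))
    (KeyData.efficient_entry.comp (id.fst.fst.pair id.snd)) (hX id.snd.valFst) (hX id.snd.valSnd)

/-- The key has to lie in the support, because only there does `g` return the true hash values. -/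
theorem attack_spec [∀ lam, NeZero (q lam)] {g : Val → Val} {R : HashFamily m}
    (hg : Evaluates g R) {lam : ℕ} {t : ℕ+}
    {f : (Fin (k lam) → Val) × Matrix (Fin (n lam)) (Fin (m lam)) (ZMod (q lam))}
    (hf : f ∈ ((setEncoding n m q k R).sample lam t).support) {X₀ X₁ : Finset (Fin (m lam))}
    (hno : ¬∀ c ≤ m lam, NoSolution (fun i => R.hash lam t (f.1 i)) f.2 (signVector X₀ X₁)
      ((shrink fun i => R.hash lam t (f.1 i))^[c] (symmDiff X₀ X₁))) :
    ∃ s : Fin (m lam) → ℤ,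
      attack n m q k g (KeyData.of lam t f) (Enc.enc (X₀, X₁)) = Enc.enc s ∧
      IsSISSolution (Real.sqrt ((m lam : ℝ) + 3)) 3 f.2 s := by
  have h1 : ∀ (i : Fin (k lam)) (x : Fin (m lam)),
      (KeyData.of lam t f).hash g i x = R.hash lam t (f.1 i) x :=
    hg.hash_of (mem_support_sample hf)
  exact listSearch_spec (r' := (KeyData.of lam t f).hash g) (A' := (KeyData.of lam t f).entry)
    (X₀' := readSet (m lam) (Enc.enc X₀)) (X₁' := readSet (m lam) (Enc.enc X₁))
    h1 (KeyData.entry_of lam t f) (readSet_enc X₀) (readSet_enc X₁) hno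

/-- Sample hash functions with `S`, run the adversary `B`, and apply `F` to its answer. -/
noncomputable def attackLaw (k : ℕ → ℕ) (S B : PPT) (F : KeyData → Val → Val)
    (a : Unary × Unary × List (List ℕ)) : PMF Val :=
  (PMF.mapList (fun _ => S.law (Enc.enc (a.1, a.2.1))) (List.range (k a.1.val))).bind fun r =>
    (B.law (Enc.enc (a.1, a.2.1, r, a.2.2))).map (F (a.1, a.2.1, r, a.2.2))

theorem polyTimeLaw_attackLaw {S B : PPT} {F : KeyData → Val → Val}
    (hF : EfficientlyComputable fun p : KeyData × Val => F p.1 p.2)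
    (hk : EfficientlyComputable fun lam : Unary => Unary.mk (k lam.val)) :
    PolyTimeLaw (attackLaw k S B F) := by
  have hS : PolyTimeLaw fun a : Unary × Unary => S.law (Enc.enc a) :=
    ⟨S, fun a => (PMF.map_id _).symm⟩
  have hB : PolyTimeLaw fun a : KeyData => B.law (Enc.enc a) :=
    ⟨B, fun a => (PMF.map_id _).symm⟩
  have hkey : EfficientlyComputable fun p : (Unary × Unary × List (List ℕ)) × List Val =>
      ((p.1.1, p.1.2.1, p.2, p.1.2.2) : KeyData) :=
    id.fst.fst.pair (id.fst.snd.fst.pair (id.snd.pair id.fst.snd.snd))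
  refine PolyTimeLaw.bind (PolyTimeLaw.mapList
    (hS.comp (id.fst.fst.pair id.fst.snd.fst)) (unaryRange (hk.comp id.fst)))
    (PolyTimeLaw.map (hB.comp hkey) (g := fun p v => F (p.1.1, p.1.2.1, p.2, p.1.2.2) v) ?_)
  exact hF.comp ((hkey.comp id.fst).pair id.snd)

/-- The law `attackLaw` for a random threshold of at most `P.eval lam + 1`. -/
noncomputable def guessLaw (k : ℕ → ℕ) (P : Polynomial ℕ) (S B : PPT) (F : KeyData → Val → Val)
    (a : Unary × List (List ℕ)) : PMF Val :=
  ((PMF.uniformOfFintype (Fin (P.eval a.1.val + 1))).map Fin.val).bind fun t =>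
    attackLaw k S B F (a.1, Unary.mk (t + 1), a.2)

/-- The guess is drawn in binary but handed over in unary. Unfolding an arbitrary binary number
takes exponential time; instead the indices below both `P.eval lam` and the guess are counted. -/
theorem polyTimeLaw_guessLaw (P : Polynomial ℕ) {S B : PPT} {F : KeyData → Val → Val}
    (hF : EfficientlyComputable fun p : KeyData × Val => F p.1 p.2)
    (hk : EfficientlyComputable fun lam : Unary => Unary.mk (k lam.val)) :
    PolyTimeLaw (guessLaw k P S B F) := by
  have hrange : EfficientlyComputable fun a : Unary × List (List ℕ) =>
      List.range (P.eval a.1.val) := range_eval P id.fst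
  have hunary : EfficientlyComputable fun p : (Unary × List (List ℕ)) × ℕ =>
      Unary.mk (((List.range (P.eval p.1.1.val)).filter fun i => decide (i + 1 - p.2 = 0)).length +
        1) :=
    (unaryLength (cons (const 0) (filter
      (p := fun (p : (Unary × List (List ℕ)) × ℕ) i => decide (i + 1 - p.2 = 0))
      (decide_eq (natSub (natAdd id.snd (const 1)) id.fst.snd) (const 0))
      (hrange.comp id.fst)))).congr fun p => by rw [List.length_cons]
  have hlaw := PolyTimeLaw.bind (PolyTimeLaw.uniform ((length hrange).congr fun a =>
      List.length_range))
    (g := fun a t => attackLaw k S B F (a.1, Unary.mk (((List.range (P.eval a.1.val)).filter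
      fun i => decide (i + 1 - t = 0)).length + 1), a.2))
    ((polyTimeLaw_attackLaw hF hk).comp (id.fst.fst.pair (hunary.pair id.fst.snd)))
  refine hlaw.congr fun a => PMF.bind_congr_support fun t ht => ?_
  obtain ⟨t, -, rfl⟩ := (PMF.mem_support_map_iff _ _ _).1 ht
  have hcount : ((List.range (P.eval a.1.val)).filter fun i => decide (i + 1 - (t : ℕ) = 0)).length =
      t := by
    have ht := t.2
    generalize (t : ℕ) = t' at ht ⊢
    rw [← List.countP_eq_length_filter]
    -- With truncated subtraction, `i + 1 - t' = 0` expresses `i < t'`.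
    have : ∀ N, (List.range N).countP (fun i => decide (i + 1 - t' = 0)) = min N t' := fun N => by
      induction N with
      | zero => simp
      | succ N ih =>
        rw [List.range_succ, List.countP_append, ih, List.countP_singleton]
        split_ifs with h
        · have := of_decide_eq_true h
          omega
        · have : ¬(N + 1 - t' = 0) := fun h' => h (decide_eq_true h')
          omega
    rw [this]
    omega
  rw [hcount]

variable [∀ lam, NeZero (q lam)]

/-- With the right threshold, the adversary receives exactly the input that it receives in the
robustness experiment. -/
theorem attackLaw_eq {S B : PPT} {F : KeyData → Val → Val} {R : HashFamily m} (lam : ℕ) (t : ℕ+)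
    (hS : S.law (Enc.enc (Unary.mk lam, Unary.mk t)) = R.sample lam t)
    (A : Matrix (Fin (n lam)) (Fin (m lam)) (ZMod (q lam))) :
    attackLaw k S B F
      (Unary.mk lam, Unary.mk t, List.ofFn fun a => List.ofFn fun x => (A a x).val) =
    ((R.sample lam t).iid (k lam)).bind fun r =>
      (B.law (Enc.enc (Unary.mk lam, Unary.mk t, (r, A)))).map
        (F (KeyData.of lam t (r, A))) := by
  simp only [attackLaw]
  rw [hS, ← PMF.map_ofFn_iid _ List.length_range, PMF.bind_map]
  refine congrArg _ (funext fun r => ?_)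
  have h : Enc.enc (Unary.mk lam, Unary.mk t, (r, A)) = Enc.enc ((Unary.mk lam, Unary.mk t,
      List.ofFn r, List.ofFn fun a => List.ofFn fun x => (A a x).val) : KeyData) :=
    congrArg (fun v => Val.pair _ (Val.pair _ v)) (KeyData.enc_key (r, A))
  rw [h]
  rfl

end IBLT

/-! ### Bounding the advantage of an adversary -/

theorem PMF.prob_nonneg {Ω : Type} (μ : PMF Ω) (E : Set Ω) : 0 ≤ μ.prob E := ENNReal.toReal_nonneg

theorem PMF.ofReal_prob {Ω : Type} (μ : PMF Ω) (E : Set Ω) :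
    ENNReal.ofReal (μ.prob E) = μ.toOuterMeasure E :=
  ENNReal.ofReal_toReal (μ.toOuterMeasure_ne_top E)

/-- The price of guessing: one component of a uniform mixture is at most as many times as likely as
the mixture as there are components. -/
theorem PMF.toOuterMeasure_le_mul_bind {α β : Type} [Fintype α] [Nonempty α] (f : α → PMF β) (a : α)
    (E : Set β) : (f a).toOuterMeasure E ≤
      Fintype.card α * ((uniformOfFintype α).bind f).toOuterMeasure E := by
  rw [toOuterMeasure_bind_apply, ← ENNReal.tsum_mul_left]
  refine le_trans (le_of_eq ?_) (ENNReal.le_tsum a)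
  rw [uniformOfFintype_apply, ← mul_assoc, ENNReal.mul_inv_cancel
    (Nat.cast_ne_zero.2 Fintype.card_ne_zero) (ENNReal.natCast_ne_top _), one_mul]

namespace IBLT

variable {n m q k : ℕ → ℕ} [∀ lam, NeZero (q lam)] {R : HashFamily m}

/-- The law of a uniformly random instance and the answer of the attacker. -/
noncomputable def instanceLaw (n m q k : ℕ → ℕ) [∀ lam, NeZero (q lam)] (S B : PPT)
    (F : KeyData → Val → Val) (lam t : ℕ) :
    PMF (Matrix (Fin (n lam)) (Fin (m lam)) (ZMod (q lam)) × Val) :=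
  (PMF.uniformOfFintype (Matrix (Fin (n lam)) (Fin (m lam)) (ZMod (q lam)))).bind fun A =>
    (attackLaw k S B F (Unary.mk lam, Unary.mk t,
      List.ofFn fun a => List.ofFn fun x => (A a x).val)).map fun v => (A, v)

/-- The guess is independent of the instance and may be drawn before it. -/
theorem experiment_guessLaw {P : Polynomial ℕ} {S B D : PPT} {F : KeyData → Val → Val}
    (hD : ∀ a, D.law (Enc.enc a) = (guessLaw k P S B F a).map Enc.enc) (lam : ℕ) :
    D.experiment
      (PMF.uniformOfFintype (Matrix (Fin (n lam)) (Fin (m lam)) (ZMod (q lam))))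
      (fun A => Enc.enc (Unary.mk lam, A)) =
    (PMF.uniformOfFintype (Fin (P.eval lam + 1))).bind fun t =>
      instanceLaw n m q k S B F lam (t + 1) := by
  simp only [instanceLaw]
  rw [PMF.bind_comm, PPT.experiment]
  refine congrArg _ (funext fun A => ?_)
  have h : Enc.enc (Unary.mk lam, A) = Enc.enc (Unary.mk lam,
      List.ofFn fun a => List.ofFn fun x => (A a x).val) :=
    congrArg (Val.pair _) (Enc.enc_matrix_eq A)
  rw [h, hD, guessLaw, PMF.bind_map, ← PMF.map_bind]
  congr 1
  exact PMF.map_id _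

/-- The hash functions and the matrix are independent, so the SIS instance can come first and the
hash functions can be sampled by the attacker. -/
theorem map_experiment {S B : PPT} {F : KeyData → Val → Val} (lam : ℕ) (t : ℕ+)
    (hS : S.law (Enc.enc (Unary.mk lam, Unary.mk t)) = R.sample lam t) :
    (B.experiment ((setEncoding n m q k R).sample lam t)
      (fun f => Enc.enc (Unary.mk lam, Unary.mk t, f))).map
      (fun z => (z.1.2, F (KeyData.of lam t z.1) z.2)) = instanceLaw n m q k S B F lam t := by
  simp only [instanceLaw, attackLaw_eq (n := n) (m := m) (q := q) (k := k) (R := R) lam t hS,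
    PPT.experiment, setEncoding, PMF.bind_bind, PMF.bind_map, PMF.map_bind, PMF.map_comp]
  rw [PMF.bind_comm]
  exact congrArg _ (funext fun A => congrArg _ (funext fun r => PMF.map_comp ..))

theorem map_experiment_fst (B : PPT) (lam : ℕ) (t : ℕ+) :
    (B.experiment ((setEncoding n m q k R).sample lam t)
      (fun f => Enc.enc (Unary.mk lam, Unary.mk t, f))).map (fun z => z.1.1) =
    (R.sample lam t).iid (k lam) := by
  simp only [PPT.experiment, setEncoding, PMF.bind_bind, PMF.bind_map, PMF.map_bind]
  refine (congrArg _ (funext fun r => ?_)).trans (PMF.bind_pure _)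
  refine (congrArg _ (funext fun A => ?_)).trans (PMF.bind_const _ (PMF.pure r))
  exact (PMF.map_comp ..).trans (PMF.map_const _ _)

/-- An event that implies that there is a solution among the candidates, or that the hash
functions collide, is unlikely. -/
theorem advantage_le {P : Polynomial ℕ} {S B D : PPT} {g : Val → Val} (hg : Evaluates g R)
    (hS : ∀ (lam : ℕ) (t : ℕ+),
      S.law (Enc.enc (Unary.mk lam, Unary.mk t)) = R.sample lam t)
    (hD : ∀ a, D.law (Enc.enc a) = (guessLaw k P S B (attack n m q k g) a).map Enc.enc)
    (hR : R.IsTWiseIndependent) (lam : ℕ) (t : ℕ+) (ht : (t : ℕ) ≤ P.eval lam)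
    (hk : 2 * Real.logb (3 / Real.exp 1) (m lam : ℝ) ≤ (k lam : ℝ))
    (Bad : (setEncoding n m q k R).Key lam t → Finset (Fin (m lam)) → Finset (Fin (m lam)) → Prop)
    (hBad : ∀ f X₀ X₁, Bad f X₀ X₁ →
      (¬∀ c ≤ m lam, NoSolution (fun i => R.hash lam t (f.1 i)) f.2 (signVector X₀ X₁)
        ((shrink fun i => R.hash lam t (f.1 i))^[c] (symmDiff X₀ X₁))) ∨
      Stuck fun i => R.hash lam t (f.1 i)) :
    (setEncoding n m q k R).advantage B lam t Bad ≤
      (P.eval lam + 1 : ℕ) * (D.experiment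
        (PMF.uniformOfFintype (Matrix (Fin (n lam)) (Fin (m lam)) (ZMod (q lam))))
        (fun A => Enc.enc (Unary.mk lam, A))).prob
        {z | ∃ s : Fin (m lam) → ℤ, z.2 = Enc.enc s ∧
          IsSISSolution (Real.sqrt ((m lam : ℝ) + 3)) 3 z.1 s} + t * (7 / 8) ^ k lam := by
  set μ := B.experiment ((setEncoding n m q k R).sample lam t)
    (fun f => Enc.enc (Unary.mk lam, Unary.mk t, f)) with hμ
  set Sol : Set (Matrix (Fin (n lam)) (Fin (m lam)) (ZMod (q lam)) × Val) :=
    {z | ∃ s : Fin (m lam) → ℤ, z.2 = Enc.enc s ∧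
      IsSISSolution (Real.sqrt ((m lam : ℝ) + 3)) 3 z.1 s} with hSol
  rw [SetEncoding.advantage, ← ENNReal.ofReal_le_ofReal_iff (add_nonneg (mul_nonneg
    (Nat.cast_nonneg _) (PMF.prob_nonneg _ _)) (by positivity)), PMF.ofReal_prob,
    ENNReal.ofReal_add (mul_nonneg (Nat.cast_nonneg _) (PMF.prob_nonneg _ _)) (by positivity),
    ENNReal.ofReal_mul (Nat.cast_nonneg _), ENNReal.ofReal_natCast, PMF.ofReal_prob,
    experiment_guessLaw hD]
  have hcard : Fintype.card (Fin (P.eval lam + 1)) = P.eval lam + 1 := Fintype.card_fin _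
  have htm : (t : ℕ) - 1 < P.eval lam + 1 := by omega
  -- The guess `t - 1` stands for the threshold `t`, which is at least one.
  have h1 := PMF.toOuterMeasure_le_mul_bind (fun t : Fin (P.eval lam + 1) =>
    instanceLaw n m q k S B (attack n m q k g) lam (t + 1)) ⟨t - 1, htm⟩ Sol
  rw [hcard, Nat.sub_add_cancel t.pos, ← map_experiment lam t (hS lam t),
    PMF.toOuterMeasure_map_apply] at h1
  have h2 := toOuterMeasure_stuck_le (m := m) hR lam t hk
  rw [← map_experiment_fst (n := n) (q := q) B, PMF.toOuterMeasure_map_apply] at h2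
  -- The inclusion of events is needed only on the support; this provides the sampled key that
  -- `attack_spec` requires.
  refine le_trans (le_trans (PMF.toOuterMeasure_mono μ ?_) (MeasureTheory.measure_union_le _ _))
    (add_le_add h1 h2)
  rintro ⟨f, v⟩ ⟨⟨X₀, X₁, hv, hb⟩, hmem⟩
  simp only at hv
  subst hv
  rcases hBad f X₀ X₁ hb with h | h
  · refine Or.inl (attack_spec hg ?_ h)
    rw [hμ, PPT.experiment, PMF.mem_support_bind_iff] at hmem
    obtain ⟨f', hf', hmem⟩ := hmem
    obtain ⟨v, -, h⟩ := (PMF.mem_support_map_iff _ _ _).1 hmem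
    rwa [← (Prod.mk.inj h).1]
  · exact Or.inr h

end IBLT

/-! ### Negligible functions -/

theorem Polynomial.exists_eval_le_pow (P : Polynomial ℕ) :
    ∃ d N : ℕ, ∀ x : ℕ, N < x → P.eval x < x ^ d := by
  induction P using Polynomial.induction_on' with
  | add p q hp hq =>
    obtain ⟨d, N, hp⟩ := hp
    obtain ⟨e, M, hq⟩ := hq
    refine ⟨max d e + 1, max 2 (max N M), fun x hx => ?_⟩
    have hx1 : 0 < x := by omega
    have h1 := (hp x (by omega)).trans_le (Nat.pow_le_pow_right hx1 (le_max_left d e))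
    have h2 := (hq x (by omega)).trans_le (Nat.pow_le_pow_right hx1 (le_max_right d e))
    rw [Polynomial.eval_add, pow_succ]
    have h3 : x ^ max d e * 2 ≤ x ^ max d e * x := Nat.mul_le_mul_left _ (by omega)
    omega
  | monomial n a =>
    refine ⟨n + 1, a, fun x hx => ?_⟩
    rw [Polynomial.eval_monomial, pow_succ, mul_comm]
    exact Nat.mul_lt_mul_of_pos_left hx (Nat.pow_pos (by omega))

theorem Negligible.mono {f g : ℕ → ℝ} (hg : Negligible g) (h : ∀ lam, 0 < lam → f lam ≤ g lam) :
    Negligible f := fun c => by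
  obtain ⟨N, hN⟩ := hg c
  exact ⟨N, fun lam hlam => (h lam (by omega)).trans_lt (hN lam hlam)⟩

theorem Negligible.add {f g : ℕ → ℝ} (hf : Negligible f) (hg : Negligible g) :
    Negligible fun lam => f lam + g lam := fun c => by
  -- The extra power of `lam ≥ 2` absorbs the factor two.
  obtain ⟨N, hN⟩ := hf (c + 1)
  obtain ⟨M, hM⟩ := hg (c + 1)
  refine ⟨max 1 (max N M), fun lam hlam => ?_⟩
  have h1 := hN lam (by omega)
  have h2 := hM lam (by omega)
  have hl : (2 : ℝ) ≤ lam := by exact_mod_cast (by omega : 2 ≤ lam)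
  have h3 : 2 * (1 / (lam : ℝ) ^ (c + 1)) ≤ 1 / (lam : ℝ) ^ c := by
    rw [mul_one_div, div_le_div_iff₀ (by positivity) (by positivity), pow_succ]
    nlinarith [pow_pos (by linarith : (0 : ℝ) < lam) c]
  linarith

theorem Negligible.polynomial_mul {f : ℕ → ℝ} (hf : Negligible f) (P : Polynomial ℕ) :
    Negligible fun lam => ((P.eval lam : ℕ) : ℝ) * f lam := fun c => by
  obtain ⟨d, N, hP⟩ := P.exists_eval_le_pow
  obtain ⟨M, hM⟩ := hf (c + d)
  refine ⟨max N M, fun lam hlam => ?_⟩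
  have h0 : (0 : ℝ) < lam := by exact_mod_cast (by omega : 0 < lam)
  have h1 : ((P.eval lam : ℕ) : ℝ) < (lam : ℝ) ^ d := by exact_mod_cast hP lam (by omega)
  calc ((P.eval lam : ℕ) : ℝ) * f lam ≤ ((P.eval lam : ℕ) : ℝ) * (1 / (lam : ℝ) ^ (c + d)) := by
        gcongr
        exact (hM lam (by omega)).le
    _ < (lam : ℝ) ^ d * (1 / (lam : ℝ) ^ (c + d)) := by gcongr
    _ = 1 / (lam : ℝ) ^ c := by
        rw [pow_add]
        field_simp

theorem Negligible.geometric {r : ℝ} (h0 : 0 ≤ r) (h1 : r < 1) : Negligible fun lam => r ^ lam :=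
  fun c => by
  have h := tendsto_pow_const_mul_const_pow_of_lt_one c h0 h1
  obtain ⟨N, hN⟩ := Filter.eventually_atTop.1 (h.eventually (gt_mem_nhds one_pos))
  refine ⟨N, fun lam hlam => ?_⟩
  have hl : (0 : ℝ) < lam := by exact_mod_cast (by omega : 0 < lam)
  rw [lt_div_iff₀ (by positivity), mul_comm]
  exact hN lam hlam.le


/-! ### Conclusion -/

namespace IBLT

variable {n m q k : ℕ → ℕ} [∀ lam, NeZero (q lam)] {R : HashFamily m}

/-- Serves both claims of the theorem: for a bad event it suffices that it forces a kernel candidate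
or colliding hash functions. The first alternative costs a polynomial factor against SIS, the second
is exponentially small in `k ≥ lam`. -/
theorem negligible_advantage
    (hn : EfficientlyComputable fun lam : Unary => Unary.mk (n lam.val))
    (hm : EfficientlyComputable fun lam : Unary => Unary.mk (m lam.val))
    (hq : EfficientlyComputable fun lam : Unary => q lam.val)
    (hk : EfficientlyComputable fun lam : Unary => Unary.mk (k lam.val))
    (hReff : R.Efficient) (hRind : R.IsTWiseIndependent)
    (hkge : ∀ lam : ℕ,
      max (lam : ℝ) (2 * Real.logb (3 / Real.exp 1) (m lam : ℝ)) ≤ (k lam : ℝ))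
    (hSIS : SISHard n m q (fun lam => Real.sqrt ((m lam : ℝ) + 3)) (fun _ => 3))
    (B : PPT) (t : ℕ → ℕ+) (ht : PolyBounded t)
    (Bad : (lam : ℕ) → (setEncoding n m q k R).Key lam (t lam) → Finset (Fin (m lam)) →
      Finset (Fin (m lam)) → Prop)
    (hBad : ∀ lam, 0 < k lam → ∀ f X₀ X₁, Bad lam f X₀ X₁ →
      (¬∀ c ≤ m lam, NoSolution (fun i => R.hash lam (t lam) (f.1 i)) f.2 (signVector X₀ X₁)
        ((shrink fun i => R.hash lam (t lam) (f.1 i))^[c] (symmDiff X₀ X₁))) ∨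
      Stuck fun i => R.hash lam (t lam) (f.1 i)) :
    Negligible fun lam => (setEncoding n m q k R).advantage B lam (t lam) (Bad lam) := by
  obtain ⟨P, hP⟩ := ht
  obtain ⟨g, hg, hgR⟩ := exists_evaluates hReff
  obtain ⟨S, hS⟩ := hReff.1
  obtain ⟨D, hD⟩ := polyTimeLaw_guessLaw (k := k) P (S := S) (B := B)
    (efficient_attack hg hn hm hq hk) hk
  refine (((hSIS D).polynomial_mul (P + 1)).add ((Negligible.geometric (r := 7 / 8) (by norm_num)
    (by norm_num)).polynomial_mul P)).mono fun lam hlam => ?_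
  -- This gives the geometric decay in `lam` and, for positive `lam`, also the positivity of `k`.
  have hkl : lam ≤ k lam := by exact_mod_cast (le_max_left _ _).trans (hkge lam)
  refine (advantage_le hgR hS hD hRind lam (t lam) (hP lam)
    ((le_max_right _ _).trans (hkge lam)) (Bad lam) (hBad lam (hlam.trans_le hkl))).trans
    (add_le_add (le_of_eq (by rw [Polynomial.eval_add, Polynomial.eval_one])) ?_)
  exact mul_le_mul (by exact_mod_cast hP lam)
    (pow_le_pow_of_le_one (by norm_num) (by norm_num) hkl) (by positivity) (by positivity)

end IBLT

theorem mainTheorem1 (n m q k : ℕ → ℕ) [∀ lam, NeZero (q lam)]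
    (hn : EfficientlyComputable fun lam : Unary => Unary.mk (n lam.val))
    (hm : EfficientlyComputable fun lam : Unary => Unary.mk (m lam.val))
    (hq : EfficientlyComputable fun lam : Unary => q lam.val)
    (hk : EfficientlyComputable fun lam : Unary => Unary.mk (k lam.val))
    (R : HashFamily m) (hReff : R.Efficient) (hRind : R.IsTWiseIndependent)
    (hkge : ∀ lam : ℕ,
      max (lam : ℝ) (2 * Real.logb (3 / Real.exp 1) (m lam : ℝ)) ≤ (k lam : ℝ))
    (hSIS : SISHard n m q (fun lam => Real.sqrt ((m lam : ℝ) + 3)) (fun _ => 3)) :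
    (IBLT.setEncoding n m q k R).IsRobustSetEncoding ∧
    ∀ (B : PPT) (t : ℕ → ℕ+), PolyBounded t →
      Negligible fun lam =>
        (IBLT.setEncoding n m q k R).advantage B lam (t lam) fun f X₀ X₁ =>
          IBLT.decodeLoop (fun i => R.hash lam (t lam) (f.1 i)) f.2 (m lam + 1)
            (IBLT.encode (fun i => R.hash lam (t lam) (f.1 i)) f.2 X₀ -
              IBLT.encode (fun i => R.hash lam (t lam) (f.1 i)) f.2 X₁) ∅ = none := by
  refine ⟨⟨IBLT.sample_efficient hReff hn hm hq hk, IBLT.encode_efficient hReff hn hm hq hk,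
    IBLT.decode_efficient hReff hn hm hq hk, fun B t ht => ?_⟩, fun B t ht => ?_⟩
  · refine IBLT.negligible_advantage hn hm hq hk hReff hRind hkge hSIS B t ht _
      fun lam hk0 f X₀ X₁ hb => ?_
    by_contra hcon
    rw [not_or, not_not] at hcon
    obtain ⟨-, h⟩ := IBLT.decode_spec hk0 hcon.1
    rcases hb with ⟨X', hX', hne⟩ | ⟨hcard, hnone⟩
    · rcases h with h | ⟨h, -⟩
      · exact hne (Option.some.inj (hX'.symm.trans h))
      · exact Option.some_ne_none X' (hX'.symm.trans h)
    · rcases h with h | ⟨-, h⟩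
      · exact Option.some_ne_none _ (h.symm.trans hnone)
      · exact hcon.2 (IBLT.stuck_of_shrink hcard h)
  -- Only the first alternative occurs: without kernel candidates the loop ends for all hash
  -- functions and all sets.
  · refine IBLT.negligible_advantage hn hm hq hk hReff hRind hkge hSIS B t ht _
      fun lam hk0 f X₀ X₁ hb => Or.inl fun hno => ?_
    exact (IBLT.decode_spec hk0 hno).1 hb
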